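/- **Theorem (convergence of the Crank–Nicolson–tempered-WSGD scheme).** Let $1<\alpha<2$, $\lambda\ge 0$, $a<b$, $T>0$, and $l,r\ge 0$ with $l+r=1$. For $1<\alpha<2$ let $${}_aD_x^{\alpha,\lambda}v(x)=\frac{e^{-\lambda x}}{\Gamma(2-\alpha)}\frac{d^2}{dx^2}\int_a^x\frac{e^{\lambda\xi}v(\xi)}{(x-\xi)^{\alpha-1}}\,d\xi,\qquad {}_xD_b^{\alpha,\lambda}v(x)=\frac{e^{\lambda x}}{\Gamma(2-\alpha)}\frac{d^2}{dx^2}\int_x^b\frac{e^{-\lambda\xi}v(\xi)}{(\xi-x)^{\alpha-1}}\,d\xi,$$ $${}_a\mathbf D_x^{\alpha,\lambda}v={}_aD_x^{\alpha,\lambda}v-\alpha\lambda^{\alpha-1}v'-\lambda^\alpha v,\qquad {}_x\mathbf D_b^{\alpha,\lambda}v={}_xD_b^{\alpha,\lambda}v+\alpha\lambda^{\alpha-1}v'-\lambda^\alpha v.$$ Let $u$ be a solution of $$\partial_t u=\big(l\,{}_a\mathbf D_x^{\alpha,\lambda}+r\,{}_x\mathbf D_b^{\alpha,\lambda}\big)u+s(x,t)\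 \text{ on }(a,b)\times[0,T],$$ $$u(x,0)=u_0(x)\ (a<x<b),\qquad u(a,t)=\phi_l(t),\quad u(b,t)=\phi_r(t)\ (0\le t\le T),$$ where $\phi_l\equiv0$ if $l\ne0$ and $\phi_r\equiv 0$ if $r\neq 0$. Assume that $u$ is sufficiently smooth in the following sense: if $l\ne0$, then $u$, extended by zero to $x<a$, is $C^4$ in $(x,t)$ on $(-\infty,b]\times[0,T]$; if $r\neq0$, then $u$, extended by zero to $x>b$, is $C^4$ in $(x,t)$ on $[a,\infty)\times[0,T]$. Let the real weights $(\gamma_1,\gamma_2,\gamma_3)$ satisfy one of the following. * ($\mathcal S_1^\alpha$) $\gamma_2=\frac{2+\alpha}{2}-2\gamma_1$, $\gamma_3=\gamma_1-\frac\alpha2$, and $\max\big\{\frac{2(\alpha^2+3\alpha-4)}{\alpha^2+3\alpha+2},\frac{\alpha^2+3\alpha}{\alpha^2+3\alpha+4}\big\}\le\gamma_1\le\frac{3(\alpha^2+3\alpha-2)}{2(\alpha^2+3\alpha+2)}$; * ($\mathcal S_2^\alpha$) $\gamma_1=\frac{2+\alpha}{4}-\frac{\gamma_2}{2}$, $\gamma_3=\frac{2-\alpha}{4}-\frac{\gamma_2}2$,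 and $\frac{(\alpha-4)(\alpha^2+3\alpha+2)+24}{2(\alpha^2+3\alpha+2)}\le\gamma_2\le\min\big\{\frac{(\alpha-2)(\alpha^2+3\alpha+4)+16}{2(\alpha^2+3\alpha+4)},\frac{(\alpha-6)(\alpha^2+3\alpha+2)+48}{2(\alpha^2+3\alpha+2)}\big\}$; * ($\mathcal S_3^\alpha$) $\gamma_1=\frac\alpha2+\gamma_3$, $\gamma_2=\frac{2-\alpha}{2}-2\gamma_3$, and $\max\big\{\frac{(2-\alpha)(\alpha^2+\alpha-8)}{2(\alpha^2+3\alpha+2)},\frac{(1-\alpha)(\alpha^2+2\alpha)}{2(\alpha^2+3\alpha+4)}\big\}\le\gamma_3\le\frac{(2-\alpha)(\alpha^2+2\alpha-3)}{2(\alpha^2+3\alpha+2)}$. For integers $N_x,N_t\ge1$ put $h=(b-a)/N_x$, $\tau=T/N_t$, $x_j=a+jh$, $t_n=n\tau$, $t_{n+1/2}=(n+\frac12)\tau$, and with $w_k=(-1)^k\binom{\alpha}{k}$ set $$g_0=\gamma_1w_0e^{h\lambda},\quad g_1=\gamma_1w_1+\gamma_2w_0,\quad g_k=(\gamma_1w_k+\gamma_2w_{k-1}+\gamma_3w_{k-2})e^{-(k-1)h\lambda}\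 (k\ge2),$$ $$\kappa=(\gamma_1e^{h\lambda}+\gamma_2+\gamma_3e^{-h\lambda})(1-e^{-h\lambda})^\alpha,$$ $$(\mathcal D_LV)_j=\frac1{h^\alpha}\Big(\sum_{k=0}^{j+1}g_kV_{j-k+1}-\kappa V_j\Big),\qquad (\mathcal D_RV)_j=\frac1{h^\alpha}\Big(\sum_{k=0}^{N_x-j+1}g_kV_{j+k-1}-\kappa V_j\Big).$$ Let $U_j^n$ ($0\le j\le N_x$, $0\le n\le N_t$) solve the Crank–Nicolson–tempered-WSGD scheme: $U_j^0=u_0(x_j)$ for $1\le j\le N_x-1$, $U_0^n=\phi_l(t_n)$ and $U_{N_x}^n=\phi_r(t_n)$ for $0\le n\le N_t$, and, for $0\le n<N_t$ and $1\le j\le N_x-1$, with $U^{n+1/2}=(U^n+U^{n+1})/2$, $$U_j^{n+1}-l\tau(\mathcal D_LU^{n+1/2})_j-r\tau(\mathcal D_RU^{n+1/2})_j+\tau\alpha\lambda^{\alpha-1}(l-r)\frac{U_{j+1}^{n+1/2}-U_{j-1}^{n+1/2}}{2h}=U_j^n+\tau\,s(x_j,t_{n+1/2}).$$ Then there is a constant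 $c>0$, independent of $N_x$, $N_t$, $n$ and $U$, such that, with $u_j^n=u(x_j,t_n)$ and $\|v\|_h=\big(h\sum_{j=1}^{N_x-1}v_j^2\big)^{1/2}$, $$\|u^n-U^n\|_h\le c(\tau^2+h^2)\qquad\text{for all }1\le n\le N_t .$$ -/

import Mathlib

open Set

noncomputable section

namespace TemperedDiffusion

/-- Left Riemann-Liouville tempered fractional derivative of order `α ∈ (n-1, n)`. -/
def leftTempered (n : ℕ) (α lam a : ℝ) (v : ℝ → ℝ) (x : ℝ) : ℝ :=
  Real.exp (-(lam * x)) / Real.Gamma (n - α) *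
    iteratedDeriv n
      (fun y => ∫ ξ in a..y, Real.exp (lam * ξ) * v ξ / (y - ξ) ^ (α - n + 1)) x

/-- Right Riemann-Liouville tempered fractional derivative of order `α ∈ (n-1, n)`. -/
def rightTempered (n : ℕ) (α lam b : ℝ) (v : ℝ → ℝ) (x : ℝ) : ℝ :=
  (-1) ^ n * Real.exp (lam * x) / Real.Gamma (n - α) *
    iteratedDeriv n
      (fun y => ∫ ξ in y..b, Real.exp (-(lam * ξ)) * v ξ / (ξ - y) ^ (α - n + 1)) x

/-- Variant of the left tempered derivative, for `1 < α < 2`. -/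
def leftVariant (α lam a : ℝ) (v : ℝ → ℝ) (x : ℝ) : ℝ :=
  leftTempered 2 α lam a v x - α * lam ^ (α - 1) * deriv v x - lam ^ α * v x

/-- Variant of the right tempered derivative, for `1 < α < 2`. -/
def rightVariant (α lam b : ℝ) (v : ℝ → ℝ) (x : ℝ) : ℝ :=
  rightTempered 2 α lam b v x + α * lam ^ (α - 1) * deriv v x - lam ^ α * v x

/-- `u x t` is a classical solution of the initial boundary value problem for the tempered
fractional diffusion equation on `(a, b) × [0, T]` (at `t = 0` and `t = T` the time derivative is
one-sided). -/
structure IsExactSolution (α lam a b T l r : ℝ) (s : ℝ → ℝ → ℝ) (u₀ φl φr : ℝ → ℝ)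
    (u : ℝ → ℝ → ℝ) : Prop where
  equation : ∀ x ∈ Ioo a b, ∀ t ∈ Icc 0 T,
    HasDerivWithinAt (fun t' => u x t')
      (l * leftVariant α lam a (fun y => u y t) x
        + r * rightVariant α lam b (fun y => u y t) x + s x t) (Icc 0 T) t
  initial : ∀ x ∈ Ioo a b, u x 0 = u₀ x
  boundary_left : ∀ t ∈ Icc 0 T, u a t = φl t
  boundary_right : ∀ t ∈ Icc 0 T, u b t = φr t

/-- `u`, extended by zero to the left of `a`. -/
def zeroExtLeft (a : ℝ) (u : ℝ → ℝ → ℝ) (p : ℝ × ℝ) : ℝ :=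
  if p.1 < a then 0 else u p.1 p.2

/-- `u`, extended by zero to the right of `b`. -/
def zeroExtRight (b : ℝ) (u : ℝ → ℝ → ℝ) (p : ℝ × ℝ) : ℝ :=
  if b < p.1 then 0 else u p.1 p.2

/-- Smoothness of the exact solution: on each side on which the nonlocal operator is active, the
extension by zero across that endpoint is four times continuously differentiable in `(x, t)`, up
to the boundary. -/
def IsSufficientlySmooth (a b T l r : ℝ) (u : ℝ → ℝ → ℝ) : Prop :=
  (l ≠ 0 → ContDiffOn ℝ 4 (zeroExtLeft a u) (Iic b ×ˢ Icc 0 T)) ∧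
  (r ≠ 0 → ContDiffOn ℝ 4 (zeroExtRight b u) (Ici a ×ˢ Icc 0 T))

/-- The normalized Grünwald weights `(-1)^k * binom(α, k)`. -/
def grunwald (α : ℝ) (k : ℕ) : ℝ := (-1) ^ k * Ring.choose α k

/-- The weights of the tempered-WSGD operators with shifts `1, 0, -1`. -/
def wsgdWeight (α lam γ₁ γ₂ γ₃ h : ℝ) : ℕ → ℝ
  | 0 => γ₁ * grunwald α 0 * Real.exp (h * lam)
  | 1 => γ₁ * grunwald α 1 + γ₂ * grunwald α 0
  | k + 2 => (γ₁ * grunwald α (k + 2) + γ₂ * grunwald α (k + 1) + γ₃ * grunwald α k)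
      * Real.exp (-((k + 1 : ℝ) * h * lam))

/-- The constant subtracted on the diagonal of the tempered-WSGD operators. -/
def wsgdShift (α lam γ₁ γ₂ γ₃ h : ℝ) : ℝ :=
  (γ₁ * Real.exp (h * lam) + γ₂ + γ₃ * Real.exp (-(h * lam))) * (1 - Real.exp (-(h * lam))) ^ α

/-- Left tempered-WSGD operator at the node `j` (for `1 ≤ j`), on grid functions. -/
def leftWSGD (α lam γ₁ γ₂ γ₃ h : ℝ) (V : ℕ → ℝ) (j : ℕ) : ℝ :=
  1 / h ^ α * ∑ k ∈ Finset.range (j + 2), wsgdWeight α lam γ₁ γ₂ γ₃ h k * V (j + 1 - k)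
    - 1 / h ^ α * wsgdShift α lam γ₁ γ₂ γ₃ h * V j

/-- Right tempered-WSGD operator at the node `j` (for `1 ≤ j ≤ N - 1`), on grid functions on the
nodes `0, …, N`. -/
def rightWSGD (α lam γ₁ γ₂ γ₃ h : ℝ) (N : ℕ) (V : ℕ → ℝ) (j : ℕ) : ℝ :=
  1 / h ^ α * ∑ k ∈ Finset.range (N - j + 2), wsgdWeight α lam γ₁ γ₂ γ₃ h k * V (j + k - 1)
    - 1 / h ^ α * wsgdShift α lam γ₁ γ₂ γ₃ h * V j

/-- `U n j` solves the Crank-Nicolson-tempered-WSGD scheme with `Nx` space steps and `Nt` time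
steps; `h = (b - a) / Nx`, `τ = T / Nt`, `x_j = a + j * h`, `t_n = n * τ`. -/
structure IsSchemeSolution (α lam γ₁ γ₂ γ₃ a b T l r : ℝ) (s : ℝ → ℝ → ℝ) (u₀ φl φr : ℝ → ℝ)
    (Nx Nt : ℕ) (h τ : ℝ) (U : ℕ → ℕ → ℝ) : Prop where
  initial : ∀ j, 1 ≤ j → j < Nx → U 0 j = u₀ (a + j * h)
  boundary_left : ∀ n ≤ Nt, U n 0 = φl (n * τ)
  boundary_right : ∀ n ≤ Nt, U n Nx = φr (n * τ)
  step : ∀ n < Nt, ∀ j, 1 ≤ j → j < Nx →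
    let V : ℕ → ℝ := fun i => (U n i + U (n + 1) i) / 2
    U (n + 1) j
      - l * τ * leftWSGD α lam γ₁ γ₂ γ₃ h V j
      - r * τ * rightWSGD α lam γ₁ γ₂ γ₃ h Nx V j
      + τ * α * lam ^ (α - 1) * (l - r) * ((V (j + 1) - V (j - 1)) / (2 * h))
      = U n j + τ * s (a + j * h) ((n + 1 / 2 : ℝ) * τ)

/-- Weights in the first solution set, parametrized by `γ₁`, in the admissible range. -/
def AdmissibleS1 (α γ₁ γ₂ γ₃ : ℝ) : Prop :=
  γ₂ = (2 + α) / 2 - 2 * γ₁ ∧ γ₃ = γ₁ - α / 2 ∧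
  max (2 * (α ^ 2 + 3 * α - 4) / (α ^ 2 + 3 * α + 2))
      ((α ^ 2 + 3 * α) / (α ^ 2 + 3 * α + 4)) ≤ γ₁ ∧
  γ₁ ≤ 3 * (α ^ 2 + 3 * α - 2) / (2 * (α ^ 2 + 3 * α + 2))

/-- Weights in the second solution set, parametrized by `γ₂`, in the admissible range. -/
def AdmissibleS2 (α γ₁ γ₂ γ₃ : ℝ) : Prop :=
  γ₁ = (2 + α) / 4 - γ₂ / 2 ∧ γ₃ = (2 - α) / 4 - γ₂ / 2 ∧
  ((α - 4) * (α ^ 2 + 3 * α + 2) + 24) / (2 * (α ^ 2 + 3 * α + 2)) ≤ γ₂ ∧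
  γ₂ ≤ min (((α - 2) * (α ^ 2 + 3 * α + 4) + 16) / (2 * (α ^ 2 + 3 * α + 4)))
      (((α - 6) * (α ^ 2 + 3 * α + 2) + 48) / (2 * (α ^ 2 + 3 * α + 2)))

/-- Weights in the third solution set, parametrized by `γ₃`, in the admissible range. -/
def AdmissibleS3 (α γ₁ γ₂ γ₃ : ℝ) : Prop :=
  γ₁ = α / 2 + γ₃ ∧ γ₂ = (2 - α) / 2 - 2 * γ₃ ∧
  max ((2 - α) * (α ^ 2 + α - 8) / (2 * (α ^ 2 + 3 * α + 2)))
      ((1 - α) * (α ^ 2 + 2 * α) / (2 * (α ^ 2 + 3 * α + 4))) ≤ γ₃ ∧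
  γ₃ ≤ (2 - α) * (α ^ 2 + 2 * α - 3) / (2 * (α ^ 2 + 3 * α + 2))

/-- The discrete `L²` norm of a grid function on the interior nodes `1, …, N - 1`. -/
def gridNorm (h : ℝ) (N : ℕ) (v : ℕ → ℝ) : ℝ :=
  Real.sqrt (h * ∑ m ∈ Finset.Ico 1 N, v m ^ 2)

end TemperedDiffusion

end

noncomputable section

namespace TemperedDiffusion

/-! ### Rising factorial coefficients and the normalized Grünwald weights -/

/-! The argument is Lax's principle: consistency of order two plus stability in the discrete L²
norm.

Stability. All three weight families lie on one line, on which γ₁ + γ₂ + γ₃ = 1 and γ₁ - γ₃ = α/2.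
The inequalities imply g₀ + g₂ ≥ 0 and g_k ≥ 0 for k ≥ 3, and the partial sums of the g_k that
include k = 0, 1, 2 are at most κ. Pairing the left operator with a grid function e that vanishes at
both ends gives Σ g_k X_k - κ‖e‖², where X_k is the k-shifted autocorrelation. Since X₁ = ‖e‖², X₀ =
X₂ and X_k ≤ ‖e‖², this is nonpositive (`AdmissibleWeights.sum_leftWSGD_mul_nonpos`); the right
operator follows by reflection. The central difference is skew. Testing the error equation with the
sum of two consecutive error levels then gives ‖e^{n+1}‖ ≤ ‖e^n‖ + τ‖ρ‖ (`error_energy_le`,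
`gridNorm_step_le`).

Consistency in space. Multiplying by e^{λx} removes the tempering. The resulting function f vanishes
at the left endpoint together with its first three derivatives, so f(x) = ∫ f⁗(ξ)(x-ξ)₊³/6 dξ, and
both the difference operator and the fractional derivative are integrals against f⁗. Their
difference has the Peano kernel h^{3-α} K((x-ξ)/h), where K is the WSGD error on the truncated
cubic. Everything rests on K(y) = O(y^{1-α}) (`exists_wsgdKernel_bound`): this turns the kernel into
O(h²(x-ξ)^{1-α}), which is integrable because α < 2. The bound on K comes from the asymptotics of
the coefficients of (1-z)^{-β}, known with relative error O(n⁻²) when expanded around n + β/2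
(`exists_risingCoeff_bound`). The Grünwald operator thus sends x³/6 to (x-α/2)^{3-α}/Γ(4-α) up to
O(x^{1-α}), and the two linear conditions on the γ's cancel the first-order shift error.

The remaining truncation errors are h^{-α}κ = λ^α + O(h²) (`exists_wsgdShift_bound`) and Taylor
estimates for the time average, the time difference and the central difference. -/

/-- The coefficient of `z ^ n` in `(1 - z) ^ (-β)`. -/
def risingCoeff (β : ℝ) (n : ℕ) : ℝ := ∏ i ∈ Finset.range n, (β + i) / (i + 1)

@[simp] lemma risingCoeff_zero (β : ℝ) : risingCoeff β 0 = 1 := by simp [risingCoeff]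

lemma risingCoeff_succ (β : ℝ) (n : ℕ) :
    risingCoeff β (n + 1) = risingCoeff β n * ((β + n) / (n + 1)) := by
  rw [risingCoeff, Finset.prod_range_succ, risingCoeff]

/-- Coefficient form of the derivative relation for (1-z)^{-β}. It lets the size of the coefficients
of order β be read off from those of order β + 1. -/
lemma risingCoeff_add_one_mul (β : ℝ) (n : ℕ) :
    risingCoeff (β + 1) n * β = risingCoeff β n * (β + n) := by
  induction n with
  | zero => simp
  | succ n ih =>
    have hn : (n : ℝ) + 1 ≠ 0 := by positivity
    rw [risingCoeff_succ, risingCoeff_succ]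
    push_cast
    field_simp
    linear_combination (β + 1 + n) * ih

lemma risingCoeff_pos {β : ℝ} (hβ : 0 < β) (n : ℕ) : 0 < risingCoeff β n :=
  Finset.prod_pos fun i _ => by positivity

lemma risingCoeff_add_one_succ (β : ℝ) (n : ℕ) :
    risingCoeff (β + 1) (n + 1) = risingCoeff (β + 1) n + risingCoeff β (n + 1) := by
  have hn : (n : ℝ) + 1 ≠ 0 := by positivity
  have h := risingCoeff_add_one_mul β n
  rw [risingCoeff_succ, risingCoeff_succ]
  field_simp
  linear_combination h

/-- Partial summation is multiplication of the generating function by (1-z)⁻¹, which raises the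
order by one. -/
lemma sum_risingCoeff (β : ℝ) (n : ℕ) :
    ∑ k ∈ Finset.range (n + 1), risingCoeff β k = risingCoeff (β + 1) n := by
  induction n with
  | zero => simp
  | succ n ih => rw [Finset.sum_range_succ, ih, risingCoeff_add_one_succ]

lemma grunwald_eq_risingCoeff (α : ℝ) (k : ℕ) : grunwald α k = risingCoeff (-α) k := by
  have key : ∀ n : ℕ, (-1) ^ n * (descPochhammer ℤ n).smeval α
      = (n.factorial : ℝ) * risingCoeff (-α) n := by
    intro n
    induction n with
    | zero => simp
    | succ n ih =>
      have hn : (n : ℝ) + 1 ≠ 0 := by positivity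
      rw [descPochhammer_succ_right, Polynomial.smeval_mul, risingCoeff_succ, Nat.factorial_succ]
      simp only [Polynomial.smeval_sub, Polynomial.smeval_X, Polynomial.smeval_natCast, pow_one,
        pow_zero, nsmul_eq_mul, mul_one]
      push_cast
      field_simp
      linear_combination (n - α) * ih
  have h := key k
  rw [Ring.descPochhammer_eq_factorial_smul_choose, nsmul_eq_mul] at h
  have hk : (k.factorial : ℝ) ≠ 0 := by positivity
  unfold grunwald
  apply mul_left_cancel₀ hk
  linear_combination h

lemma grunwald_zero (α : ℝ) : grunwald α 0 = 1 := by simp [grunwald_eq_risingCoeff]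

lemma grunwald_one (α : ℝ) : grunwald α 1 = -α := by
  simp [grunwald_eq_risingCoeff, risingCoeff_succ]

lemma grunwald_succ (α : ℝ) (k : ℕ) :
    grunwald α (k + 1) = grunwald α k * ((k - α) / (k + 1)) := by
  rw [grunwald_eq_risingCoeff, grunwald_eq_risingCoeff, risingCoeff_succ]
  ring

lemma grunwald_pos {α : ℝ} (h₁ : 1 < α) (h₂ : α < 2) (k : ℕ) : 0 < grunwald α (k + 2) := by
  induction k with
  | zero =>
    rw [grunwald_succ, grunwald_one]
    have : 0 < α * (α - 1) := mul_pos (by linarith) (by linarith)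
    norm_num
    nlinarith
  | succ k ih =>
    rw [grunwald_succ]
    refine mul_pos ih (div_pos ?_ (by positivity))
    push_cast
    have : (0 : ℝ) ≤ k := by positivity
    linarith

lemma hasSum_grunwald {z : ℝ} (α : ℝ) (hz₀ : 0 ≤ z) (hz : z < 1) :
    HasSum (fun k => grunwald α k * z ^ k) ((1 - z) ^ α) := by
  have h := (Real.one_add_rpow_hasFPowerSeriesOnBall_zero (a := α)).hasSum (y := -z)
    (by simp [Metric.eball, edist_dist, abs_of_nonneg hz₀, hz])
  simp only [zero_add] at h
  rw [← sub_eq_add_neg] at h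
  have e : (fun k => grunwald α k * z ^ k)
      = fun k => (binomialSeries ℝ α k) fun _ => -z := by
    funext k
    rw [binomialSeries_apply, List.ofFn_const, List.prod_replicate, smul_eq_mul, grunwald,
      neg_pow z]
    ring
  rw [e]
  exact h

/-! ### Sign properties of the tempered-WSGD weights -/

/-- The weights of the untempered WSGD operators with shifts `1, 0, -1`. -/
def wsgdCoeff (α γ₁ γ₂ γ₃ : ℝ) : ℕ → ℝ
  | 0 => γ₁ * grunwald α 0
  | 1 => γ₁ * grunwald α 1 + γ₂ * grunwald α 0
  | k + 2 => γ₁ * grunwald α (k + 2) + γ₂ * grunwald α (k + 1) + γ₃ * grunwald α k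

lemma wsgdWeight_eq (α lam γ₁ γ₂ γ₃ h : ℝ) (k : ℕ) :
    wsgdWeight α lam γ₁ γ₂ γ₃ h k
      = wsgdCoeff α γ₁ γ₂ γ₃ k * Real.exp (-((k - 1 : ℝ) * h * lam)) := by
  match k with
  | 0 => simp [wsgdWeight, wsgdCoeff]
  | 1 => simp [wsgdWeight, wsgdCoeff]
  | k + 2 =>
    simp only [wsgdWeight, wsgdCoeff]
    push_cast
    ring_nf

/-- The common form of the three parametrized sets of admissible weights. -/
structure AdmissibleWeights (α γ₁ γ₂ γ₃ : ℝ) : Prop where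
  eq₂ : γ₂ = (2 + α) / 2 - 2 * γ₁
  eq₃ : γ₃ = γ₁ - α / 2
  lower : 2 * (α ^ 2 + 3 * α - 4) ≤ γ₁ * (α ^ 2 + 3 * α + 2)
  lower' : α ^ 2 + 3 * α ≤ γ₁ * (α ^ 2 + 3 * α + 4)
  upper : γ₁ * (2 * (α ^ 2 + 3 * α + 2)) ≤ 3 * (α ^ 2 + 3 * α - 2)

/-- The three families parametrize the same line, the solutions of γ₁ + γ₂ + γ₃ = 1 and γ₁ - γ₃ =
α/2. In the common form `lower'` controls g₀ + g₂, `upper` controls g₃, and `lower` controls g_k for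
k ≥ 4. -/
lemma AdmissibleS1.admissibleWeights {α γ₁ γ₂ γ₃ : ℝ} (hα : 0 < α)
    (h : AdmissibleS1 α γ₁ γ₂ γ₃) : AdmissibleWeights α γ₁ γ₂ γ₃ := by
  obtain ⟨h₂, h₃, hl, hu⟩ := h
  rw [max_le_iff, div_le_iff₀ (by positivity), div_le_iff₀ (by positivity)] at hl
  rw [le_div_iff₀ (by positivity)] at hu
  exact ⟨h₂, h₃, hl.1, hl.2, hu⟩

lemma AdmissibleS2.admissibleWeights {α γ₁ γ₂ γ₃ : ℝ} (hα : 0 < α)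
    (h : AdmissibleS2 α γ₁ γ₂ γ₃) : AdmissibleWeights α γ₁ γ₂ γ₃ := by
  obtain ⟨h₂, h₃, hl, hu⟩ := h
  rw [le_min_iff, le_div_iff₀ (by positivity), le_div_iff₀ (by positivity)] at hu
  rw [div_le_iff₀ (by positivity)] at hl
  have e : γ₂ = (2 + α) / 2 - 2 * γ₁ := by linarith
  rw [e] at hu hl
  refine ⟨e, by linarith, ?_, ?_, ?_⟩ <;> linarith [hu.1, hu.2]

lemma AdmissibleS3.admissibleWeights {α γ₁ γ₂ γ₃ : ℝ} (hα : 0 < α)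
    (h : AdmissibleS3 α γ₁ γ₂ γ₃) : AdmissibleWeights α γ₁ γ₂ γ₃ := by
  obtain ⟨h₂, h₃, hl, hu⟩ := h
  rw [max_le_iff, div_le_iff₀ (by positivity), div_le_iff₀ (by positivity)] at hl
  rw [le_div_iff₀ (by positivity)] at hu
  have e : γ₃ = γ₁ - α / 2 := by linarith
  rw [e] at hu hl
  refine ⟨by linarith, e, ?_, ?_, ?_⟩ <;> linarith [hl.1, hl.2]

namespace AdmissibleWeights

variable {α γ₁ γ₂ γ₃ : ℝ}

lemma gamma_nonneg (h : AdmissibleWeights α γ₁ γ₂ γ₃) (h₁ : 1 < α) : 0 ≤ γ₁ := by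
  have := h.lower'
  by_contra! hn
  nlinarith [sq_nonneg α]

lemma coeff_zero_add_two_nonneg (h : AdmissibleWeights α γ₁ γ₂ γ₃) :
    0 ≤ wsgdCoeff α γ₁ γ₂ γ₃ 0 + wsgdCoeff α γ₁ γ₂ γ₃ 2 := by
  have h' := h.lower'
  simp only [wsgdCoeff, grunwald_succ, grunwald_zero, h.eq₂, h.eq₃]
  norm_num
  linarith

/-- For index 3 the sign is exactly `upper`. For index k + 4 the coefficient is a positive factor
times a quadratic in k that is nonnegative at k = 0 by `lower` and increases for k ≥ 0, because α² +
3α + 4 < 14. -/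
lemma coeff_nonneg (h : AdmissibleWeights α γ₁ γ₂ γ₃) (h₁ : 1 < α) (h₂ : α < 2) (k : ℕ) :
    0 ≤ wsgdCoeff α γ₁ γ₂ γ₃ (k + 3) := by
  rcases k with _ | k
  · have h' := h.upper
    have : wsgdCoeff α γ₁ γ₂ γ₃ 3
        = α * (3 * (α ^ 2 + 3 * α - 2) - γ₁ * (2 * (α ^ 2 + 3 * α + 2))) / 12 := by
      simp only [wsgdCoeff, grunwald_succ, grunwald_zero, h.eq₂, h.eq₃]
      norm_num
      ring
    rw [zero_add, this]
    have := mul_nonneg (by linarith : 0 ≤ α) (sub_nonneg.2 h')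
    linarith
  · have h' := h.lower
    have hk : (0 : ℝ) ≤ k := by positivity
    have : wsgdCoeff α γ₁ γ₂ γ₃ (k + 1 + 3)
        = grunwald α (k + 2) / ((k + 3) * (k + 4)) *
          (γ₁ * (α ^ 2 + 3 * α + 2) + (k + 4) ^ 2 - (k + 4) * (α ^ 2 + 3 * α + 4) / 2) := by
      simp only [wsgdCoeff, grunwald_succ α (k + 3), grunwald_succ α (k + 2), h.eq₂, h.eq₃]
      push_cast
      field_simp
      ring
    rw [this]
    refine mul_nonneg (div_nonneg (grunwald_pos h₁ h₂ k).le (by positivity)) ?_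
    nlinarith [mul_nonneg hk (by nlinarith : 0 ≤ 8 - (α ^ 2 + 3 * α + 4) / 2), mul_nonneg hk hk]

end AdmissibleWeights

/-! ### Negativity of the discrete operators -/

lemma sum_wsgdCoeff_mul (α γ₁ γ₂ γ₃ : ℝ) (f : ℕ → ℝ) (n : ℕ) :
    ∑ k ∈ Finset.range (n + 2), wsgdCoeff α γ₁ γ₂ γ₃ k * f k
      = γ₁ * ∑ k ∈ Finset.range (n + 2), grunwald α k * f k
        + γ₂ * ∑ k ∈ Finset.range (n + 1), grunwald α k * f (k + 1)
        + γ₃ * ∑ k ∈ Finset.range n, grunwald α k * f (k + 2) := by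
  induction n with
  | zero => simp [Finset.sum_range_succ, wsgdCoeff]; ring
  | succ n ih =>
    simp only [Finset.sum_range_succ, wsgdCoeff] at ih ⊢
    linear_combination ih

open Filter Topology in
lemma tendsto_sum_wsgdCoeff {z : ℝ} (α γ₁ γ₂ γ₃ : ℝ) (hz₀ : 0 ≤ z) (hz : z < 1) :
    Tendsto (fun n => ∑ k ∈ Finset.range (n + 2), wsgdCoeff α γ₁ γ₂ γ₃ k * z ^ k) atTop
      (𝓝 ((γ₁ + γ₂ * z + γ₃ * z ^ 2) * (1 - z) ^ α)) := by
  have h := (hasSum_grunwald α hz₀ hz).tendsto_sum_nat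
  have h₂ := (tendsto_add_atTop_iff_nat 2).2 h
  have h₁ := (tendsto_add_atTop_iff_nat 1).2 h
  have := ((h₂.const_mul γ₁).add (h₁.const_mul (γ₂ * z))).add (h.const_mul (γ₃ * z ^ 2))
  refine (this.congr fun n => ?_).trans (by rw [← add_mul, ← add_mul])
  rw [sum_wsgdCoeff_mul]
  simp only [pow_add, pow_one, ← mul_assoc, ← Finset.sum_mul]
  ring

-- From index 3 on the terms are nonnegative, so the partial sums increase to the generating
-- function, which bounds each of them.
open Filter Topology in
lemma AdmissibleWeights.sum_coeff_le {α γ₁ γ₂ γ₃ z : ℝ} (h : AdmissibleWeights α γ₁ γ₂ γ₃)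
    (h₁ : 1 < α) (h₂ : α < 2) (hz₀ : 0 ≤ z) (hz : z ≤ 1) (n : ℕ) :
    ∑ k ∈ Finset.range (n + 3), wsgdCoeff α γ₁ γ₂ γ₃ k * z ^ k
      ≤ (γ₁ + γ₂ * z + γ₃ * z ^ 2) * (1 - z) ^ α := by
  have key : ∀ y : ℝ, 0 ≤ y → y < 1 →
      ∑ k ∈ Finset.range (n + 3), wsgdCoeff α γ₁ γ₂ γ₃ k * y ^ k
      ≤ (γ₁ + γ₂ * y + γ₃ * y ^ 2) * (1 - y) ^ α := by
    intro y hy₀ hy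
    have ht := (tendsto_add_atTop_iff_nat 1).2 (tendsto_sum_wsgdCoeff α γ₁ γ₂ γ₃ hy₀ hy)
    refine Monotone.ge_of_tendsto (monotone_nat_of_le_succ fun m => ?_) ht n
    rw [Finset.sum_range_succ _ (m + 1 + 2)]
    exact le_add_of_nonneg_right (mul_nonneg (h.coeff_nonneg h₁ h₂ m) (by positivity))
  rcases hz.lt_or_eq with hz | rfl
  · exact key z hz₀ hz
  -- The series is only summed for z < 1. The endpoint z = 1, which is the untempered case λ = 0,
  -- follows by letting z increase to 1 in a fixed partial sum.
  · have c₁ : Continuous fun y : ℝ =>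
        ∑ k ∈ Finset.range (n + 3), wsgdCoeff α γ₁ γ₂ γ₃ k * y ^ k := by fun_prop
    have c₂ : Continuous fun y : ℝ => (γ₁ + γ₂ * y + γ₃ * y ^ 2) * (1 - y) ^ α :=
      (by fun_prop : Continuous fun y : ℝ => γ₁ + γ₂ * y + γ₃ * y ^ 2).mul
        ((by fun_prop : Continuous fun y : ℝ => 1 - y).rpow_const fun _ => Or.inr (by linarith))
    refine le_of_tendsto_of_tendsto (c₁.continuousAt.tendsto.mono_left nhdsWithin_le_nhds)
      (c₂.continuousAt.tendsto.mono_left nhdsWithin_le_nhds) (b := 𝓝[<] (1 : ℝ)) ?_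
    filter_upwards [Ioo_mem_nhdsLT (zero_lt_one : (0 : ℝ) < 1)] with y hy
    exact key y hy.1.le hy.2

/-- The tempered weights are e^{hλ} times the terms of the untempered series at z = e^{-hλ}, and κ
is e^{hλ} times its sum there. -/
lemma AdmissibleWeights.sum_weight_le {α γ₁ γ₂ γ₃ lam h : ℝ}
    (hγ : AdmissibleWeights α γ₁ γ₂ γ₃) (h₁ : 1 < α) (h₂ : α < 2) (hlam : 0 ≤ lam) (hh : 0 ≤ h)
    (n : ℕ) :
    ∑ k ∈ Finset.range (n + 3), wsgdWeight α lam γ₁ γ₂ γ₃ h k ≤ wsgdShift α lam γ₁ γ₂ γ₃ h := by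
  have hz := hγ.sum_coeff_le h₁ h₂ (Real.exp_pos (-(h * lam))).le
    (Real.exp_le_one_iff.2 (by linarith [mul_nonneg hh hlam])) n
  have e : Real.exp (h * lam) * Real.exp (-(h * lam)) = 1 := by
    rw [← Real.exp_add]; simp
  calc _ = Real.exp (h * lam) * ∑ k ∈ Finset.range (n + 3),
        wsgdCoeff α γ₁ γ₂ γ₃ k * Real.exp (-(h * lam)) ^ k := by
        rw [Finset.mul_sum]
        refine Finset.sum_congr rfl fun k _ => ?_
        rw [wsgdWeight_eq, ← Real.exp_nat_mul, mul_left_comm, ← Real.exp_add]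
        ring_nf
    _ ≤ _ := mul_le_mul_of_nonneg_left hz (Real.exp_pos _).le
    _ = _ := by
        unfold wsgdShift
        linear_combination (1 - Real.exp (-(h * lam))) ^ α *
          (γ₂ + γ₃ * Real.exp (-(h * lam))) * e

lemma AdmissibleWeights.weight_nonneg {α γ₁ γ₂ γ₃ lam h : ℝ}
    (hγ : AdmissibleWeights α γ₁ γ₂ γ₃) (h₁ : 1 < α) (h₂ : α < 2) (k : ℕ) :
    0 ≤ wsgdWeight α lam γ₁ γ₂ γ₃ h (k + 3) := by
  rw [wsgdWeight_eq]
  exact mul_nonneg (hγ.coeff_nonneg h₁ h₂ k) (Real.exp_pos _).le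

lemma AdmissibleWeights.weight_zero_add_two_nonneg {α γ₁ γ₂ γ₃ lam h : ℝ}
    (hγ : AdmissibleWeights α γ₁ γ₂ γ₃) (h₁ : 1 < α) (hlam : 0 ≤ lam) (hh : 0 ≤ h) :
    0 ≤ wsgdWeight α lam γ₁ γ₂ γ₃ h 0 + wsgdWeight α lam γ₁ γ₂ γ₃ h 2 := by
  have hl := mul_nonneg hh hlam
  have e : Real.exp (-(h * lam)) ≤ Real.exp (h * lam) := Real.exp_le_exp.2 (by linarith)
  have hc := hγ.coeff_zero_add_two_nonneg
  have h0 : 0 ≤ wsgdCoeff α γ₁ γ₂ γ₃ 0 := by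
    simpa [wsgdCoeff, grunwald_zero] using hγ.gamma_nonneg h₁
  rw [wsgdWeight_eq, wsgdWeight_eq]
  norm_num
  nlinarith [mul_nonneg hc (Real.exp_pos (-(h * lam))).le, mul_le_mul_of_nonneg_left e h0]

/-- With zero boundary values both sums run over all products of neighbours. This is the
skew-symmetry of the central difference, and it also gives X₀ = X₂ in the quadratic form. -/
lemma sum_Ico_shift_eq {e : ℕ → ℝ} {N : ℕ} (hN : 1 ≤ N) (h0 : e 0 = 0) (hN0 : e N = 0) :
    ∑ j ∈ Finset.Ico 1 N, e (j + 1) * e j = ∑ j ∈ Finset.Ico 1 N, e (j - 1) * e j := by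
  obtain ⟨M, rfl⟩ := Nat.exists_eq_add_of_le' hN
  rw [Finset.sum_Ico_eq_sum_range, Finset.sum_Ico_eq_sum_range, ← sub_eq_zero,
    ← Finset.sum_sub_distrib]
  have := Finset.sum_range_sub (fun i => e i * e (i + 1)) M
  simp only [h0, hN0, mul_zero, zero_mul, sub_zero] at this
  rw [← this]
  refine Finset.sum_congr rfl fun i _ => ?_
  rw [add_comm 1 i, Nat.add_sub_cancel]
  ring

lemma sum_sq_shift_le {e : ℕ → ℝ} {N : ℕ} (hN : 1 ≤ N) (h0 : e 0 = 0) (hN0 : e N = 0) (k : ℕ) :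
    ∑ j ∈ Finset.Ico 1 N, (if k ≤ j + 1 then e (j + 1 - k) else 0) ^ 2
      ≤ ∑ j ∈ Finset.Ico 1 N, e j ^ 2 := by
  have hQ : ∑ j ∈ Finset.Ico 1 N, e j ^ 2 = ∑ j ∈ Finset.range (N + 1), e j ^ 2 := by
    rw [Finset.sum_range_succ, hN0, Finset.range_eq_Ico, Finset.sum_eq_sum_Ico_succ_bot hN]
    simp [h0]
  have : ∀ j, (if k ≤ j + 1 then e (j + 1 - k) else 0) ^ 2
      = if k ≤ j + 1 then e (j + 1 - k) ^ 2 else 0 := fun j => by split_ifs <;> simp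
  simp only [this]
  rw [hQ, ← Finset.sum_filter]
  have inj : Set.InjOn (fun j => j + 1 - k)
      ((Finset.Ico 1 N).filter fun j => k ≤ j + 1 : Finset ℕ) := by
    intro x hx y hy hxy
    simp only [Finset.coe_filter, Finset.mem_Ico, Set.mem_ofPred_eq] at hx hy hxy
    omega
  rw [← Finset.sum_image (f := fun i => e i ^ 2) inj]
  refine Finset.sum_le_sum_of_subset_of_nonneg ?_ fun _ _ _ => sq_nonneg _
  intro i hi
  simp only [Finset.mem_image, Finset.mem_filter, Finset.mem_Ico, Finset.mem_range] at hi ⊢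
  omega

/-- The form is Σ g_k X_k with X_k the autocorrelation at shift k - 1. No sign of g₁ is needed since
X₁ = Q exactly; g₀ and g₂ enter only through their sum since X₀ = X₂; for the rest X_k ≤ Q and g_k ≥
0. What is left is (Σ g_k) Q ≤ κ Q. -/
lemma AdmissibleWeights.sum_mul_le {α γ₁ γ₂ γ₃ lam h : ℝ}
    (hγ : AdmissibleWeights α γ₁ γ₂ γ₃) (h₁ : 1 < α) (h₂ : α < 2) (hlam : 0 ≤ lam) (hh : 0 ≤ h)
    {e : ℕ → ℝ} {N : ℕ} (hN : 1 ≤ N) (h0 : e 0 = 0) (hN0 : e N = 0) :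
    ∑ j ∈ Finset.Ico 1 N,
        (∑ k ∈ Finset.range (j + 2), wsgdWeight α lam γ₁ γ₂ γ₃ h k * e (j + 1 - k)) * e j
      ≤ wsgdShift α lam γ₁ γ₂ γ₃ h * ∑ j ∈ Finset.Ico 1 N, e j ^ 2 := by
  set g := wsgdWeight α lam γ₁ γ₂ γ₃ h
  set Q := ∑ j ∈ Finset.Ico 1 N, e j ^ 2 with hQ
  -- The condition k ≤ j + 1 guards the truncated subtraction: it extends e by zero, so that every j
  -- can use the same range of k.
  set X : ℕ → ℝ := fun k =>
    ∑ j ∈ Finset.Ico 1 N, (if k ≤ j + 1 then e (j + 1 - k) else 0) * e j with hX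
  have hXle : ∀ k, X k ≤ Q := by
    intro k
    have h1 := sum_sq_shift_le hN h0 hN0 k
    calc X k ≤ ∑ j ∈ Finset.Ico 1 N,
          ((if k ≤ j + 1 then e (j + 1 - k) else 0) ^ 2 / 2 + e j ^ 2 / 2) :=
          Finset.sum_le_sum fun j _ => by
            nlinarith [sq_nonneg ((if k ≤ j + 1 then e (j + 1 - k) else 0) - e j)]
      _ ≤ Q := by
          rw [Finset.sum_add_distrib, ← Finset.sum_div, ← Finset.sum_div]
          linarith
  have hX1 : X 1 = Q := Finset.sum_congr rfl fun j _ => by simp [sq]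
  have hX02 : X 0 = X 2 := by
    have := sum_Ico_shift_eq hN h0 hN0
    simp only [hX]
    convert this using 2 with j hj j hj
    · simp
    · have := (Finset.mem_Ico.1 hj).1
      rw [if_pos (by omega), show j + 1 - 2 = j - 1 by omega]
  have hsum : ∑ j ∈ Finset.Ico 1 N, (∑ k ∈ Finset.range (j + 2), g k * e (j + 1 - k)) * e j
      = ∑ k ∈ Finset.range (N - 1 + 3), g k * X k := by
    simp only [hX, Finset.mul_sum]
    rw [Finset.sum_comm]
    refine Finset.sum_congr rfl fun j hj => ?_
    rw [Finset.sum_mul]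
    have hj' := Finset.mem_Ico.1 hj
    refine Finset.sum_congr_of_eq_on_inter ?_ ?_ ?_
    · intro k hk hk'
      simp only [Finset.mem_range] at hk hk'
      omega
    · intro k hk hk'
      simp only [Finset.mem_range] at hk hk'
      rw [if_neg (by omega)]
      simp
    · intro k hk hk'
      simp only [Finset.mem_range] at hk hk'
      rw [if_pos (by omega)]
      ring
  have hle := hγ.sum_weight_le h₁ h₂ hlam hh (N - 1)
  have hQ0 : 0 ≤ Q := Finset.sum_nonneg fun _ _ => sq_nonneg _
  rw [hsum]
  refine le_trans ?_ (mul_le_mul_of_nonneg_right hle hQ0)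
  rw [Finset.sum_mul, add_comm (N - 1) 3, Finset.sum_range_add, Finset.sum_range_add]
  refine add_le_add ?_ (Finset.sum_le_sum fun k _ => ?_)
  · have h02 := hγ.weight_zero_add_two_nonneg h₁ hlam hh
    simp only [Finset.sum_range_succ, Finset.sum_range_zero, hX1, hX02]
    have := mul_le_mul_of_nonneg_left (hXle 2) h02
    linarith
  · rw [add_comm 3 k]
    exact mul_le_mul_of_nonneg_left (hXle _) (hγ.weight_nonneg h₁ h₂ k)

lemma AdmissibleWeights.sum_leftWSGD_mul_nonpos {α γ₁ γ₂ γ₃ lam h : ℝ}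
    (hγ : AdmissibleWeights α γ₁ γ₂ γ₃) (h₁ : 1 < α) (h₂ : α < 2) (hlam : 0 ≤ lam) (hh : 0 ≤ h)
    {e : ℕ → ℝ} {N : ℕ} (hN : 1 ≤ N) (h0 : e 0 = 0) (hN0 : e N = 0) :
    ∑ j ∈ Finset.Ico 1 N, leftWSGD α lam γ₁ γ₂ γ₃ h e j * e j ≤ 0 := by
  have key := hγ.sum_mul_le h₁ h₂ hlam hh hN h0 hN0
  have hp : 0 ≤ 1 / h ^ α := by positivity
  have : ∑ j ∈ Finset.Ico 1 N, leftWSGD α lam γ₁ γ₂ γ₃ h e j * e j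
      = 1 / h ^ α * (∑ j ∈ Finset.Ico 1 N,
        (∑ k ∈ Finset.range (j + 2), wsgdWeight α lam γ₁ γ₂ γ₃ h k * e (j + 1 - k)) * e j
        - wsgdShift α lam γ₁ γ₂ γ₃ h * ∑ j ∈ Finset.Ico 1 N, e j ^ 2) := by
    rw [Finset.mul_sum, ← Finset.sum_sub_distrib, Finset.mul_sum]
    refine Finset.sum_congr rfl fun j _ => ?_
    unfold leftWSGD
    ring
  rw [this]
  exact mul_nonpos_of_nonneg_of_nonpos hp (by linarith)

lemma rightWSGD_eq_leftWSGD (α lam γ₁ γ₂ γ₃ h : ℝ) {N j : ℕ} (hj : 1 ≤ j) (hjN : j < N)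
    (V : ℕ → ℝ) :
    rightWSGD α lam γ₁ γ₂ γ₃ h N V j
      = leftWSGD α lam γ₁ γ₂ γ₃ h (fun i => V (N - i)) (N - j) := by
  unfold rightWSGD leftWSGD
  have : ∀ k ∈ Finset.range (N - j + 2), N - (N - j + 1 - k) = j + k - 1 := by
    intro k hk
    rw [Finset.mem_range] at hk
    omega
  rw [Finset.sum_congr rfl fun k hk => by rw [← this k hk]]
  simp only [show N - (N - j) = j by omega]

lemma sum_Ico_reflect_nodes (f : ℕ → ℝ) (N : ℕ) :
    ∑ j ∈ Finset.Ico 1 N, f (N - j) = ∑ j ∈ Finset.Ico 1 N, f j := by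
  refine Finset.sum_nbij' (fun j => N - j) (fun j => N - j) ?_ ?_ ?_ ?_ fun _ _ => rfl <;>
  · intro j hj
    simp only [Finset.mem_Ico] at hj ⊢
    omega

lemma AdmissibleWeights.sum_rightWSGD_mul_nonpos {α γ₁ γ₂ γ₃ lam h : ℝ}
    (hγ : AdmissibleWeights α γ₁ γ₂ γ₃) (h₁ : 1 < α) (h₂ : α < 2) (hlam : 0 ≤ lam) (hh : 0 ≤ h)
    {e : ℕ → ℝ} {N : ℕ} (hN : 1 ≤ N) (h0 : e 0 = 0) (hN0 : e N = 0) :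
    ∑ j ∈ Finset.Ico 1 N, rightWSGD α lam γ₁ γ₂ γ₃ h N e j * e j ≤ 0 := by
  have key := hγ.sum_leftWSGD_mul_nonpos h₁ h₂ hlam hh (e := fun i => e (N - i)) hN
    (by simpa using hN0) (by simpa using h0)
  rw [← sum_Ico_reflect_nodes] at key
  refine le_of_eq_of_le (Finset.sum_congr rfl fun j hj => ?_) key
  obtain ⟨h1, h2⟩ := Finset.mem_Ico.1 hj
  rw [rightWSGD_eq_leftWSGD _ _ _ _ _ _ h1 h2, show N - (N - j) = j by omega]

/-! ### Asymptotics of the rising factorial coefficients -/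

lemma abs_log_sub_log_sub_le {x : ℝ} (hx₀ : 0 ≤ x) (hx : x ≤ 1 / 2) :
    |Real.log (1 + x) - Real.log (1 - x) - 2 * x| ≤ 4 * x ^ 3 := by
  have h1 := Real.abs_log_sub_add_sum_range_le (x := x) (by rw [abs_of_nonneg hx₀]; linarith) 2
  have h2 := Real.abs_log_sub_add_sum_range_le (x := -x)
    (by rw [abs_neg, abs_of_nonneg hx₀]; linarith) 2
  rw [abs_neg] at h2
  have hb : |x| ^ (2 + 1) / (1 - |x|) ≤ 2 * x ^ 3 := by
    rw [abs_of_nonneg hx₀, div_le_iff₀ (by linarith)]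
    linarith [mul_nonneg (pow_nonneg hx₀ 3) (by linarith : 0 ≤ 1 - 2 * x), pow_succ x 2]
  have h1' := abs_le.1 (h1.trans hb)
  have h2' := abs_le.1 (h2.trans hb)
  simp only [Finset.sum_range_succ, Finset.sum_range_zero, sub_neg_eq_add] at h1' h2'
  norm_num at h1' h2'
  rw [abs_le]
  constructor <;> linarith [h1'.1, h1'.2, h2'.1, h2'.2]

/-- The quotient (y + d)/(y - d) is symmetric about y, so its logarithm has no second-order term in
d/y. -/
lemma abs_log_quotient_le {y d : ℝ} (hd : 0 ≤ d) (hy : 0 < y) (hdy : d ≤ y / 2) :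
    |Real.log (y + d) - Real.log (y - d) - 2 * d / y| ≤ 4 * d ^ 3 / y ^ 3 := by
  have hx : d / y ≤ 1 / 2 := by rw [div_le_iff₀ hy]; linarith
  have h := abs_log_sub_log_sub_le (div_nonneg hd hy.le) hx
  have e1 : Real.log (y + d) = Real.log y + Real.log (1 + d / y) := by
    rw [← Real.log_mul hy.ne' (by positivity)]
    congr 1
    field_simp
  have e2 : Real.log (y - d) = Real.log y + Real.log (1 - d / y) := by
    rw [← Real.log_mul hy.ne' (by linarith)]
    congr 1
    field_simp
  rw [e1, e2]
  convert h using 1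
  · ring_nf
  · rw [div_pow]; ring

/-- The logarithm of the normalized coefficient. -/
def logNormalizedCoeff (β : ℝ) (n : ℕ) : ℝ :=
  Real.log (risingCoeff β n) - (β - 1) * Real.log (n + β / 2)

/-- The shift β/2 is chosen so that both ratios, of consecutive coefficients and of consecutive
normalizing factors, are symmetric about the same point y = n + (1+β)/2. The 1/y terms then cancel
and the increment is O(y⁻³), stated in telescoping form. -/
lemma abs_logNormalizedCoeff_sub_le {β : ℝ} (hβ₁ : 1 < β) (hβ₂ : β < 3) {n : ℕ} (hn : 1 ≤ n) :
    |logNormalizedCoeff β (n + 1) - logNormalizedCoeff β n|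
      ≤ 6 * (1 / (n : ℝ) ^ 2 - 1 / ((n + 1 : ℕ) : ℝ) ^ 2) := by
  have hn' : (1 : ℝ) ≤ n := by exact_mod_cast hn
  set y : ℝ := n + (1 + β) / 2 with hy
  set d : ℝ := (β - 1) / 2 with hd
  have hd0 : 0 ≤ d := by linarith
  have hd1 : d ≤ 1 := by linarith
  have hyn : (n : ℝ) + 1 ≤ y := by linarith
  have hy0 : 0 < y := by linarith
  have h1 := abs_log_quotient_le hd0 hy0 (by linarith)
  have h2 := abs_log_quotient_le (d := 1 / 2) (by norm_num) hy0 (by linarith)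
  have hA := risingCoeff_pos (by linarith : 0 < β) n
  have e : logNormalizedCoeff β (n + 1) - logNormalizedCoeff β n
      = (Real.log (y + d) - Real.log (y - d) - 2 * d / y)
        - 2 * d * (Real.log (y + 1 / 2) - Real.log (y - 1 / 2) - 2 * (1 / 2) / y) := by
    unfold logNormalizedCoeff
    rw [risingCoeff_succ, Real.log_mul hA.ne' (by positivity),
      Real.log_div (by positivity) (by positivity)]
    rw [show y + d = β + n by rw [hy, hd]; ring, show y - d = n + 1 by rw [hy, hd]; ring,
      show y + 1 / 2 = ((n + 1 : ℕ) : ℝ) + β / 2 by rw [hy]; push_cast; ring,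
      show y - 1 / 2 = n + β / 2 by rw [hy]; ring, hd]
    field_simp
    ring
  have hy3 : 1 / y ^ 3 ≤ 1 / ((n : ℝ) + 1) ^ 3 := by gcongr
  have hn3 : 1 / ((n : ℝ) + 1) ^ 3 ≤ 1 / (n : ℝ) ^ 2 - 1 / ((n + 1 : ℕ) : ℝ) ^ 2 := by
    push_cast
    rw [div_sub_div _ _ (by positivity) (by positivity), div_le_div_iff₀ (by positivity)
      (by positivity)]
    have : 0 ≤ ((n : ℝ) + 1) ^ 2 * (n ^ 2 + 3 * n + 1) := by positivity
    nlinarith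
  calc _ ≤ |Real.log (y + d) - Real.log (y - d) - 2 * d / y|
        + 2 * d * |Real.log (y + 1 / 2) - Real.log (y - 1 / 2) - 2 * (1 / 2) / y| := by
        rw [e]
        refine (abs_sub _ _).trans ?_
        rw [abs_mul (2 * d), abs_of_nonneg (by linarith : 0 ≤ 2 * d)]
    _ ≤ 4 * d ^ 3 / y ^ 3 + 2 * d * (4 * (1 / 2) ^ 3 / y ^ 3) := by gcongr
    _ = (4 * d ^ 3 + d) * (1 / y ^ 3) := by ring
    _ ≤ (4 * 1 ^ 3 + 1) * (1 / y ^ 3) := by gcongr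
    _ ≤ 6 * (1 / y ^ 3) := by
        have : 0 ≤ 1 / y ^ 3 := by positivity
        linarith
    _ ≤ _ := by linarith

-- Euler's product for Γ(β) times the coefficient is n^β/(β + n). The shift β/2 does not affect the
-- limit.
open Filter Topology in
lemma tendsto_logNormalizedCoeff {β : ℝ} (hβ : 0 < β) :
    Tendsto (logNormalizedCoeff β) atTop (𝓝 (-Real.log (Real.Gamma β))) := by
  have hG := (Real.GammaSeq_tendsto_Gamma β).log (Real.Gamma_pos_of_pos hβ).ne'
  have hlog : ∀ c : ℝ, Tendsto (fun n : ℕ => Real.log (n : ℝ) - Real.log (n + c)) atTop (𝓝 0) := by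
    intro c
    have h1 : Tendsto (fun n : ℕ => (n : ℝ) / (n + c)) atTop (𝓝 1) :=
      tendsto_natCast_div_add_atTop c
    have h2 := h1.log one_ne_zero
    rw [Real.log_one] at h2
    refine h2.congr' ?_
    have hc := (tendsto_natCast_atTop_atTop (R := ℝ)).eventually_gt_atTop (max 0 (-c))
    filter_upwards [hc] with n hn
    rw [max_lt_iff] at hn
    rw [Real.log_div hn.1.ne' (by linarith)]
  have h := ((hlog β).add ((hlog (β / 2)).const_mul (β - 1))).sub hG
  simp only [mul_zero, add_zero, zero_sub] at h
  refine h.congr' ?_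
  filter_upwards [eventually_ge_atTop 1] with n hn
  have hn' : (0 : ℝ) < n := by exact_mod_cast hn
  have hp : ∏ i ∈ Finset.range n, ((i : ℝ) + 1) = n.factorial := by
    rw [← Finset.prod_range_add_one_eq_factorial]; push_cast; rfl
  have hA : Real.GammaSeq β n * risingCoeff β n = (n : ℝ) ^ β / (β + n) := by
    have hne : ∏ j ∈ Finset.range n, (β + (j : ℝ)) ≠ 0 :=
      (Finset.prod_pos fun i _ => by positivity).ne'
    rw [Real.GammaSeq, risingCoeff, Finset.prod_div_distrib, hp, Finset.prod_range_succ]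
    have : (n.factorial : ℝ) ≠ 0 := by positivity
    have : β + n ≠ 0 := by positivity
    field_simp
  have hApos := risingCoeff_pos hβ n
  have hGpos : 0 < Real.GammaSeq β n := by
    refine pos_of_mul_pos_left ?_ hApos.le
    rw [hA]; positivity
  have hl := congrArg Real.log hA
  rw [Real.log_mul hGpos.ne' hApos.ne', Real.log_div (by positivity) (by positivity),
    Real.log_rpow hn'] at hl
  unfold logNormalizedCoeff
  rw [add_comm (n : ℝ) β]
  linarith

-- Telescoping: adding or subtracting D/n² makes the sequence monotone, with the same limit.
open Filter Topology in
lemma abs_sub_lim_le {L : ℕ → ℝ} {l D : ℝ} (hL : Tendsto L atTop (𝓝 l))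
    (h : ∀ n : ℕ, 1 ≤ n → |L (n + 1) - L n| ≤ D * (1 / (n : ℝ) ^ 2 - 1 / ((n + 1 : ℕ) : ℝ) ^ 2))
    {n : ℕ} (hn : 1 ≤ n) : |L n - l| ≤ D / (n : ℝ) ^ 2 := by
  have hz : Tendsto (fun m : ℕ => D * (1 / ((m + n : ℕ) : ℝ) ^ 2)) atTop (𝓝 0) := by
    have h1 : Tendsto (fun m : ℕ => D * (1 / (m : ℝ) ^ 2)) atTop (𝓝 (D * 0)) :=
      (tendsto_const_div_pow (1 : ℝ) 2 (by norm_num)).const_mul D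
    rw [mul_zero] at h1
    exact (tendsto_add_atTop_iff_nat n).2 h1
  have hLn := (tendsto_add_atTop_iff_nat n).2 hL
  have hstep : ∀ m, |L (m + 1 + n) - L (m + n)|
      ≤ D * (1 / ((m + n : ℕ) : ℝ) ^ 2) - D * (1 / ((m + 1 + n : ℕ) : ℝ) ^ 2) := by
    intro m
    have := h (m + n) (by omega)
    rw [mul_sub] at this
    rwa [show m + 1 + n = m + n + 1 by ring]
  have hup : Antitone fun m => L (m + n) + D * (1 / ((m + n : ℕ) : ℝ) ^ 2) :=
    antitone_nat_of_succ_le fun m => by linarith [(abs_le.1 (hstep m)).2]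
  have hlo : Monotone fun m => L (m + n) - D * (1 / ((m + n : ℕ) : ℝ) ^ 2) :=
    monotone_nat_of_le_succ fun m => by linarith [(abs_le.1 (hstep m)).1]
  have h1 := hup.le_of_tendsto (hLn.add hz) 0
  have h2 := hlo.ge_of_tendsto (hLn.sub hz) 0
  simp only [zero_add, add_zero, sub_zero] at h1 h2
  rw [abs_le, div_eq_mul_one_div]
  constructor <;> linarith

lemma abs_exp_sub_one_le_mul (t : ℝ) : |Real.exp t - 1| ≤ |t| * Real.exp |t| := by
  rcases le_total 0 t with ht | ht
  · rw [abs_of_nonneg ht, abs_of_nonneg (by linarith [Real.add_one_le_exp t])]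
    have h1 := Real.add_one_le_exp (-t)
    have h2 : Real.exp (-t) * Real.exp t = 1 := by rw [← Real.exp_add]; simp
    nlinarith [Real.exp_pos t]
  · rw [abs_of_nonpos ht, abs_of_nonpos (by linarith [Real.exp_le_one_iff.2 ht])]
    nlinarith [Real.add_one_le_exp t, Real.one_le_exp (neg_nonneg.2 ht)]

lemma exists_risingCoeff_bound {β : ℝ} (hβ₁ : 1 < β) (hβ₂ : β < 3) :
    ∃ C, 0 ≤ C ∧ ∀ n : ℕ, 1 ≤ n →
      |risingCoeff β n - ((n : ℝ) + β / 2) ^ (β - 1) / Real.Gamma β| ≤ C * (n : ℝ) ^ (β - 3) := by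
  have hΓ := Real.Gamma_pos_of_pos (by linarith : 0 < β)
  -- The factor 3^{β-1} comes from n + β/2 ≤ 3n. The factor 6e⁶ comes from |e^t - 1| ≤ |t|e^{|t|}
  -- with |t| ≤ 6/n² ≤ 6.
  refine ⟨(3 : ℝ) ^ (β - 1) / Real.Gamma β * (6 * Real.exp 6), by positivity, fun n hn => ?_⟩
  have hn' : (1 : ℝ) ≤ n := by exact_mod_cast hn
  set t := logNormalizedCoeff β n + Real.log (Real.Gamma β) with ht
  have htb : |t| ≤ 6 / (n : ℝ) ^ 2 := by
    have := abs_sub_lim_le (tendsto_logNormalizedCoeff (by linarith : 0 < β))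
      (fun m hm => abs_logNormalizedCoeff_sub_le hβ₁ hβ₂ hm) hn
    rwa [sub_neg_eq_add] at this
  have ht6 : |t| ≤ 6 := htb.trans (div_le_self (by norm_num) (one_le_pow₀ hn'))
  set X : ℝ := (n : ℝ) + β / 2 with hX
  have hX0 : 0 < X := by positivity
  have hA := risingCoeff_pos (by linarith : 0 < β) n
  have e : risingCoeff β n = X ^ (β - 1) / Real.Gamma β * Real.exp t := by
    rw [ht, logNormalizedCoeff, Real.exp_add, Real.exp_log hΓ, Real.exp_sub, Real.exp_log hA,
      Real.rpow_def_of_pos hX0, mul_comm (Real.log X), ← hX]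
    have := Real.exp_ne_zero ((β - 1) * Real.log X)
    generalize Real.exp ((β - 1) * Real.log X) = E at *
    field_simp
  have e2 : risingCoeff β n - X ^ (β - 1) / Real.Gamma β
      = X ^ (β - 1) / Real.Gamma β * (Real.exp t - 1) := by rw [e]; ring
  have hXn : X ^ (β - 1) ≤ 3 ^ (β - 1) * (n : ℝ) ^ (β - 1) := by
    rw [← Real.mul_rpow (by norm_num) (by positivity)]
    exact Real.rpow_le_rpow hX0.le (by linarith) (by linarith)
  have hpow : (n : ℝ) ^ (β - 1) = (n : ℝ) ^ (β - 3) * (n : ℝ) ^ 2 := by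
    rw [← Real.rpow_natCast, ← Real.rpow_add (by linarith)]
    norm_num
    ring_nf
  rw [e2, abs_mul, abs_of_nonneg (by positivity)]
  calc _ ≤ 3 ^ (β - 1) * (n : ℝ) ^ (β - 1) / Real.Gamma β * (6 / (n : ℝ) ^ 2 * Real.exp 6) := by
        gcongr
        exact (abs_exp_sub_one_le_mul t).trans (by gcongr)
    _ = _ := by
        rw [hpow]
        field_simp

/-! ### The Peano kernel of the Grünwald operator -/

/-- If q' is the sequence of partial sums of q, its convolution with the coefficients is the partial
sum of the convolution of q, which raises the order by one. -/
lemma sum_risingCoeff_mul_succ {β γ : ℝ} {q q' : ℕ → ℝ} (h0 : q' 0 = q 0)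
    (hs : ∀ j, q' (j + 1) = q' j + q (j + 1))
    (h : ∀ n, ∑ k ∈ Finset.range (n + 1), risingCoeff β k * q (n - k) = risingCoeff γ n) (n : ℕ) :
    ∑ k ∈ Finset.range (n + 1), risingCoeff β k * q' (n - k) = risingCoeff (γ + 1) n := by
  induction n with
  | zero => have := h 0; simp at this ⊢; rw [h0, this]
  | succ n ih =>
    rw [risingCoeff_add_one_succ, ← ih, ← h (n + 1), Finset.sum_range_succ,
      Finset.sum_range_succ _ (n + 1), ← add_assoc, ← Finset.sum_add_distrib]
    congr 1
    · refine Finset.sum_congr rfl fun k hk => ?_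
      rw [Finset.mem_range] at hk
      rw [show n + 1 - k = n - k + 1 by omega, hs]
      ring
    · simp [h0]

/-- The cubic (j + θ)³/6 is expanded in the figurate polynomials 1, j+1, (j+1)(j+2)/2,
(j+1)(j+2)(j+3)/6. These are iterated partial sums of 1, so their convolutions are single
coefficients of orders β + 1 to β + 4. -/
lemma sum_risingCoeff_mul_cube (β θ : ℝ) (n : ℕ) :
    ∑ k ∈ Finset.range (n + 1), risingCoeff β k * ((n : ℝ) + θ - k) ^ 3 / 6
      = risingCoeff (β + 4) n + (θ - 2) * risingCoeff (β + 3) n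
        + (3 * θ ^ 2 - 9 * θ + 7) / 6 * risingCoeff (β + 2) n
        + (θ - 1) ^ 3 / 6 * risingCoeff (β + 1) n := by
  have h1 : ∀ n, ∑ k ∈ Finset.range (n + 1), risingCoeff β k * (fun _ : ℕ => (1 : ℝ)) (n - k)
      = risingCoeff (β + 1) n := fun n => by simpa using sum_risingCoeff β n
  have h2 := sum_risingCoeff_mul_succ (q := fun _ => 1) (q' := fun j : ℕ => (j : ℝ) + 1) (by simp)
    (fun j => by push_cast; ring) h1
  have h3 := sum_risingCoeff_mul_succ (q := fun j : ℕ => (j : ℝ) + 1)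
    (q' := fun j : ℕ => ((j : ℝ) + 1) * (j + 2) / 2) (by simp)
    (fun j => by push_cast; ring) h2
  have h4 := sum_risingCoeff_mul_succ (q := fun j : ℕ => ((j : ℝ) + 1) * (j + 2) / 2)
    (q' := fun j : ℕ => ((j : ℝ) + 1) * (j + 2) * (j + 3) / 6) (by norm_num)
    (fun j => by push_cast; ring) h3
  rw [show β + 4 = β + 1 + 1 + 1 + 1 by ring, show β + 3 = β + 1 + 1 + 1 by ring,
    show β + 2 = β + 1 + 1 by ring, ← h4 n, ← h3 n, ← h2 n, ← h1 n, Finset.mul_sum,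
    Finset.mul_sum, Finset.mul_sum, ← Finset.sum_add_distrib, ← Finset.sum_add_distrib,
    ← Finset.sum_add_distrib]
  refine Finset.sum_congr rfl fun k hk => ?_
  rw [Finset.mem_range] at hk
  rw [Nat.cast_sub (by omega)]
  ring

/-! ### Taylor bounds for real powers away from zero. -/

lemma abs_rpow_sub_rpow_le {r m x y : ℝ} (hr₀ : 0 ≤ r) (hr : r ≤ 1) (hm : 0 < m) (hx : m ≤ x)
    (hy : m ≤ y) : |y ^ r - x ^ r| ≤ r * m ^ (r - 1) * |y - x| := by
  have h := Convex.norm_image_sub_le_of_norm_hasDerivWithin_le (f := fun z : ℝ => z ^ r)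
    (f' := fun z => r * z ^ (r - 1)) (C := r * m ^ (r - 1)) (s := Ici m)
    (fun z hz => (Real.hasDerivAt_rpow_const
      (Or.inl (hm.trans_le hz).ne')).hasDerivWithinAt) ?_ (convex_Ici m) hx hy
  · simpa only [Real.norm_eq_abs] using h
  · intro z hz
    have hz0 : 0 < z := hm.trans_le hz
    rw [Real.norm_of_nonneg (by positivity)]
    exact mul_le_mul_of_nonneg_left (Real.rpow_le_rpow_of_nonpos hm hz (by linarith)) hr₀

lemma abs_rpow_taylor_le {p m x y : ℝ} (hp₁ : 1 ≤ p) (hp₂ : p ≤ 2) (hm : 0 < m) (hx : m ≤ x)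
    (hy : m ≤ y) :
    |y ^ p - x ^ p - p * x ^ (p - 1) * (y - x)| ≤ p * (p - 1) * m ^ (p - 2) * (y - x) ^ 2 := by
  have hsub : ∀ z ∈ uIcc x y, m ≤ z := fun z hz =>
    (le_min hx hy).trans hz.1
  have h := Convex.norm_image_sub_le_of_norm_hasDerivWithin_le
    (f := fun z : ℝ => z ^ p - p * x ^ (p - 1) * z)
    (f' := fun z => p * z ^ (p - 1) - p * x ^ (p - 1) * 1)
    (C := p * (p - 1) * m ^ (p - 2) * |y - x|) (s := uIcc x y)
    (fun z hz => ((Real.hasDerivAt_rpow_const (Or.inl (hm.trans_le (hsub z hz)).ne')).sub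
      ((hasDerivAt_id z).const_mul _)).hasDerivWithinAt) ?_ (convex_uIcc x y)
      left_mem_uIcc right_mem_uIcc
  · simp only [Real.norm_eq_abs] at h
    calc _ = |y ^ p - p * x ^ (p - 1) * y - (x ^ p - p * x ^ (p - 1) * x)| := by congr 1; ring
      _ ≤ _ := h
      _ = _ := by rw [mul_assoc, ← sq, sq_abs]
  · intro z hz
    have h1 := abs_rpow_sub_rpow_le (r := p - 1) (by linarith) (by linarith) hm hx (hsub z hz)
    have h2 : |z - x| ≤ |y - x| := abs_sub_left_of_mem_uIcc hz
    rw [mul_one, ← mul_sub, Real.norm_eq_abs, abs_mul, abs_of_nonneg (by linarith : 0 ≤ p)]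
    rw [show p - 1 - 1 = p - 2 by ring] at h1
    have hc : 0 ≤ (p - 1) * m ^ (p - 2) := mul_nonneg (by linarith) (by positivity)
    calc p * |z ^ (p - 1) - x ^ (p - 1)| ≤ p * ((p - 1) * m ^ (p - 2) * |y - x|) := by
          gcongr
          exact h1.trans (by gcongr)
      _ = _ := by ring

-- The sum is a combination of the coefficients of orders 4-α, 3-α, 2-α and 1-α. The first has its
-- precise asymptotics around X = n + (4-α)/2, the second is needed to first order, and the last two
-- are O(n^{1-α}). The first two terms form the Taylor expansion of (X + θ - 2)^{3-α}, and X + θ - 2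
-- = n + θ - α/2.
set_option maxHeartbeats 1000000 in
lemma exists_sum_grunwald_cube_bound {α : ℝ} (h₁ : 1 < α) (h₂ : α < 2) :
    ∃ C, 0 ≤ C ∧ ∀ n : ℕ, 1 ≤ n → ∀ θ : ℝ, 0 ≤ θ → θ ≤ 1 →
      |∑ k ∈ Finset.range (n + 1), grunwald α k * ((n : ℝ) + θ - k) ^ 3 / 6
        - ((n : ℝ) + θ - α / 2) ^ (3 - α) / Real.Gamma (4 - α)| ≤ C * (n : ℝ) ^ (1 - α) := by
  obtain ⟨C₁, hC₁, hA⟩ := exists_risingCoeff_bound (β := 4 - α) (by linarith) (by linarith)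
  set G := Real.Gamma (4 - α) with hG
  have hG0 : 0 < G := Real.Gamma_pos_of_pos (by linarith)
  set p := 3 - α with hp
  set C₂ : ℝ := 9 / G + C₁ with hC₂
  set C₃ : ℝ := 2 * C₁ + 3 / G with hC₃
  set C₄ : ℝ := p * (p - 1) * (1 - α / 2) ^ (p - 2) * 4 / G with hC₄
  have hm : 0 < 1 - α / 2 := by linarith
  have hC₄0 : 0 ≤ C₄ := by
    have : 0 ≤ p - 1 := by linarith
    have : 0 ≤ p := by linarith
    positivity
  refine ⟨C₁ + 2 * C₃ + 4 * C₂ + C₂ * 2 / (2 - α) + C₄, ?_, fun n hn θ hθ₀ hθ₁ => ?_⟩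
  · have : 0 < 2 - α := by linarith
    positivity
  have hn' : (1 : ℝ) ≤ n := by exact_mod_cast hn
  have hn0 : (0 : ℝ) < n := by linarith
  set M := (n : ℝ) ^ (1 - α) with hM
  have hM0 : 0 < M := by positivity
  have hM1 : (n : ℝ) ^ (p - 1) = M * n := by
    rw [hM, ← Real.rpow_add_one hn0.ne']; congr 1; rw [hp]; ring
  have hM2 : (n : ℝ) ^ p = M * n ^ 2 := by
    rw [hM, ← Real.rpow_natCast, ← Real.rpow_add hn0]; congr 1; rw [hp]; push_cast; ring
  set X : ℝ := (n : ℝ) + (4 - α) / 2 with hX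
  have hX0 : 0 < X := by linarith
  have hXn : X ≤ 3 * n := by linarith
  have hXp : X ^ p ≤ 9 * (M * n ^ 2) := by
    calc X ^ p ≤ (3 * n) ^ p := Real.rpow_le_rpow hX0.le hXn (by linarith)
      _ = 3 ^ p * (M * n ^ 2) := by rw [Real.mul_rpow (by norm_num) hn0.le, hM2]
      _ ≤ 3 ^ (2 : ℝ) * (M * n ^ 2) := by
          gcongr
          · norm_num
          · linarith
      _ = _ := by norm_num
  have hXp1 : X ^ (p - 1) ≤ 3 * (M * n) := by
    calc X ^ (p - 1) ≤ (3 * n) ^ (p - 1) := Real.rpow_le_rpow hX0.le hXn (by linarith)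
      _ = 3 ^ (p - 1) * (M * n) := by rw [Real.mul_rpow (by norm_num) hn0.le, hM1]
      _ ≤ 3 ^ (1 : ℝ) * (M * n) := by
          gcongr
          · norm_num
          · linarith
      _ = _ := by norm_num
  have hA := hA n hn
  rw [show 4 - α - 1 = p by rw [hp]; ring, show 4 - α - 3 = 1 - α by ring, ← hX] at hA
  set P₄ := risingCoeff (4 - α) n with hP₄
  set P₃ := risingCoeff (3 - α) n with hP₃
  set P₂ := risingCoeff (2 - α) n with hP₂
  set P₁ := risingCoeff (1 - α) n with hP₁
  have r3 : P₃ * (p + n) = P₄ * p := by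
    have := risingCoeff_add_one_mul (3 - α) n
    rw [show 3 - α + 1 = 4 - α by ring] at this
    exact this.symm
  have r2 : P₂ * (p - 1 + n) = P₃ * (p - 1) := by
    have := risingCoeff_add_one_mul (2 - α) n
    rw [show 2 - α + 1 = 3 - α by ring] at this
    rw [show p - 1 = 2 - α by rw [hp]; ring]
    exact this.symm
  have r1 : P₁ * (p - 2 + n) = P₂ * (p - 2) := by
    have := risingCoeff_add_one_mul (1 - α) n
    rw [show 1 - α + 1 = 2 - α by ring] at this
    rw [show p - 2 = 1 - α by rw [hp]; ring]
    exact this.symm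
  have hP₄0 : 0 < P₄ := risingCoeff_pos (by linarith) n
  have hP₃0 : 0 < P₃ := risingCoeff_pos (by linarith) n
  have hP₂0 : 0 < P₂ := risingCoeff_pos (by linarith) n
  have hn2 : M ≤ M * n ^ 2 := le_mul_of_one_le_right hM0.le (one_le_pow₀ hn')
  have b4 : P₄ ≤ C₂ * (M * n ^ 2) := by
    have h1 := (abs_le.1 hA).2
    have h2 : X ^ p / G ≤ 9 * (M * n ^ 2) / G := by gcongr
    have h3 : C₁ * M ≤ C₁ * (M * n ^ 2) := by gcongr
    calc P₄ ≤ C₁ * (M * n ^ 2) + 9 * (M * n ^ 2) / G := by linarith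
      _ = _ := by rw [hC₂]; ring
  have b3 : |P₃ - p * X ^ (p - 1) / G| ≤ C₃ * M := by
    -- The exact relation P₃(p + n) = pP₄ transfers the asymptotics; replacing p + n by X costs only
    -- a multiple of X^{p-1}, which is O(Mn) and is absorbed on dividing by n.
    have e : (P₃ - p * X ^ (p - 1) / G) * (p + n)
        = p * (P₄ - X ^ p / G) + p * (X ^ (p - 1) * ((4 - α) / 2 - p) / G) := by
      have : X ^ p = X ^ (p - 1) * X := by
        rw [← Real.rpow_add_one hX0.ne']; ring_nf
      rw [this, sub_mul, r3, hX]
      ring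
    have h1 : |p * (P₄ - X ^ p / G)| ≤ 2 * (C₁ * M) := by
      rw [abs_mul, abs_of_nonneg (by linarith : 0 ≤ p)]
      gcongr
      linarith
    have h2 : |p * (X ^ (p - 1) * ((4 - α) / 2 - p) / G)| ≤ 2 * (3 * (M * n) * (1 / 2) / G) := by
      rw [abs_mul, abs_of_nonneg (by linarith : 0 ≤ p), abs_div, abs_mul, abs_of_pos hG0,
        abs_of_pos (by positivity : 0 < X ^ (p - 1))]
      gcongr
      · linarith
      · rw [abs_le]; constructor <;> linarith
    have h3 : |P₃ - p * X ^ (p - 1) / G| * n ≤ C₃ * M * n := by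
      calc _ ≤ |P₃ - p * X ^ (p - 1) / G| * (p + n) := by gcongr; linarith
        _ = |(P₃ - p * X ^ (p - 1) / G) * (p + n)| := by
            rw [abs_mul, abs_of_pos (by linarith : 0 < p + n)]
        _ ≤ 2 * (C₁ * M) + 2 * (3 * (M * n) * (1 / 2) / G) := by
            rw [e]; exact (abs_add_le _ _).trans (add_le_add h1 h2)
        _ ≤ 2 * (C₁ * (M * n)) + 2 * (3 * (M * n) * (1 / 2) / G) := by
            gcongr
            exact le_mul_of_one_le_right hM0.le hn'
        _ = _ := by rw [hC₃]; ring
    exact le_of_mul_le_mul_right h3 hn0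
  have b2 : P₂ ≤ C₂ * M * 2 := by
    have h : P₂ * n ^ 2 ≤ C₂ * M * 2 * n ^ 2 := by
      calc P₂ * n ^ 2 ≤ P₂ * ((p - 1 + n) * (p + n)) := by
            gcongr
            nlinarith [mul_nonneg (by linarith : 0 ≤ p - 1) hn0.le,
              mul_nonneg (by linarith : 0 ≤ p) (by linarith : 0 ≤ p - 1)]
        _ = P₄ * (p * (p - 1)) := by linear_combination (p + n) * r2 + (p - 1) * r3
        _ ≤ C₂ * (M * n ^ 2) * (2 * 1) := by
            have : 0 ≤ p - 1 := by linarith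
            have : 0 ≤ p := by linarith
            gcongr <;> linarith
        _ = _ := by ring
    exact le_of_mul_le_mul_right h (by positivity)
  have b1 : |P₁| ≤ C₂ * 2 / (2 - α) * M := by
    have hα : 0 < 2 - α := by linarith
    have e : |P₁| * (p - 2 + n) = P₂ * |p - 2| := by
      have := congrArg abs r1
      rwa [abs_mul, abs_mul, abs_of_pos hP₂0, abs_of_pos (by linarith : 0 < p - 2 + n)] at this
    have h : |P₁| * (2 - α) ≤ C₂ * M * 2 := by
      calc _ ≤ |P₁| * (p - 2 + n) := by gcongr; linarith
        _ = P₂ * |p - 2| := e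
        _ ≤ P₂ * 1 := by
            gcongr
            rw [abs_le]; constructor <;> linarith
        _ ≤ _ := by linarith
    rw [← le_div_iff₀ hα] at h
    refine h.trans (le_of_eq ?_)
    ring
  have tay : |(X + (θ - 2)) ^ p / G - X ^ p / G - (θ - 2) * (p * X ^ (p - 1) / G)| ≤ C₄ * M := by
    have hαn : 1 * (α / 2) ≤ n * (α / 2) := by gcongr
    have ht := abs_rpow_taylor_le (p := p) (m := n * (1 - α / 2)) (x := X) (y := X + (θ - 2))
      (by linarith) (by linarith) (by positivity) (by linarith) (by linarith)
    have e : (X + (θ - 2)) ^ p / G - X ^ p / G - (θ - 2) * (p * X ^ (p - 1) / G)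
        = ((X + (θ - 2)) ^ p - X ^ p - p * X ^ (p - 1) * (X + (θ - 2) - X)) / G := by
      ring
    rw [e, abs_div, abs_of_pos hG0, div_le_iff₀ hG0]
    refine ht.trans ?_
    rw [Real.mul_rpow hn0.le hm.le, show (n : ℝ) ^ (p - 2) = M by rw [hM, hp]; ring_nf, hC₄]
    have hθ4 : (X + (θ - 2) - X) ^ 2 ≤ 4 := by nlinarith
    have : 0 ≤ p - 1 := by linarith
    have : 0 ≤ p := by linarith
    calc _ ≤ p * (p - 1) * (M * (1 - α / 2) ^ (p - 2)) * 4 := by gcongr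
      _ = _ := by field_simp
  have hsum := sum_risingCoeff_mul_cube (-α) θ n
  simp only [← grunwald_eq_risingCoeff] at hsum
  rw [hsum, show -α + 4 = 4 - α by ring, show -α + 3 = 3 - α by ring,
    show -α + 2 = 2 - α by ring, show -α + 1 = 1 - α by ring, ← hP₄, ← hP₃, ← hP₂, ← hP₁,
    show (n : ℝ) + θ - α / 2 = X + (θ - 2) by rw [hX]; ring]
  have d3 : |(θ - 2) * (P₃ - p * X ^ (p - 1) / G)| ≤ 2 * (C₃ * M) := by
    rw [abs_mul]
    gcongr
    rw [abs_le]; constructor <;> linarith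
  have d2 : |(3 * θ ^ 2 - 9 * θ + 7) / 6 * P₂| ≤ 2 * (C₂ * M * 2) := by
    rw [abs_mul, abs_of_pos hP₂0]
    gcongr
    rw [abs_le]; constructor <;> nlinarith
  have d1 : |(θ - 1) ^ 3 / 6 * P₁| ≤ 1 * (C₂ * 2 / (2 - α) * M) := by
    rw [abs_mul]
    gcongr
    rw [abs_div, abs_pow, abs_of_nonpos (by linarith : θ - 1 ≤ 0)]
    have : (-(θ - 1)) ^ 3 ≤ 1 := pow_le_one₀ (by linarith) (by linarith)
    rw [abs_of_pos (by norm_num : (0 : ℝ) < 6)]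
    linarith
  rw [abs_le] at hA d1 d2 d3 tay ⊢
  constructor <;> linarith [hA.1, hA.2, d1.1, d1.2, d2.1, d2.2, d3.1, d3.2, tay.1, tay.2]

/-- The Grünwald operator applied to the truncated cubic `x₊ ^ 3 / 6`. -/
def grunwaldKernel (α x : ℝ) : ℝ :=
  ∑ k ∈ Finset.range ⌈x⌉₊, grunwald α k * max (x - k) 0 ^ 3 / 6

/-- Terms with k ≥ x vanish, so the range may be any sufficiently long one. This allows the three
shifted kernels to be compared with one finite sum. -/
lemma sum_grunwald_eq_grunwaldKernel (α : ℝ) {x : ℝ} {N : ℕ} (h : x ≤ N) :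
    ∑ k ∈ Finset.range N, grunwald α k * max (x - k) 0 ^ 3 / 6 = grunwaldKernel α x := by
  refine (Finset.sum_subset (Finset.range_mono (Nat.ceil_le.2 h)) fun k _ hk => ?_).symm
  rw [Finset.mem_range, not_lt, Nat.ceil_le] at hk
  rw [max_eq_right (by linarith)]
  simp

lemma grunwaldKernel_of_nonpos (α : ℝ) {x : ℝ} (hx : x ≤ 0) : grunwaldKernel α x = 0 := by
  rw [← sum_grunwald_eq_grunwaldKernel α (N := 0) (by simpa using hx)]
  simp

lemma abs_grunwaldKernel_le (α : ℝ) {x : ℝ} (hx : x ≤ 3) :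
    |grunwaldKernel α x| ≤ ∑ k ∈ Finset.range 3, |grunwald α k| * 3 ^ 3 / 6 := by
  rw [← sum_grunwald_eq_grunwaldKernel α (N := 3) (by simpa using hx)]
  refine (Finset.abs_sum_le_sum_abs _ _).trans (Finset.sum_le_sum fun k _ => ?_)
  rw [abs_div, abs_mul, abs_of_pos (by norm_num : (0 : ℝ) < 6),
    abs_of_nonneg (by positivity : 0 ≤ max (x - k) 0 ^ 3)]
  have : max (x - k) 0 ≤ 3 :=
    max_le (by linarith [(Nat.cast_nonneg k : (0 : ℝ) ≤ k)]) (by norm_num)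
  gcongr

lemma exists_grunwaldKernel_bound {α : ℝ} (h₁ : 1 < α) (h₂ : α < 2) :
    ∃ C, 0 ≤ C ∧ ∀ x : ℝ, 1 ≤ x →
      |grunwaldKernel α x - (x - α / 2) ^ (3 - α) / Real.Gamma (4 - α)| ≤ C * x ^ (1 - α) := by
  obtain ⟨C, hC, h⟩ := exists_sum_grunwald_cube_bound h₁ h₂
  refine ⟨C * (1 / 2) ^ (1 - α), by positivity, fun x hx => ?_⟩
  have hx0 : 0 ≤ x := by linarith
  have hn : 1 ≤ ⌊x⌋₊ := Nat.le_floor (by simpa using hx)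
  have hn' : (1 : ℝ) ≤ ⌊x⌋₊ := by exact_mod_cast hn
  have hle := Nat.floor_le hx0
  have hlt := Nat.lt_floor_add_one x
  have key := h ⌊x⌋₊ hn (x - ⌊x⌋₊) (by linarith) (by linarith)
  rw [add_sub_cancel] at key
  have e : ∑ k ∈ Finset.range (⌊x⌋₊ + 1), grunwald α k * (x - k) ^ 3 / 6 = grunwaldKernel α x := by
    rw [← sum_grunwald_eq_grunwaldKernel α (N := ⌊x⌋₊ + 1) (by push_cast; linarith)]
    refine Finset.sum_congr rfl fun k hk => ?_
    have hk' : k ≤ ⌊x⌋₊ := by rw [Finset.mem_range] at hk; omega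
    have : (k : ℝ) ≤ ⌊x⌋₊ := by exact_mod_cast hk'
    rw [max_eq_left (by linarith)]
  rw [e] at key
  refine key.trans ?_
  rw [mul_assoc, ← Real.mul_rpow (by norm_num) hx0]
  gcongr ?_ * ?_
  exact Real.rpow_le_rpow_of_nonpos (by linarith) (by linarith) (by linarith)

/-- The Peano kernel of the WSGD approximation of the fractional derivative of order `α`. -/
def wsgdKernel (α γ₁ γ₂ γ₃ x : ℝ) : ℝ :=
  γ₁ * grunwaldKernel α (x + 1) + γ₂ * grunwaldKernel α x + γ₃ * grunwaldKernel α (x - 1)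
    - max x 0 ^ (3 - α) / Real.Gamma (4 - α)

lemma wsgdKernel_of_le_neg_one {α γ₁ γ₂ γ₃ x : ℝ} (h₂ : α < 2) (hx : x ≤ -1) :
    wsgdKernel α γ₁ γ₂ γ₃ x = 0 := by
  rw [wsgdKernel, grunwaldKernel_of_nonpos α (by linarith), grunwaldKernel_of_nonpos α
    (by linarith), grunwaldKernel_of_nonpos α (by linarith), max_eq_right (by linarith),
    Real.zero_rpow (by linarith)]
  simp

lemma sum_wsgdCoeff_mul_cube (α γ₁ γ₂ γ₃ : ℝ) {x : ℝ} {n : ℕ} (hx : x ≤ n + 1) :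
    ∑ k ∈ Finset.range (n + 2), wsgdCoeff α γ₁ γ₂ γ₃ k * (max (x + 1 - k) 0 ^ 3 / 6)
      = wsgdKernel α γ₁ γ₂ γ₃ x + max x 0 ^ (3 - α) / Real.Gamma (4 - α) := by
  rw [sum_wsgdCoeff_mul, wsgdKernel, sub_add_cancel,
    ← sum_grunwald_eq_grunwaldKernel α (x := x + 1) (N := n + 2) (by push_cast; linarith),
    ← sum_grunwald_eq_grunwaldKernel α (x := x) (N := n + 1) (by push_cast; linarith),
    ← sum_grunwald_eq_grunwaldKernel α (x := x - 1) (N := n) (by linarith)]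
  have e1 : ∀ k : ℕ, x + 1 - ((k + 1 : ℕ) : ℝ) = x - k := fun k => by push_cast; ring
  have e2 : ∀ k : ℕ, x - ((k + 1 : ℕ) : ℝ) = x - 1 - k := fun k => by push_cast; ring
  simp only [e1, e2, mul_div_assoc]

-- For x ≥ 2 each shifted Grünwald kernel is replaced by a power of x + 1 - α/2, x - α/2 or x - 1 -
-- α/2, and the powers are expanded at x. The zeroth-order terms cancel against x^{3-α} as the γ's
-- sum to 1, and the first-order terms cancel as γ₁ - γ₃ = α/2; the rest is O(x^{1-α}). For x ≤ 2 a
-- constant bound suffices, since x^{1-α} ≥ 1/2 on (0, 2].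
set_option maxHeartbeats 1000000 in
lemma exists_wsgdKernel_bound {α γ₁ γ₂ γ₃ : ℝ} (h₁ : 1 < α) (h₂ : α < 2)
    (hγ : AdmissibleWeights α γ₁ γ₂ γ₃) :
    ∃ C, 0 ≤ C ∧ (∀ x, x ≤ 0 → |wsgdKernel α γ₁ γ₂ γ₃ x| ≤ C) ∧
      ∀ x, 0 < x → |wsgdKernel α γ₁ γ₂ γ₃ x| ≤ C * x ^ (1 - α) := by
  obtain ⟨C, hC, hk⟩ := exists_grunwaldKernel_bound h₁ h₂
  set G := Real.Gamma (4 - α) with hG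
  have hG0 : 0 < G := Real.Gamma_pos_of_pos (by linarith)
  set D := ∑ k ∈ Finset.range 3, |grunwald α k| * 3 ^ 3 / 6 with hD
  have hD0 : 0 ≤ D := Finset.sum_nonneg fun k _ => by positivity
  set S := |γ₁| + |γ₂| + |γ₃| with hS
  set p := 3 - α with hp
  -- Chosen so that x - 1 - α/2 ≥ cx for all x ≥ 2, with equality at x = 2. All expansion points
  -- then stay at least cx.
  set c : ℝ := (1 - α / 2) / 2 with hc
  have hc0 : 0 < c := by linarith
  set Ca := S * D + 2 ^ p / G with hCa
  have hCa0 : 0 ≤ Ca := by positivity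
  set T := p * (p - 1) * c ^ (p - 2) * 4 with hT
  have hT0 : 0 ≤ T := by
    have : 0 ≤ p - 1 := by linarith
    have : 0 ≤ p := by linarith
    positivity
  set Cb := S * (C * (1 / 2) ^ (1 - α)) + S * T / G with hCb
  have hCb0 : 0 ≤ Cb := by positivity
  have small : ∀ x, x ≤ 2 → |wsgdKernel α γ₁ γ₂ γ₃ x| ≤ Ca := by
    intro x hx
    have a1 := abs_grunwaldKernel_le α (x := x + 1) (by linarith)
    have a2 := abs_grunwaldKernel_le α (x := x) (by linarith)
    have a3 := abs_grunwaldKernel_le α (x := x - 1) (by linarith)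
    have a4 : max x 0 ^ p / G ≤ 2 ^ p / G :=
      div_le_div_of_nonneg_right (Real.rpow_le_rpow (le_max_right _ _)
        (max_le hx (by norm_num)) (by linarith)) hG0.le
    have a5 : 0 ≤ max x 0 ^ p / G := by positivity
    have b1 : |γ₁ * grunwaldKernel α (x + 1)| ≤ |γ₁| * D := by rw [abs_mul]; gcongr
    have b2 : |γ₂ * grunwaldKernel α x| ≤ |γ₂| * D := by rw [abs_mul]; gcongr
    have b3 : |γ₃ * grunwaldKernel α (x - 1)| ≤ |γ₃| * D := by rw [abs_mul]; gcongr
    rw [wsgdKernel, hCa, hS]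
    rw [abs_le] at b1 b2 b3 ⊢
    constructor <;> linarith [b1.1, b1.2, b2.1, b2.2, b3.1, b3.2]
  refine ⟨2 * Ca + Cb, by positivity, fun x hx => (small x (by linarith)).trans (by linarith),
    fun x hx => ?_⟩
  rcases le_total x 2 with hx2 | hx2
  · have h1 : (1 : ℝ) / 2 ≤ x ^ (1 - α) := by
      calc (1 : ℝ) / 2 = 2 ^ (-1 : ℝ) := by rw [Real.rpow_neg_one]; norm_num
        _ ≤ 2 ^ (1 - α) := Real.rpow_le_rpow_of_exponent_le (by norm_num) (by linarith)
        _ ≤ x ^ (1 - α) := Real.rpow_le_rpow_of_nonpos hx hx2 (by linarith)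
    have h2 := small x hx2
    nlinarith [mul_nonneg hCb0 (by linarith : 0 ≤ x ^ (1 - α))]
  · set M := x ^ (1 - α) with hM
    have hM0 : 0 < M := by positivity
    have step : ∀ y, x / 2 ≤ y → 1 ≤ y → |grunwaldKernel α y - (y - α / 2) ^ p / G|
        ≤ C * (1 / 2) ^ (1 - α) * M := by
      intro y hy hy1
      refine (hk y hy1).trans ?_
      rw [mul_assoc, hM, ← Real.mul_rpow (by norm_num) hx.le]
      gcongr ?_ * ?_
      exact Real.rpow_le_rpow_of_nonpos (by linarith) (by linarith) (by linarith)
    have tay : ∀ y, c * x ≤ y → |y - x| ≤ 2 →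
        |y ^ p - x ^ p - p * x ^ (p - 1) * (y - x)| ≤ T * M := by
      intro y hy hyx
      have := abs_rpow_taylor_le (p := p) (m := c * x) (x := x) (y := y) (by linarith)
        (by linarith) (by positivity) (by nlinarith) hy
      refine this.trans ?_
      have hsq : (y - x) ^ 2 ≤ 4 := by
        have := sq_le_sq' (abs_le.1 hyx).1 (abs_le.1 hyx).2
        linarith
      rw [Real.mul_rpow hc0.le hx.le, show x ^ (p - 2) = M by rw [hM, hp]; ring_nf, hT]
      have : 0 ≤ p - 1 := by linarith
      have : 0 ≤ p := by linarith
      calc _ ≤ p * (p - 1) * (c ^ (p - 2) * M) * 4 := by gcongr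
        _ = _ := by ring
    have s1 := step (x + 1) (by linarith) (by linarith)
    have s2 := step x (by linarith) (by linarith)
    have s3 := step (x - 1) (by linarith) (by linarith)
    have t1 := tay (x + 1 - α / 2) (by nlinarith) (by rw [abs_le]; constructor <;> linarith)
    have t2 := tay (x - α / 2) (by nlinarith) (by rw [abs_le]; constructor <;> linarith)
    have t3 := tay (x - 1 - α / 2) (by nlinarith) (by rw [abs_le]; constructor <;> linarith)
    have e : wsgdKernel α γ₁ γ₂ γ₃ x
        = γ₁ * (grunwaldKernel α (x + 1) - (x + 1 - α / 2) ^ p / G)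
          + γ₂ * (grunwaldKernel α x - (x - α / 2) ^ p / G)
          + γ₃ * (grunwaldKernel α (x - 1) - (x - 1 - α / 2) ^ p / G)
          + (γ₁ * ((x + 1 - α / 2) ^ p - x ^ p - p * x ^ (p - 1) * (x + 1 - α / 2 - x))
          + γ₂ * ((x - α / 2) ^ p - x ^ p - p * x ^ (p - 1) * (x - α / 2 - x))
          + γ₃ * ((x - 1 - α / 2) ^ p - x ^ p - p * x ^ (p - 1) * (x - 1 - α / 2 - x))) / G := by
      rw [wsgdKernel, max_eq_left hx.le, hγ.eq₂, hγ.eq₃, ← hG, ← hp]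
      field_simp
      ring
    have m : ∀ {g a b : ℝ}, |a| ≤ b → |g * a| ≤ |g| * b := fun h => by
      rw [abs_mul]; gcongr
    have hsum : |γ₁ * ((x + 1 - α / 2) ^ p - x ^ p - p * x ^ (p - 1) * (x + 1 - α / 2 - x))
          + γ₂ * ((x - α / 2) ^ p - x ^ p - p * x ^ (p - 1) * (x - α / 2 - x))
          + γ₃ * ((x - 1 - α / 2) ^ p - x ^ p - p * x ^ (p - 1) * (x - 1 - α / 2 - x))|
        ≤ S * (T * M) := by
      refine (abs_add_three _ _ _).trans ?_
      have := add_le_add (add_le_add (m (g := γ₁) t1) (m (g := γ₂) t2)) (m (g := γ₃) t3)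
      refine this.trans (le_of_eq ?_)
      rw [hS]; ring
    have hsum' := div_le_div_of_nonneg_right hsum hG0.le
    have hker : |γ₁ * (grunwaldKernel α (x + 1) - (x + 1 - α / 2) ^ p / G)
          + γ₂ * (grunwaldKernel α x - (x - α / 2) ^ p / G)
          + γ₃ * (grunwaldKernel α (x - 1) - (x - 1 - α / 2) ^ p / G)|
        ≤ S * (C * (1 / 2) ^ (1 - α) * M) := by
      refine (abs_add_three _ _ _).trans ?_
      have := add_le_add (add_le_add (m (g := γ₁) s1) (m (g := γ₂) s2)) (m (g := γ₃) s3)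
      refine this.trans (le_of_eq ?_)
      rw [hS]; ring
    calc _ ≤ S * (C * (1 / 2) ^ (1 - α) * M) + S * (T * M) / G := by
          rw [e]
          refine (abs_add_le _ _).trans (add_le_add hker ?_)
          rwa [abs_div, abs_of_pos hG0]
      _ = Cb * M := by rw [hCb]; ring
      _ ≤ _ := by gcongr; linarith

/-! ### Riemann-Liouville integrals of smooth functions vanishing at the left endpoint -/

/-- `f 0, f 1, …, f n` are successive derivatives on `[a, b]`, all but the last of which vanish at
`a`. -/
structure IsDerivChain (a b : ℝ) (n : ℕ) (f : ℕ → ℝ → ℝ) : Prop where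
  continuousOn : ∀ i ≤ n, ContinuousOn (f i) (Icc a b)
  hasDerivAt : ∀ i < n, ∀ x ∈ Ioo a b, HasDerivAt (f i) (f (i + 1) x) x
  eq_zero : ∀ i < n, f i a = 0

open MeasureTheory

lemma intervalIntegrable_sub_rpow {p : ℝ} (hp : -1 < p) (x c d : ℝ) :
    IntervalIntegrable (fun ξ : ℝ => (x - ξ) ^ p) volume c d := by
  have h : IntervalIntegrable (fun ξ : ℝ => ξ ^ p) volume (x - c) (x - d) :=
    intervalIntegral.intervalIntegrable_rpow' hp
  simpa using h.comp_sub_left x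

namespace IsDerivChain

variable {a b : ℝ} {n : ℕ} {f : ℕ → ℝ → ℝ}

/-- Integration by parts. The boundary term at a vanishes because f i does, the one at x because p +
1 > 0; a singular weight with -1 < p < 0 is allowed. -/
lemma integral_mul_rpow (hf : IsDerivChain a b n f) {i : ℕ} (hi : i < n) {p : ℝ} (hp : -1 < p)
    {x : ℝ} (hx : x ∈ Icc a b) :
    ∫ ξ in a..x, f i ξ * (x - ξ) ^ p
      = (∫ ξ in a..x, f (i + 1) ξ * (x - ξ) ^ (p + 1)) / (p + 1) := by
  have hsub : uIcc a x ⊆ Icc a b := by rw [uIcc_of_le hx.1]; exact Icc_subset_Icc_right hx.2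
  have hp1 : p + 1 ≠ 0 := by linarith
  have h := intervalIntegral.integral_mul_deriv_eq_deriv_mul_of_hasDerivAt (a := a) (b := x)
    (u := f i) (u' := f (i + 1)) (v := fun ξ => -((x - ξ) ^ (p + 1) / (p + 1)))
    (v' := fun ξ => (x - ξ) ^ p) ((hf.continuousOn i hi.le).mono hsub) ?_ ?_ ?_
    ((hf.continuousOn (i + 1) hi).mono hsub).intervalIntegrable
    (intervalIntegrable_sub_rpow hp x a x)
  · rw [h, hf.eq_zero i hi, sub_self, Real.zero_rpow hp1, ← intervalIntegral.integral_div]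
    simp only [mul_neg, intervalIntegral.integral_neg, mul_div_assoc]
    simp
  · refine Continuous.continuousOn (Continuous.neg (Continuous.div_const ?_ _))
    exact (continuous_const.sub continuous_id).rpow_const fun _ => Or.inr (by linarith)
  · intro ξ hξ
    rw [min_eq_left hx.1, max_eq_right hx.1] at hξ
    exact hf.hasDerivAt i hi ξ ⟨hξ.1, hξ.2.trans_le hx.2⟩
  · intro ξ hξ
    rw [min_eq_left hx.1, max_eq_right hx.1] at hξ
    have h1 : HasDerivAt (fun ξ : ℝ => x - ξ) (-1) ξ := by
      simpa using (hasDerivAt_id ξ).const_sub x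
    have h2 := ((h1.rpow_const (p := p + 1) (Or.inl (sub_pos.2 hξ.2).ne')).div_const (p + 1)).neg
    refine h2.congr_deriv ?_
    rw [add_sub_cancel_right]
    field_simp

lemma apply_eq_integral (hf : IsDerivChain a b 4 f) {x : ℝ} (hx : x ∈ Icc a b) :
    f 0 x = (∫ ξ in a..x, f 4 ξ * (x - ξ) ^ 3) / 6 := by
  have hsub : Icc a x ⊆ Icc a b := Icc_subset_Icc_right hx.2
  have h0 : ∫ ξ in a..x, f 1 ξ = f 0 x - f 0 a :=
    intervalIntegral.integral_eq_sub_of_hasDerivAt_of_le hx.1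
      ((hf.continuousOn 0 (by norm_num)).mono hsub)
      (fun y hy => hf.hasDerivAt 0 (by norm_num) y ⟨hy.1, hy.2.trans_le hx.2⟩)
      (((hf.continuousOn 1 (by norm_num)).mono (by rwa [uIcc_of_le hx.1])).intervalIntegrable)
  have h1 := hf.integral_mul_rpow (i := 1) (by norm_num) (p := 0) (by norm_num) hx
  have h2 := hf.integral_mul_rpow (i := 2) (by norm_num) (p := 1) (by norm_num) hx
  have h3 := hf.integral_mul_rpow (i := 3) (by norm_num) (p := 2) (by norm_num) hx
  norm_num at h1 h2 h3
  rw [hf.eq_zero 0 (by norm_num), sub_zero] at h0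
  rw [← h0, h1, h2, h3]
  ring

lemma integral_mul_rpow_two (hf : IsDerivChain a b 4 f) {α : ℝ} (h₂ : α < 2) {x : ℝ}
    (hx : x ∈ Icc a b) :
    (∫ ξ in a..x, f 2 ξ * (x - ξ) ^ (1 - α)) / Real.Gamma (2 - α)
      = (∫ ξ in a..x, f 4 ξ * (x - ξ) ^ (3 - α)) / Real.Gamma (4 - α) := by
  rw [hf.integral_mul_rpow (i := 2) (by norm_num) (by linarith) hx,
    hf.integral_mul_rpow (i := 3) (by norm_num) (by linarith) hx,
    show 1 - α + 1 = 2 - α by ring, show 2 - α + 1 = 3 - α by ring,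
    show 4 - α = 3 - α + 1 by ring, Real.Gamma_add_one (by linarith),
    show Real.Gamma (3 - α) = Real.Gamma (2 - α + 1) by ring_nf, Real.Gamma_add_one (by linarith)]
  simp only [div_div]
  ring_nf

end IsDerivChain

/-! ### Differentiating fractional integrals, written over a fixed interval. -/

lemma integral_mul_max_rpow {a b x p : ℝ} {g : ℝ → ℝ} (hg : ContinuousOn g (Icc a b))
    (hx : x ∈ Icc a b) (hp : 0 < p) :
    ∫ ξ in a..b, g ξ * max (x - ξ) 0 ^ p = ∫ ξ in a..x, g ξ * (x - ξ) ^ p := by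
  have hc : ContinuousOn (fun ξ => g ξ * max (x - ξ) 0 ^ p) (Icc a b) :=
    hg.mul (Continuous.continuousOn (((continuous_const.sub continuous_id).max
      continuous_const).rpow_const fun _ => Or.inr hp.le))
  have i1 : IntervalIntegrable (fun ξ => g ξ * max (x - ξ) 0 ^ p) volume a x :=
    (hc.mono (by rw [uIcc_of_le hx.1]; exact Icc_subset_Icc_right hx.2)).intervalIntegrable
  have i2 : IntervalIntegrable (fun ξ => g ξ * max (x - ξ) 0 ^ p) volume x b :=
    (hc.mono (by rw [uIcc_of_le hx.2]; exact Icc_subset_Icc_left hx.1)).intervalIntegrable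
  rw [← intervalIntegral.integral_add_adjacent_intervals i1 i2]
  have z : ∫ ξ in x..b, g ξ * max (x - ξ) 0 ^ p = 0 := by
    rw [intervalIntegral.integral_congr (g := fun _ => 0), intervalIntegral.integral_zero]
    intro ξ hξ
    rw [uIcc_of_le hx.2] at hξ
    beta_reduce
    rw [max_eq_right (by linarith [hξ.1]), Real.zero_rpow hp.ne', mul_zero]
  rw [z, add_zero]
  refine intervalIntegral.integral_congr fun ξ hξ => ?_
  rw [uIcc_of_le hx.1] at hξ
  rw [max_eq_left (by linarith [hξ.2])]

lemma hasDerivAt_max_rpow {p : ℝ} (hp : 1 < p) (z : ℝ) :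
    HasDerivAt (fun z : ℝ => max z 0 ^ p) (p * max z 0 ^ (p - 1)) z := by
  have hne : ∀ y : ℝ, y ≠ 0 → HasDerivAt (fun z : ℝ => max z 0 ^ p) (p * max y 0 ^ (p - 1)) y := by
    intro y hy
    rcases lt_or_gt_of_ne hy with h | h
    · rw [max_eq_right h.le, Real.zero_rpow (by linarith), mul_zero]
      refine (hasDerivAt_const y (0 : ℝ)).congr_of_eventuallyEq ?_
      filter_upwards [Iio_mem_nhds h] with t ht
      rw [max_eq_right (le_of_lt ht), Real.zero_rpow (by linarith)]
    · rw [max_eq_left h.le]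
      refine (Real.hasDerivAt_rpow_const (Or.inl h.ne')).congr_of_eventuallyEq ?_
      filter_upwards [Ioi_mem_nhds h] with t ht
      rw [max_eq_left (le_of_lt ht)]
  by_cases hz : z = 0
  · subst hz
    refine hasDerivAt_of_hasDerivAt_of_ne (g := fun y => p * max y 0 ^ (p - 1)) hne ?_ ?_
    · exact ((continuous_id.max continuous_const).rpow_const
        fun _ => Or.inr (by linarith)).continuousAt
    · exact (continuous_const.mul ((continuous_id.max continuous_const).rpow_const
        fun _ => Or.inr (by linarith))).continuousAt
  · exact hne z hz

lemma hasDerivAt_integral_mul_max_rpow {a b p : ℝ} (hab : a ≤ b) {g : ℝ → ℝ}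
    (hg : ContinuousOn g (Icc a b)) (hp : 1 < p) (y : ℝ) :
    HasDerivAt (fun y => ∫ ξ in a..b, g ξ * max (y - ξ) 0 ^ p)
      (p * ∫ ξ in a..b, g ξ * max (y - ξ) 0 ^ (p - 1)) y := by
  have hc : ∀ q : ℝ, 0 ≤ q → ∀ z,
      ContinuousOn (fun ξ => g ξ * max (z - ξ) 0 ^ q) (uIcc a b) := by
    intro q hq z
    rw [uIcc_of_le hab]
    exact hg.mul (Continuous.continuousOn (((continuous_const.sub continuous_id).max
      continuous_const).rpow_const fun _ => Or.inr hq))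
  have hmeas : ∀ q : ℝ, 0 ≤ q → ∀ z, AEStronglyMeasurable
      (fun ξ => g ξ * max (z - ξ) 0 ^ q) (volume.restrict (uIoc a b)) := fun q hq z =>
    ((hc q hq z).mono uIoc_subset_uIcc).aestronglyMeasurable measurableSet_uIoc
  set R := |y| + 1 + |a| with hR
  have h := intervalIntegral.hasDerivAt_integral_of_dominated_loc_of_deriv_le
    (μ := volume) (a := a) (b := b) (x₀ := y) (s := Metric.ball y 1)
    (F := fun y ξ => g ξ * max (y - ξ) 0 ^ p)
    (F' := fun y ξ => g ξ * (p * max (y - ξ) 0 ^ (p - 1)))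
    (bound := fun ξ => |g ξ| * (p * R ^ (p - 1)))
    (Metric.ball_mem_nhds y one_pos) ?_ ?_ ?_ ?_ ?_ ?_
  · refine h.2.congr_deriv ?_
    rw [← intervalIntegral.integral_const_mul]
    congr 1
    ext ξ
    ring
  · exact Filter.Eventually.of_forall fun z => hmeas p (by linarith) z
  · exact (hc p (by linarith) y).intervalIntegrable
  · refine ((hmeas (p - 1) (by linarith) y).const_mul p).congr (Filter.Eventually.of_forall ?_)
    intro ξ
    simp only
    ring
  · refine Filter.Eventually.of_forall fun ξ hξ z hz => ?_
    rw [uIoc_of_le hab] at hξ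
    rw [Real.norm_eq_abs, abs_mul, abs_of_nonneg (by positivity : 0 ≤ p * max (z - ξ) 0 ^ (p - 1))]
    gcongr ?_ * (_ * ?_)
    refine Real.rpow_le_rpow (le_max_right _ _) (max_le ?_ (by positivity)) (by linarith)
    rw [Metric.mem_ball, Real.dist_eq] at hz
    have h1 := (abs_lt.1 hz).2
    have h2 := le_abs_self y
    have h3 := neg_abs_le a
    linarith [hξ.1]
  · refine ContinuousOn.intervalIntegrable ?_
    rw [uIcc_of_le hab]
    exact hg.abs.mul continuousOn_const
  · refine Filter.Eventually.of_forall fun ξ _ z _ => ?_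
    have h1 : HasDerivAt (fun z : ℝ => z - ξ) 1 z := (hasDerivAt_id z).sub_const ξ
    have := ((hasDerivAt_max_rpow hp (z - ξ)).comp z h1).const_mul (g ξ)
    simpa [Function.comp_def] using this

/-- The singular integral is not differentiated directly. Four integrations by parts raise the
exponent from 1-α to 5-α, after which two derivatives pass under an integral over the fixed interval
[a, b] and lower it to 3-α. Undoing two integrations by parts gives the formula with f 2. -/
lemma IsDerivChain.leftTempered_eq {a b α lam : ℝ} {f : ℕ → ℝ → ℝ} {v : ℝ → ℝ}
    (hf : IsDerivChain a b 4 f) (h₁ : 1 < α) (h₂ : α < 2)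
    (hv : ∀ ξ ∈ Icc a b, f 0 ξ = Real.exp (lam * ξ) * v ξ) {x : ℝ} (hx : x ∈ Ioo a b) :
    leftTempered 2 α lam a v x = Real.exp (-(lam * x)) *
      ((∫ ξ in a..x, f 2 ξ * (x - ξ) ^ (1 - α)) / Real.Gamma (2 - α)) := by
  have hab : a ≤ b := (hx.1.trans hx.2).le
  have h4 := hf.continuousOn 4 le_rfl
  set J : ℝ → ℝ → ℝ := fun p y => ∫ ξ in a..b, f 4 ξ * max (y - ξ) 0 ^ p with hJ
  have hJd : ∀ p, 1 < p → ∀ y, HasDerivAt (J p) (p * J (p - 1) y) y := fun p hp y =>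
    hasDerivAt_integral_mul_max_rpow hab h4 hp y
  have h5 : 5 - α ≠ 0 := by linarith
  have h4' : 4 - α ≠ 0 := by linarith
  have h3 : 3 - α ≠ 0 := by linarith
  have h2 : 2 - α ≠ 0 := by linarith
  have hloc : (fun y => ∫ ξ in a..y, Real.exp (lam * ξ) * v ξ / (y - ξ) ^ (α - (2 : ℕ) + 1))
      =ᶠ[nhds x] fun y => J (5 - α) y / ((2 - α) * (3 - α) * (4 - α) * (5 - α)) := by
    filter_upwards [Ioo_mem_nhds hx.1 hx.2] with y hy
    have hy' : y ∈ Icc a b := ⟨hy.1.le, hy.2.le⟩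
    have e : ∫ ξ in a..y, Real.exp (lam * ξ) * v ξ / (y - ξ) ^ (α - (2 : ℕ) + 1)
        = ∫ ξ in a..y, f 0 ξ * (y - ξ) ^ (1 - α) := by
      refine intervalIntegral.integral_congr fun ξ hξ => ?_
      rw [uIcc_of_le hy'.1] at hξ
      rw [hv ξ ⟨hξ.1, hξ.2.trans hy'.2⟩, div_eq_mul_inv, ← Real.rpow_neg (by linarith [hξ.2])]
      push_cast
      ring_nf
    simp only [hJ]
    rw [e, integral_mul_max_rpow h4 hy' (by linarith),
      hf.integral_mul_rpow (i := 0) (by norm_num) (by linarith) hy',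
      hf.integral_mul_rpow (i := 1) (by norm_num) (by linarith) hy',
      hf.integral_mul_rpow (i := 2) (by norm_num) (by linarith) hy',
      hf.integral_mul_rpow (i := 3) (by norm_num) (by linarith) hy']
    rw [show 1 - α + 1 = 2 - α by ring, show 2 - α + 1 = 3 - α by ring,
      show 3 - α + 1 = 4 - α by ring, show 4 - α + 1 = 5 - α by ring]
    simp only [div_div]
    ring_nf
  have hd1 : deriv (fun y => J (5 - α) y / ((2 - α) * (3 - α) * (4 - α) * (5 - α)))
      = fun y => J (4 - α) y / ((2 - α) * (3 - α) * (4 - α)) := by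
    funext y
    rw [((hJd (5 - α) (by linarith) y).div_const _).deriv, show 5 - α - 1 = 4 - α by ring]
    field_simp
  have hx' : x ∈ Icc a b := ⟨hx.1.le, hx.2.le⟩
  have hd2 : iteratedDeriv 2
      (fun y => ∫ ξ in a..y, Real.exp (lam * ξ) * v ξ / (y - ξ) ^ (α - (2 : ℕ) + 1)) x
      = J (3 - α) x / ((2 - α) * (3 - α)) := by
    rw [hloc.iteratedDeriv_eq 2, iteratedDeriv_succ, iteratedDeriv_one, hd1,
      ((hJd (4 - α) (by linarith) x).div_const _).deriv, show 4 - α - 1 = 3 - α by ring]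
    field_simp
  rw [leftTempered, hd2, hf.integral_mul_rpow_two h₂ hx']
  simp only [hJ]
  rw [integral_mul_max_rpow h4 hx' (by linarith), show 4 - α = 3 - α + 1 by ring,
    Real.Gamma_add_one h3, show Real.Gamma (3 - α) = Real.Gamma (2 - α + 1) by ring_nf,
    Real.Gamma_add_one h2]
  push_cast
  have := (Real.Gamma_pos_of_pos (by linarith : 0 < 2 - α)).ne'
  field_simp

/-! ### Consistency of the spatial discretization -/

lemma IsDerivChain.apply_eq_integral_max {a b : ℝ} {f : ℕ → ℝ → ℝ} (hf : IsDerivChain a b 4 f)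
    {x : ℝ} (hx : x ∈ Icc a b) :
    f 0 x = ∫ ξ in a..b, f 4 ξ * (max (x - ξ) 0 ^ 3 / 6) := by
  have h := integral_mul_max_rpow (hf.continuousOn 4 le_rfl) hx (by norm_num : (0 : ℝ) < 3)
  norm_num at h
  rw [hf.apply_eq_integral hx, ← h, ← intervalIntegral.integral_div]
  simp only [mul_div_assoc]

lemma max_mul_sub {h x y : ℝ} (hh : 0 < h) (e : x = h * y) : max x 0 = h * max y 0 := by
  rw [e, mul_max_of_nonneg _ _ hh.le, mul_zero]

lemma wsgd_sum_sub_eq_kernel {α γ₁ γ₂ γ₃ h s : ℝ} (hh : 0 < h) {j : ℕ} (hs : s ≤ j * h) :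
    1 / h ^ α * ∑ k ∈ Finset.range (j + 2),
        wsgdCoeff α γ₁ γ₂ γ₃ k * (max (s + h - k * h) 0 ^ 3 / 6)
      - max s 0 ^ (3 - α) / Real.Gamma (4 - α)
      = h ^ (3 - α) * wsgdKernel α γ₁ γ₂ γ₃ (s / h) := by
  have hs' : s / h ≤ j + 1 := by rw [div_le_iff₀ hh]; linarith
  have key := sum_wsgdCoeff_mul_cube α γ₁ γ₂ γ₃ hs'
  have e : ∀ k : ℕ, max (s + h - k * h) 0 ^ 3 / 6 = h ^ 3 * (max (s / h + 1 - k) 0 ^ 3 / 6) := by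
    intro k
    rw [max_mul_sub hh (y := s / h + 1 - k) (by field_simp)]
    ring
  have e2 : max s 0 ^ (3 - α) = h ^ (3 - α) * max (s / h) 0 ^ (3 - α) := by
    rw [← Real.mul_rpow hh.le (le_max_right _ _), ← max_mul_sub hh (x := s) (y := s / h) (by field_simp)]
  have e3 : h ^ (3 - α) = h ^ 3 / h ^ α := by
    rw [Real.rpow_sub hh]; norm_num
  simp only [e]
  rw [Finset.sum_congr rfl fun k _ => mul_left_comm _ _ _, ← Finset.mul_sum, key, e2, e3]
  ring

-- The error is the integral of f 4 against h^{3-α}K((x-ξ)/h). To the left of x the kernel is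
-- O(h²(x-ξ)^{1-α}), on the single cell to its right it is O(h^{3-α}), and beyond x + h it vanishes.
-- The constant depends on f only through the bound M, so it can be used uniformly in time.
set_option maxHeartbeats 1000000 in
lemma exists_consistency_bound {α γ₁ γ₂ γ₃ a b : ℝ} (h₁ : 1 < α) (h₂ : α < 2)
    (hγ : AdmissibleWeights α γ₁ γ₂ γ₃) (hab : a < b) :
    ∃ C, 0 ≤ C ∧ ∀ (f : ℕ → ℝ → ℝ) (M : ℝ), IsDerivChain a b 4 f →
      (∀ ξ ∈ Icc a b, |f 4 ξ| ≤ M) → ∀ (N j : ℕ) (h : ℝ), 0 < h → N * h = b - a → j < N →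
      |1 / h ^ α * ∑ k ∈ Finset.range (j + 2),
          wsgdCoeff α γ₁ γ₂ γ₃ k * f 0 (a + j * h + h - k * h)
        - (∫ ξ in a..(a + j * h), f 2 ξ * (a + j * h - ξ) ^ (1 - α)) / Real.Gamma (2 - α)|
        ≤ C * M * h ^ 2 := by
  obtain ⟨C, hC, hK₀, hK⟩ := exists_wsgdKernel_bound h₁ h₂ hγ
  refine ⟨C * ((b - a) ^ (2 - α) / (2 - α) + (b - a) ^ (2 - α)), ?_, ?_⟩
  · have : 0 < 2 - α := by linarith
    have : 0 < b - a := by linarith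
    positivity
  intro f M hf hM N j h hh hN hj
  have hjN : ((j : ℝ) + 1) * h ≤ b - a := by
    rw [← hN]
    have : ((j : ℝ) + 1) ≤ N := by exact_mod_cast hj
    gcongr
  have hj0 : 0 ≤ (j : ℝ) * h := by positivity
  set x := a + j * h with hx
  have hax : a ≤ x := by linarith
  have hxb : x + h ≤ b := by linarith
  have hxm : x ∈ Icc a b := ⟨hax, by linarith⟩
  have hM0 : 0 ≤ M := (abs_nonneg _).trans (hM a ⟨le_rfl, hab.le⟩)
  have h4 := hf.continuousOn 4 le_rfl
  set E : ℝ → ℝ := fun ξ => 1 / h ^ α * ∑ k ∈ Finset.range (j + 2),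
        wsgdCoeff α γ₁ γ₂ γ₃ k * (max (x - ξ + h - k * h) 0 ^ 3 / 6)
      - max (x - ξ) 0 ^ (3 - α) / Real.Gamma (4 - α) with hE
  have hEK : ∀ ξ ∈ Icc a b, E ξ = h ^ (3 - α) * wsgdKernel α γ₁ γ₂ γ₃ ((x - ξ) / h) :=
    fun ξ hξ => wsgd_sum_sub_eq_kernel hh (by linarith [hξ.1])
  have hcube : ∀ z : ℝ, Continuous fun ξ : ℝ => max (z - ξ) 0 ^ 3 / 6 := fun z => by fun_prop
  have hcube' : ∀ k : ℕ, ContinuousOn (fun ξ => 1 / h ^ α * (wsgdCoeff α γ₁ γ₂ γ₃ k *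
      (f 4 ξ * (max (x + h - k * h - ξ) 0 ^ 3 / 6)))) (Icc a b) := fun k =>
    continuousOn_const.mul (continuousOn_const.mul (h4.mul (hcube _).continuousOn))
  have hpow : ContinuousOn (fun ξ => f 4 ξ * max (x - ξ) 0 ^ (3 - α)) (Icc a b) :=
    h4.mul (Continuous.continuousOn (((continuous_const.sub continuous_id).max
      continuous_const).rpow_const fun _ => Or.inr (by linarith)))
  have hint : ∀ {g : ℝ → ℝ}, ContinuousOn g (Icc a b) → IntervalIntegrable g volume a b :=
    fun hg => (hg.mono (uIcc_of_le hab.le).le).intervalIntegrable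
  have hrepr : 1 / h ^ α * ∑ k ∈ Finset.range (j + 2),
          wsgdCoeff α γ₁ γ₂ γ₃ k * f 0 (x + h - k * h)
        - (∫ ξ in a..x, f 2 ξ * (x - ξ) ^ (1 - α)) / Real.Gamma (2 - α)
      = ∫ ξ in a..b, f 4 ξ * E ξ := by
    have hs : 1 / h ^ α * ∑ k ∈ Finset.range (j + 2),
          wsgdCoeff α γ₁ γ₂ γ₃ k * f 0 (x + h - k * h)
        = ∫ ξ in a..b, ∑ k ∈ Finset.range (j + 2), 1 / h ^ α * (wsgdCoeff α γ₁ γ₂ γ₃ k *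
            (f 4 ξ * (max (x + h - k * h - ξ) 0 ^ 3 / 6))) := by
      rw [intervalIntegral.integral_finsetSum fun k _ => hint (hcube' k), Finset.mul_sum]
      refine Finset.sum_congr rfl fun k hk => ?_
      rw [intervalIntegral.integral_const_mul, intervalIntegral.integral_const_mul,
        ← hf.apply_eq_integral_max]
      have hk' : (k : ℝ) ≤ j + 1 := by
        have : k ≤ j + 1 := by rw [Finset.mem_range] at hk; omega
        exact_mod_cast this
      have h1 : (k : ℝ) * h ≤ (j + 1) * h := by gcongr
      have h2 : 0 ≤ (k : ℝ) * h := by positivity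
      constructor <;> linarith
    rw [hf.integral_mul_rpow_two h₂ hxm, hs, ← integral_mul_max_rpow h4 hxm (by linarith),
      ← intervalIntegral.integral_div, ← intervalIntegral.integral_sub
        (hint (continuousOn_finsetSum _ fun k _ => hcube' k)) ((hint hpow).div_const _)]
    refine intervalIntegral.integral_congr fun ξ _ => ?_
    simp only [hE]
    rw [mul_sub, Finset.mul_sum, Finset.mul_sum]
    congr 1
    · refine Finset.sum_congr rfl fun k _ => ?_
      rw [show x - ξ + h - k * h = x + h - k * h - ξ by ring]
      ring
    · ring
  have hfE : ContinuousOn (fun ξ => f 4 ξ * E ξ) (Icc a b) := by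
    refine h4.mul (ContinuousOn.sub (continuousOn_const.mul (continuousOn_finsetSum _ fun k _ =>
      continuousOn_const.mul ?_)) (ContinuousOn.div_const ?_ _))
    · fun_prop
    · exact Continuous.continuousOn (((continuous_const.sub continuous_id).max
        continuous_const).rpow_const fun _ => Or.inr (by linarith))
  have hsubint : ∀ {c d : ℝ}, a ≤ c → c ≤ d → d ≤ b →
      IntervalIntegrable (fun ξ => f 4 ξ * E ξ) volume c d := fun hc hcd hd =>
    (hfE.mono (by rw [uIcc_of_le hcd]; exact Icc_subset_Icc hc hd)).intervalIntegrable
  rw [hrepr, ← intervalIntegral.integral_add_adjacent_intervals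
    (hsubint le_rfl hax hxm.2) (hsubint hax hxm.2 le_rfl),
    ← intervalIntegral.integral_add_adjacent_intervals
    (hsubint hax (by linarith) hxb) (hsubint (by linarith) hxb le_rfl)]
  have hz : ∫ ξ in (x + h)..b, f 4 ξ * E ξ = 0 := by
    rw [intervalIntegral.integral_congr (g := fun _ => 0), intervalIntegral.integral_zero]
    intro ξ hξ
    rw [uIcc_of_le hxb] at hξ
    beta_reduce
    rw [hEK ξ ⟨by linarith [hξ.1], hξ.2⟩, wsgdKernel_of_le_neg_one h₂, mul_zero, mul_zero]
    rw [div_le_iff₀ hh]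
    linarith [hξ.1]
  have hmid : |∫ ξ in x..(x + h), f 4 ξ * E ξ| ≤ M * (h ^ (3 - α) * C) * h := by
    have := intervalIntegral.norm_integral_le_of_norm_le_const (a := x) (b := x + h)
      (C := M * (h ^ (3 - α) * C)) (f := fun ξ => f 4 ξ * E ξ) ?_
    · rwa [add_sub_cancel_left, abs_of_pos hh] at this
    · intro ξ hξ
      rw [uIoc_of_le (by linarith)] at hξ
      have hξm : ξ ∈ Icc a b := ⟨by linarith [hξ.1], by linarith [hξ.2]⟩
      rw [Real.norm_eq_abs, abs_mul, hEK ξ hξm, abs_mul,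
        abs_of_pos (by positivity : 0 < h ^ (3 - α))]
      gcongr
      · exact hM ξ hξm
      · exact hK₀ _ (div_nonpos_of_nonpos_of_nonneg (by linarith [hξ.1]) hh.le)
  have h3 : h ^ (3 - α) = h ^ 2 * h ^ (1 - α) := by
    rw [← Real.rpow_natCast, ← Real.rpow_add hh]; norm_num; ring_nf
  have hleft : |∫ ξ in a..x, f 4 ξ * E ξ| ≤ M * (C * h ^ 2) * ((b - a) ^ (2 - α) / (2 - α)) := by
    have hb : ∫ ξ in a..x, M * (C * h ^ 2) * (x - ξ) ^ (1 - α)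
        = M * (C * h ^ 2) * ((x - a) ^ (2 - α) / (2 - α)) := by
      rw [intervalIntegral.integral_const_mul,
        intervalIntegral.integral_comp_sub_left (fun s : ℝ => s ^ (1 - α)), sub_self,
        integral_rpow (Or.inl (by linarith)), show 1 - α + 1 = 2 - α by ring,
        Real.zero_rpow (by linarith), sub_zero]
    have := intervalIntegral.norm_integral_le_of_norm_le (a := a) (b := x) (μ := volume)
      (f := fun ξ => f 4 ξ * E ξ) (g := fun ξ => M * (C * h ^ 2) * (x - ξ) ^ (1 - α)) hax ?_
      ((intervalIntegrable_sub_rpow (by linarith) x a x).const_mul _)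
    · rw [hb] at this
      refine this.trans ?_
      have h2α : 0 < 2 - α := by linarith
      have hxa : 0 ≤ x - a := by linarith
      gcongr
      exact hxm.2
    -- The point ξ = x is discarded, because the power bound on the kernel is available only for
    -- positive arguments.
    · have hne : ∀ᵐ ξ ∂(volume : Measure ℝ), ξ ≠ x :=
        compl_mem_ae_iff.2 (measure_singleton x)
      filter_upwards [hne] with ξ hξx hξ
      have hlt : ξ < x := lt_of_le_of_ne hξ.2 hξx
      have hξm : ξ ∈ Icc a b := ⟨hξ.1.le, hξ.2.trans hxm.2⟩
      rw [Real.norm_eq_abs, abs_mul, hEK ξ hξm, abs_mul,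
        abs_of_pos (by positivity : 0 < h ^ (3 - α))]
      have hk := hK ((x - ξ) / h) (div_pos (by linarith) hh)
      rw [Real.div_rpow (by linarith) hh.le] at hk
      calc _ ≤ M * (h ^ (3 - α) * (C * ((x - ξ) ^ (1 - α) / h ^ (1 - α)))) := by
            gcongr
            exact hM ξ hξm
        _ = _ := by
            rw [h3]
            have : h ^ (1 - α) ≠ 0 := by positivity
            field_simp
  have hhα : h ^ (3 - α) * h ≤ h ^ 2 * (b - a) ^ (2 - α) := by
    have e : h ^ (3 - α) * h = h ^ 2 * h ^ (2 - α) := by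
      rw [h3, mul_assoc, ← Real.rpow_add_one hh.ne']; ring_nf
    rw [e]
    gcongr
    linarith
  rw [hz, add_zero]
  refine (abs_add_le _ _).trans ?_
  have := mul_le_mul_of_nonneg_left hhα (mul_nonneg hM0 hC)
  linarith

-- With y = hλ the quantity is λ^α Φ(y), where Φ(y) is the product of γ₁e^y + γ₂ + γ₃e^{-y} = 1 +
-- αy/2 + O(y²) and ((1 - e^{-y})/y)^α = 1 - αy/2 + O(y²). The linear terms cancel, by the same
-- condition γ₁ - γ₃ = α/2 that makes the operator second order.
set_option maxHeartbeats 1000000 in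
lemma exists_wsgdShift_bound {α γ₁ γ₂ γ₃ lam : ℝ} (h₁ : 1 < α) (h₂ : α < 2)
    (hγ : AdmissibleWeights α γ₁ γ₂ γ₃) (hlam : 0 ≤ lam) (H : ℝ) :
    ∃ C, 0 ≤ C ∧ ∀ h : ℝ, 0 < h → h ≤ H →
      |1 / h ^ α * wsgdShift α lam γ₁ γ₂ γ₃ h - lam ^ α| ≤ C * h ^ 2 := by
  set S := |γ₁| + |γ₂| + |γ₃| with hS
  set W := α + α * (α - 1) * (1 / 4) ^ (α - 2) with hW
  have hW0 : 0 ≤ W := by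
    have : 0 ≤ α - 1 := by linarith
    positivity
  set K := 1 + 2 * S + W * (2 + S) with hK
  have hS0 : 0 ≤ S := by positivity
  have hK0 : 0 ≤ K := by positivity
  set D := S * Real.exp (H * lam) + 1 with hD
  have hD0 : 0 ≤ D := by positivity
  set ψ : ℝ → ℝ := fun y => (1 - Real.exp (-y)) / y with hψ
  set Φ : ℝ → ℝ := fun y => (γ₁ * Real.exp y + γ₂ + γ₃ * Real.exp (-y)) * ψ y ^ α with hΦ
  have hψ0 : ∀ y, 0 < y → 0 ≤ ψ y := fun y hy =>
    div_nonneg (by linarith [Real.exp_le_one_iff.2 (by linarith : -y ≤ 0)]) hy.le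
  have hψ1 : ∀ y, 0 < y → ψ y ≤ 1 := fun y hy => by
    rw [div_le_one hy]; linarith [Real.add_one_le_exp (-y)]
  have small : ∀ y, 0 < y → y ≤ 1 → |Φ y - 1| ≤ K * y ^ 2 := by
    intro y hy hy1
    have b1 := Real.exp_bound (x := y) (n := 2) (by rwa [abs_of_pos hy]) (by norm_num)
    have b2 := Real.exp_bound (x := -y) (n := 2) (by rwa [abs_neg, abs_of_pos hy]) (by norm_num)
    have b3 := Real.exp_bound (x := -y) (n := 3) (by rwa [abs_neg, abs_of_pos hy]) (by norm_num)
    rw [abs_neg, abs_of_pos hy] at b2 b3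
    rw [abs_of_pos hy] at b1
    norm_num [Finset.sum_range_succ, Nat.factorial] at b1 b2 b3
    have hy2 : 0 ≤ y ^ 2 := sq_nonneg y
    have hy3 : y ^ 3 ≤ y ^ 2 := pow_le_pow_of_le_one hy.le hy1 (by norm_num)
    set s := (γ₁ * Real.exp y + γ₂ + γ₃ * Real.exp (-y)) - (1 + α / 2 * y) with hs
    have hsb : |s| ≤ S * y ^ 2 := by
      have e : s = γ₁ * (Real.exp y - (1 + y)) + γ₃ * (Real.exp (-y) - (1 + -y)) := by
        rw [hs, hγ.eq₂, hγ.eq₃]; ring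
      rw [e]
      refine (abs_add_le _ _).trans ?_
      rw [abs_mul, abs_mul]
      have t1 : |γ₁| * |Real.exp y - (1 + y)| ≤ |γ₁| * y ^ 2 := by
        gcongr; exact b1.trans (by linarith)
      have t2 : |γ₃| * |Real.exp (-y) - (1 + -y)| ≤ |γ₃| * y ^ 2 := by
        gcongr; exact b2.trans (by linarith)
      have t3 : 0 ≤ |γ₂| * y ^ 2 := by positivity
      rw [hS]; linarith
    have hψy : |ψ y - 1 + y / 2| ≤ y ^ 2 := by
      have e : ψ y - 1 + y / 2 = -(Real.exp (-y) - (1 + -y + y ^ 2 / 2)) / y := by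
        simp only [hψ]; field_simp; ring
      rw [e, abs_div, abs_neg, abs_of_pos hy, div_le_iff₀ hy]
      refine b3.trans ?_
      nlinarith [pow_pos hy 3]
    have hψm : (1 : ℝ) / 4 ≤ ψ y := by
      simp only [hψ]
      rw [le_div_iff₀ hy]
      have := (abs_le.1 b3).2
      have hyy : y ^ 2 ≤ y := by simpa using pow_le_pow_of_le_one hy.le hy1 (by norm_num : 1 ≤ 2)
      linarith
    have hψ1y : (ψ y - 1) ^ 2 ≤ y ^ 2 := by
      have l1 := hψ1 y hy
      have l2 : 1 - ψ y ≤ y := by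
        simp only [hψ]
        rw [sub_le_iff_le_add, ← sub_le_iff_le_add', le_div_iff₀ hy]
        have := (abs_le.1 b2).2
        nlinarith [mul_pos hy hy]
      exact sq_le_sq' (by linarith) (by linarith)
    set w := ψ y ^ α - (1 - α / 2 * y) with hw
    have hwb : |w| ≤ W * y ^ 2 := by
      have tay := abs_rpow_taylor_le (p := α) (m := 1 / 4) (x := 1) (y := ψ y) h₁.le h₂.le
        (by norm_num) (by norm_num) hψm
      rw [Real.one_rpow, Real.one_rpow, mul_one] at tay
      have e : w = (ψ y ^ α - 1 - α * (ψ y - 1)) + α * (ψ y - 1 + y / 2) := by rw [hw]; ring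
      rw [e]
      refine (abs_add_le _ _).trans ?_
      rw [abs_mul α, abs_of_pos (by linarith : 0 < α)]
      have t1 : α * |ψ y - 1 + y / 2| ≤ α * y ^ 2 := by gcongr
      have h0 : 0 ≤ α * (α - 1) * (1 / 4 : ℝ) ^ (α - 2) := by
        have : 0 ≤ α - 1 := by linarith
        positivity
      have t2 := mul_le_mul_of_nonneg_left hψ1y h0
      rw [hW]; linarith
    have e : Φ y - 1 = -(α ^ 2 / 4) * y ^ 2 + s * (1 - α / 2 * y) + w * (1 + α / 2 * y + s) := by
      simp only [hΦ]
      rw [show γ₁ * Real.exp y + γ₂ + γ₃ * Real.exp (-y) = 1 + α / 2 * y + s by rw [hs]; ring,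
        show ψ y ^ α = 1 - α / 2 * y + w by rw [hw]; ring]
      ring
    have hay : α / 2 * y ≤ 1 := by nlinarith
    have hay0 : 0 ≤ α / 2 * y := by positivity
    have t1 : |-(α ^ 2 / 4) * y ^ 2| ≤ 1 * y ^ 2 := by
      rw [abs_mul, abs_neg, abs_of_nonneg (by positivity), abs_of_nonneg hy2]
      gcongr
      nlinarith
    have t2 : |s * (1 - α / 2 * y)| ≤ S * y ^ 2 * 2 := by
      rw [abs_mul]
      gcongr
      rw [abs_le]; constructor <;> linarith
    have t3 : |w * (1 + α / 2 * y + s)| ≤ W * y ^ 2 * (2 + S) := by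
      rw [abs_mul]
      gcongr
      refine (abs_add_le _ _).trans (add_le_add ?_ (hsb.trans ?_))
      · rw [abs_of_nonneg (by linarith)]; linarith
      · exact mul_le_of_le_one_right hS0 (pow_le_one₀ hy.le hy1)
    rw [e]
    refine (abs_add_three _ _ _).trans ?_
    rw [hK]
    linarith
  refine ⟨(K + D) * lam ^ α * lam ^ 2, by positivity, fun h hh hhH => ?_⟩
  rcases hlam.eq_or_lt with rfl | hl
  · simp [wsgdShift, Real.zero_rpow (by linarith : α ≠ 0)]
  set y := h * lam with hy
  have hy0 : 0 < y := by positivity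
  have hyH : y ≤ H * lam := by rw [hy]; gcongr
  have e : 1 / h ^ α * wsgdShift α lam γ₁ γ₂ γ₃ h = lam ^ α * Φ y := by
    have e1 : 1 - Real.exp (-y) = h * lam * ψ y := by simp only [hψ, ← hy]; field_simp
    have e2 : (1 - Real.exp (-y)) ^ α = h ^ α * lam ^ α * ψ y ^ α := by
      rw [e1, Real.mul_rpow hy0.le (hψ0 y hy0), Real.mul_rpow hh.le hlam]
    have : h ^ α ≠ 0 := by positivity
    simp only [wsgdShift, ← hy, e2, hΦ]
    field_simp
  have hb : |Φ y - 1| ≤ (K + D) * y ^ 2 := by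
    rcases le_total y 1 with h1 | h1
    · refine (small y hy0 h1).trans ?_
      gcongr
      linarith
    -- For y ≥ 1 no expansion is needed: Φ is bounded since y ≤ Hλ, and y² ≥ 1 absorbs the constant.
    · have hE : 1 ≤ Real.exp (H * lam) := Real.one_le_exp (hy0.le.trans hyH)
      have hΦb : |Φ y| ≤ S * Real.exp (H * lam) := by
        simp only [hΦ]
        rw [abs_mul, abs_of_nonneg (Real.rpow_nonneg (hψ0 y hy0) α)]
        refine (mul_le_of_le_one_right (abs_nonneg _)
          (Real.rpow_le_one (hψ0 y hy0) (hψ1 y hy0) (by linarith))).trans ?_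
        refine (abs_add_three _ _ _).trans ?_
        rw [abs_mul, abs_mul, Real.abs_exp, Real.abs_exp, hS]
        have a1 : |γ₁| * Real.exp y ≤ |γ₁| * Real.exp (H * lam) := by gcongr
        have a2 : |γ₂| * 1 ≤ |γ₂| * Real.exp (H * lam) := by gcongr
        have a3 : |γ₃| * Real.exp (-y) ≤ |γ₃| * Real.exp (H * lam) := by gcongr; linarith
        linarith
      have : |Φ y - 1| ≤ D := by
        rw [hD]
        refine (abs_sub _ _).trans ?_
        rw [abs_one]; linarith
      have hy2 : 1 ≤ y ^ 2 := one_le_pow₀ h1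
      nlinarith [mul_nonneg hK0 (sq_nonneg y), mul_le_mul_of_nonneg_left hy2 hD0]
  rw [e, show lam ^ α * Φ y - lam ^ α = lam ^ α * (Φ y - 1) by ring, abs_mul,
    abs_of_pos (by positivity : 0 < lam ^ α)]
  calc _ ≤ lam ^ α * ((K + D) * y ^ 2) := by gcongr
    _ = _ := by rw [hy]; ring

/-! ### Taylor estimates -/

lemma abs_taylor_one_le {s : Set ℝ} (hs : s.OrdConnected) {f f₁ f₂ : ℝ → ℝ} {M : ℝ}
    (h : ∀ z ∈ s, HasDerivWithinAt f (f₁ z) s z) (h₁ : ∀ z ∈ s, HasDerivWithinAt f₁ (f₂ z) s z)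
    (hM : ∀ z ∈ s, |f₂ z| ≤ M) {x y : ℝ} (hx : x ∈ s) (hy : y ∈ s) :
    |f y - f x - f₁ x * (y - x)| ≤ M * (y - x) ^ 2 := by
  have hsub : uIcc x y ⊆ s := hs.uIcc_subset hx hy
  have hM0 : 0 ≤ M := (abs_nonneg _).trans (hM x hx)
  have key := Convex.norm_image_sub_le_of_norm_hasDerivWithin_le
    (f := fun z => f z - f₁ x * z) (f' := fun z => f₁ z - f₁ x * 1) (C := M * |y - x|)
    (s := uIcc x y) (fun z hz => ((h z (hsub hz)).mono hsub).sub
      (((hasDerivAt_id z).const_mul _).hasDerivWithinAt)) ?_ (convex_uIcc x y)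
      left_mem_uIcc right_mem_uIcc
  · simp only [Real.norm_eq_abs] at key
    rw [mul_assoc, ← sq, sq_abs] at key
    convert key using 2
    ring
  · intro z hz
    have h2 := Convex.norm_image_sub_le_of_norm_hasDerivWithin_le
      (fun z hz => (h₁ z (hsub hz)).mono hsub) (fun z hz => hM z (hsub hz)) (convex_uIcc x y)
      left_mem_uIcc hz
    rw [mul_one]
    refine h2.trans ?_
    rw [Real.norm_eq_abs]
    exact mul_le_mul_of_nonneg_left (abs_sub_left_of_mem_uIcc hz) hM0

lemma abs_taylor_two_le {s : Set ℝ} (hs : s.OrdConnected) {f f₁ f₂ f₃ : ℝ → ℝ} {M : ℝ}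
    (h : ∀ z ∈ s, HasDerivWithinAt f (f₁ z) s z) (h₁ : ∀ z ∈ s, HasDerivWithinAt f₁ (f₂ z) s z)
    (h₂ : ∀ z ∈ s, HasDerivWithinAt f₂ (f₃ z) s z) (hM : ∀ z ∈ s, |f₃ z| ≤ M) {x y : ℝ}
    (hx : x ∈ s) (hy : y ∈ s) :
    |f y - f x - f₁ x * (y - x) - f₂ x / 2 * (y - x) ^ 2| ≤ M * |y - x| ^ 3 := by
  have hsub : uIcc x y ⊆ s := hs.uIcc_subset hx hy
  have hM0 : 0 ≤ M := (abs_nonneg _).trans (hM x hx)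
  have key := Convex.norm_image_sub_le_of_norm_hasDerivWithin_le
    (f := fun z => f z - (f₁ x * (z - x) + f₂ x / 2 * (z - x) ^ 2))
    (f' := fun z => f₁ z - (f₁ x + f₂ x * (z - x))) (C := M * |y - x| ^ 2)
    (s := uIcc x y) (fun z hz => ((h z (hsub hz)).mono hsub).sub ?_) ?_ (convex_uIcc x y)
      left_mem_uIcc right_mem_uIcc
  · simp only [Real.norm_eq_abs] at key
    convert key using 1
    · congr 1; ring
    · ring
  · have h1 : HasDerivAt (fun z : ℝ => z - x) 1 z := (hasDerivAt_id z).sub_const x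
    refine HasDerivAt.hasDerivWithinAt (((h1.const_mul (f₁ x)).add
      ((h1.pow 2).const_mul (f₂ x / 2))).congr_deriv ?_)
    norm_num
    ring
  · intro z hz
    have h2 := abs_taylor_one_le hs h₁ h₂ hM hx (hsub hz)
    rw [Real.norm_eq_abs, ← sub_sub]
    refine h2.trans ?_
    rw [← sq_abs (z - x)]
    exact mul_le_mul_of_nonneg_left
      (pow_le_pow_left₀ (abs_nonneg _) (abs_sub_left_of_mem_uIcc hz) 2) hM0

lemma abs_average_sub_le {s : Set ℝ} (hs : s.OrdConnected) {f f₁ f₂ : ℝ → ℝ} {M : ℝ}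
    (h : ∀ z ∈ s, HasDerivWithinAt f (f₁ z) s z) (h₁ : ∀ z ∈ s, HasDerivWithinAt f₁ (f₂ z) s z)
    (hM : ∀ z ∈ s, |f₂ z| ≤ M) {x y : ℝ} (hx : x ∈ s) (hy : y ∈ s) :
    |(f x + f y) / 2 - f ((x + y) / 2)| ≤ M * (y - x) ^ 2 := by
  have hm : (x + y) / 2 ∈ s := by
    refine hs.uIcc_subset hx hy ?_
    rw [mem_uIcc]
    rcases le_total x y with h | h
    · left; constructor <;> linarith
    · right; constructor <;> linarith
  have hM0 : 0 ≤ M := (abs_nonneg _).trans (hM x hx)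
  have k1 := abs_le.1 (abs_taylor_one_le hs h h₁ hM hm hx)
  have k2 := abs_le.1 (abs_taylor_one_le hs h h₁ hM hm hy)
  have e1 : (x - (x + y) / 2) ^ 2 = (y - x) ^ 2 / 4 := by ring
  have e2 : (y - (x + y) / 2) ^ 2 = (y - x) ^ 2 / 4 := by ring
  rw [e1] at k1
  rw [e2] at k2
  have := mul_nonneg hM0 (sq_nonneg (y - x))
  rw [abs_le]
  constructor <;> linarith [k1.1, k1.2, k2.1, k2.2]

/-- The quadratic Taylor terms at x + d and x - d are equal and cancel, leaving two cubic
remainders. -/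
lemma abs_central_difference_le {s : Set ℝ} (hs : s.OrdConnected) {f f₁ f₂ f₃ : ℝ → ℝ} {M : ℝ}
    (h : ∀ z ∈ s, HasDerivWithinAt f (f₁ z) s z) (h₁ : ∀ z ∈ s, HasDerivWithinAt f₁ (f₂ z) s z)
    (h₂ : ∀ z ∈ s, HasDerivWithinAt f₂ (f₃ z) s z) (hM : ∀ z ∈ s, |f₃ z| ≤ M) {x d : ℝ}
    (hd : 0 ≤ d) (hx₁ : x - d ∈ s) (hx₂ : x + d ∈ s) :
    |f (x + d) - f (x - d) - 2 * d * f₁ x| ≤ 2 * M * d ^ 3 := by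
  have hm : x ∈ s := hs.out hx₁ hx₂ ⟨by linarith, by linarith⟩
  have k1 := abs_taylor_two_le hs h h₁ h₂ hM hm hx₁
  have k2 := abs_taylor_two_le hs h h₁ h₂ hM hm hx₂
  rw [show x - d - x = -d by ring, abs_neg, abs_of_nonneg hd] at k1
  rw [show x + d - x = d by ring, abs_of_nonneg hd] at k2
  rw [abs_le] at k1 k2 ⊢
  constructor <;> linarith [k1.1, k1.2, k2.1, k2.2]

/-! ### Partial derivatives on a product of sets -/

/-- The partial derivative in the direction `w`, within the set `S`. -/
def partialWithin (S : Set (ℝ × ℝ)) (w : ℝ × ℝ) (G : ℝ × ℝ → ℝ) (p : ℝ × ℝ) : ℝ :=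
  fderivWithin ℝ G S p w

section Partial

variable {X Y : Set ℝ} {G : ℝ × ℝ → ℝ} {n : ℕ}

lemma contDiffOn_partialWithin (hX : UniqueDiffOn ℝ X) (hY : UniqueDiffOn ℝ Y)
    (hG : ContDiffOn ℝ (n + 1 : ℕ) G (X ×ˢ Y)) (w : ℝ × ℝ) :
    ContDiffOn ℝ n (partialWithin (X ×ˢ Y) w G) (X ×ˢ Y) :=
  (hG.fderivWithin (hX.prod hY) (by norm_cast)).clm_apply contDiffOn_const

lemma hasFDerivWithinAt_of_contDiffOn {S : Set (ℝ × ℝ)}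
    (hG : ContDiffOn ℝ (n + 1 : ℕ) G S) {p : ℝ × ℝ} (hp : p ∈ S) :
    HasFDerivWithinAt G (fderivWithin ℝ G S p) S p :=
  ((hG.differentiableOn (by norm_cast)) p hp).hasFDerivWithinAt

lemma hasDerivWithinAt_fst (hG : ContDiffOn ℝ (n + 1 : ℕ) G (X ×ˢ Y)) {x t : ℝ} (hx : x ∈ X)
    (ht : t ∈ Y) :
    HasDerivWithinAt (fun x => G (x, t)) (partialWithin (X ×ˢ Y) (1, 0) G (x, t)) X x := by
  have h := hasFDerivWithinAt_of_contDiffOn hG (p := (x, t)) ⟨hx, ht⟩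
  have h2 : HasDerivWithinAt (fun x : ℝ => (x, t)) ((1 : ℝ), (0 : ℝ)) X x :=
    (hasDerivWithinAt_id x X).prodMk (hasDerivWithinAt_const x X t)
  exact h.comp_hasDerivWithinAt x h2 fun y hy => mk_mem_prod hy ht

lemma hasDerivWithinAt_snd (hG : ContDiffOn ℝ (n + 1 : ℕ) G (X ×ˢ Y)) {x t : ℝ} (hx : x ∈ X)
    (ht : t ∈ Y) :
    HasDerivWithinAt (fun t => G (x, t)) (partialWithin (X ×ˢ Y) (0, 1) G (x, t)) Y t := by
  have h := hasFDerivWithinAt_of_contDiffOn hG (p := (x, t)) ⟨hx, ht⟩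
  have h2 : HasDerivWithinAt (fun t : ℝ => (x, t)) ((0 : ℝ), (1 : ℝ)) Y t :=
    (hasDerivWithinAt_const t Y x).prodMk (hasDerivWithinAt_id t Y)
  exact h.comp_hasDerivWithinAt t h2 fun y hy => mk_mem_prod hx hy

lemma contDiffOn_iterate_partialWithin (hX : UniqueDiffOn ℝ X) (hY : UniqueDiffOn ℝ Y)
    (w : ℝ × ℝ) (i : ℕ) (hG : ContDiffOn ℝ (n + i : ℕ) G (X ×ˢ Y)) :
    ContDiffOn ℝ n ((partialWithin (X ×ˢ Y) w)^[i] G) (X ×ˢ Y) := by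
  induction i generalizing n with
  | zero => simpa using hG
  | succ i ih =>
    rw [Function.iterate_succ_apply']
    exact contDiffOn_partialWithin hX hY (ih (by convert hG using 2; ring)) w

lemma exists_abs_le_of_continuousOn {S K : Set (ℝ × ℝ)} (hK : IsCompact K) (hKS : K ⊆ S)
    (hG : ContinuousOn G S) : ∃ M, 0 ≤ M ∧ ∀ p ∈ K, |G p| ≤ M := by
  obtain ⟨M, hM⟩ := hK.exists_bound_of_continuousOn (hG.mono hKS)
  exact ⟨max M 0, le_max_right _ _, fun p hp => (hM p hp).trans (le_max_left _ _)⟩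

variable {a b T : ℝ}

lemma exists_average_bound (hX : UniqueDiffOn ℝ X) (hsub : Icc a b ⊆ X) (hT : 0 < T)
    (hG : ContDiffOn ℝ (2 : ℕ) G (X ×ˢ Icc 0 T)) :
    ∃ M, 0 ≤ M ∧ ∀ x ∈ Icc a b, ∀ t₁ ∈ Icc 0 T, ∀ t₂ ∈ Icc 0 T,
      |(G (x, t₁) + G (x, t₂)) / 2 - G (x, (t₁ + t₂) / 2)| ≤ M * (t₂ - t₁) ^ 2 := by
  have hY : UniqueDiffOn ℝ (Icc 0 T) := uniqueDiffOn_Icc hT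
  have h1 := contDiffOn_partialWithin (n := 1) hX hY hG (0, 1)
  have h2 := contDiffOn_partialWithin (n := 0) hX hY h1 (0, 1)
  obtain ⟨M, hM0, hM⟩ := exists_abs_le_of_continuousOn
    ((isCompact_Icc (a := a) (b := b)).prod (isCompact_Icc (a := (0 : ℝ)) (b := T)))
    (prod_mono hsub le_rfl) h2.continuousOn
  exact ⟨M, hM0, fun x hx t₁ h₁ t₂ h₂ => abs_average_sub_le (s := Icc 0 T) ordConnected_Icc
    (fun z hz => hasDerivWithinAt_snd (n := 1) hG (hsub hx) hz)
    (fun z hz => hasDerivWithinAt_snd (n := 0) h1 (hsub hx) hz) (fun z hz => hM _ ⟨hx, hz⟩) h₁ h₂⟩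

lemma exists_time_difference_bound (hX : UniqueDiffOn ℝ X) (hsub : Icc a b ⊆ X) (hT : 0 < T)
    (hG : ContDiffOn ℝ (3 : ℕ) G (X ×ˢ Icc 0 T)) :
    ∃ M, 0 ≤ M ∧ ∀ x ∈ Icc a b, ∀ t₁ ∈ Icc 0 T, ∀ t₂ ∈ Icc 0 T, t₁ ≤ t₂ →
      |G (x, t₂) - G (x, t₁) - (t₂ - t₁) * partialWithin (X ×ˢ Icc 0 T) (0, 1) G
        (x, (t₁ + t₂) / 2)| ≤ M * (t₂ - t₁) ^ 3 := by
  have hY : UniqueDiffOn ℝ (Icc 0 T) := uniqueDiffOn_Icc hT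
  have h1 := contDiffOn_partialWithin (n := 2) hX hY hG (0, 1)
  have h2 := contDiffOn_partialWithin (n := 1) hX hY h1 (0, 1)
  have h3 := contDiffOn_partialWithin (n := 0) hX hY h2 (0, 1)
  obtain ⟨M, hM0, hM⟩ := exists_abs_le_of_continuousOn
    ((isCompact_Icc (a := a) (b := b)).prod (isCompact_Icc (a := (0 : ℝ)) (b := T)))
    (prod_mono hsub le_rfl) h3.continuousOn
  refine ⟨M, hM0, fun x hx t₁ ht₁ t₂ ht₂ hle => ?_⟩
  have key := abs_central_difference_le (s := Icc 0 T) ordConnected_Icc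
    (fun z hz => hasDerivWithinAt_snd (n := 2) hG (hsub hx) hz)
    (fun z hz => hasDerivWithinAt_snd (n := 1) h1 (hsub hx) hz)
    (fun z hz => hasDerivWithinAt_snd (n := 0) h2 (hsub hx) hz) (fun z hz => hM _ ⟨hx, hz⟩)
    (x := (t₁ + t₂) / 2) (d := (t₂ - t₁) / 2) (by linarith)
    (by rw [show (t₁ + t₂) / 2 - (t₂ - t₁) / 2 = t₁ by ring]; exact ht₁)
    (by rw [show (t₁ + t₂) / 2 + (t₂ - t₁) / 2 = t₂ by ring]; exact ht₂)
  rw [show (t₁ + t₂) / 2 - (t₂ - t₁) / 2 = t₁ by ring,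
    show (t₁ + t₂) / 2 + (t₂ - t₁) / 2 = t₂ by ring,
    show 2 * ((t₂ - t₁) / 2) = t₂ - t₁ by ring] at key
  refine key.trans ?_
  have : 0 ≤ M * (t₂ - t₁) ^ 3 := mul_nonneg hM0 (pow_nonneg (by linarith) 3)
  linarith

lemma exists_space_difference_bound (hab : a < b) (hT : 0 < T)
    (hG : ContDiffOn ℝ (3 : ℕ) G (Icc a b ×ˢ Icc 0 T)) :
    ∃ M, 0 ≤ M ∧ ∀ t ∈ Icc 0 T, ∀ x d, 0 ≤ d → x - d ∈ Icc a b → x + d ∈ Icc a b →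
      |G (x + d, t) - G (x - d, t) - 2 * d * partialWithin (Icc a b ×ˢ Icc 0 T) (1, 0) G (x, t)|
        ≤ 2 * M * d ^ 3 := by
  have hX : UniqueDiffOn ℝ (Icc a b) := uniqueDiffOn_Icc hab
  have hY : UniqueDiffOn ℝ (Icc 0 T) := uniqueDiffOn_Icc hT
  have h1 := contDiffOn_partialWithin (n := 2) hX hY hG (1, 0)
  have h2 := contDiffOn_partialWithin (n := 1) hX hY h1 (1, 0)
  have h3 := contDiffOn_partialWithin (n := 0) hX hY h2 (1, 0)
  obtain ⟨M, hM0, hM⟩ := exists_abs_le_of_continuousOn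
    ((isCompact_Icc (a := a) (b := b)).prod (isCompact_Icc (a := (0 : ℝ)) (b := T)))
    le_rfl h3.continuousOn
  exact ⟨M, hM0, fun t ht x d hd hx₁ hx₂ => abs_central_difference_le (s := Icc a b)
    ordConnected_Icc
    (fun z hz => hasDerivWithinAt_fst (n := 2) hG hz ht)
    (fun z hz => hasDerivWithinAt_fst (n := 1) h1 hz ht)
    (fun z hz => hasDerivWithinAt_fst (n := 0) h2 hz ht) (fun z hz => hM _ ⟨hz, ht⟩)
    hd hx₁ hx₂⟩

end Partial

/-! ### Truncation error of the left tempered-WSGD operator -/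

section Chain

variable {a b T : ℝ} {G : ℝ × ℝ → ℝ}

lemma contDiffOn_iterate_fst (hT : 0 < T) (hG : ContDiffOn ℝ (4 : ℕ) G (Iic b ×ˢ Icc 0 T)) {i n : ℕ}
    (hi : n + i = 4) :
    ContDiffOn ℝ n ((partialWithin (Iic b ×ˢ Icc 0 T) (1, 0))^[i] G) (Iic b ×ˢ Icc 0 T) :=
  contDiffOn_iterate_partialWithin (uniqueDiffOn_Iic b) (uniqueDiffOn_Icc hT) _ i (by rwa [hi])

lemma hasDerivWithinAt_iterate_fst (hT : 0 < T)
    (hG : ContDiffOn ℝ (4 : ℕ) G (Iic b ×ˢ Icc 0 T)) {i : ℕ} (hi : i < 4) {x t : ℝ} (hx : x ≤ b)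
    (ht : t ∈ Icc 0 T) :
    HasDerivWithinAt (fun x => (partialWithin (Iic b ×ˢ Icc 0 T) (1, 0))^[i] G (x, t))
      ((partialWithin (Iic b ×ˢ Icc 0 T) (1, 0))^[i + 1] G (x, t)) (Iic b) x := by
  obtain ⟨n, hn⟩ := Nat.exists_eq_add_of_le' (Nat.succ_le_of_lt hi)
  rw [Function.iterate_succ_apply']
  exact hasDerivWithinAt_fst (n := n) (contDiffOn_iterate_fst hT hG (by omega)) hx ht

lemma continuousOn_iterate_fst (hT : 0 < T)
    (hG : ContDiffOn ℝ (4 : ℕ) G (Iic b ×ˢ Icc 0 T)) {i : ℕ} (hi : i ≤ 4) {t : ℝ}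
    (ht : t ∈ Icc 0 T) :
    ContinuousOn (fun x => (partialWithin (Iic b ×ˢ Icc 0 T) (1, 0))^[i] G (x, t)) (Iic b) := by
  obtain ⟨n, hn⟩ := Nat.exists_eq_add_of_le' hi
  exact (contDiffOn_iterate_fst (n := n) hT hG (by omega)).continuousOn.comp
    (by fun_prop) fun x hx => mk_mem_prod hx ht

-- All x-derivatives of the zero extension vanish for x < a, hence also at a by continuity. This is
-- where smoothness across the endpoint is converted into vanishing boundary data.
open Filter Topology in
lemma isDerivChain_iterate_fst (hab : a < b) (hT : 0 < T)
    (hG : ContDiffOn ℝ (4 : ℕ) G (Iic b ×ˢ Icc 0 T))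
    (h0 : ∀ x < a, ∀ t ∈ Icc 0 T, G (x, t) = 0) {t : ℝ} (ht : t ∈ Icc 0 T) :
    IsDerivChain a b 4
      fun i x => (partialWithin (Iic b ×ˢ Icc 0 T) (1, 0))^[i] G (x, t) := by
  have hz : ∀ i ≤ 4, ∀ x < a, (partialWithin (Iic b ×ˢ Icc 0 T) (1, 0))^[i] G (x, t) = 0 := by
    intro i
    induction i with
    | zero => intro _ x hx; simpa using h0 x hx t ht
    | succ i ih =>
      intro hi x hx
      have h1 := (hasDerivWithinAt_iterate_fst hT hG (i := i) (by omega) (hx.trans hab).le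
        ht).hasDerivAt (Iic_mem_nhds (hx.trans hab))
      have h2 : HasDerivAt (fun x => (partialWithin (Iic b ×ˢ Icc 0 T) (1, 0))^[i] G (x, t)) 0 x :=
        (hasDerivAt_const x (0 : ℝ)).congr_of_eventuallyEq (by
          filter_upwards [Iio_mem_nhds hx] with y hy
          exact ih (by omega) y hy)
      exact h1.unique h2
  refine ⟨fun i hi => (continuousOn_iterate_fst hT hG hi ht).mono Icc_subset_Iic_self,
    fun i hi x hx => (hasDerivWithinAt_iterate_fst hT hG hi hx.2.le ht).hasDerivAt
      (Iic_mem_nhds hx.2), fun i hi => ?_⟩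
  have hc := ((continuousOn_iterate_fst hT hG hi.le ht) a hab.le).mono
    (Iio_subset_Iic hab.le : Iio a ⊆ Iic b)
  refine tendsto_nhds_unique hc.tendsto (tendsto_const_nhds.congr' ?_)
  filter_upwards [self_mem_nhdsWithin] with y hy
  exact (hz i hi.le y hy).symm

end Chain

lemma IsDerivChain.average {a b : ℝ} {n : ℕ} {f g : ℕ → ℝ → ℝ} (hf : IsDerivChain a b n f)
    (hg : IsDerivChain a b n g) : IsDerivChain a b n fun i x => (f i x + g i x) / 2 where
  continuousOn i hi := ((hf.continuousOn i hi).add (hg.continuousOn i hi)).div_const 2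
  hasDerivAt i hi x hx := ((hf.hasDerivAt i hi x hx).add (hg.hasDerivAt i hi x hx)).div_const 2
  eq_zero i hi := by simp [hf.eq_zero i hi, hg.eq_zero i hi]

open MeasureTheory in
lemma abs_integral_mul_rpow_le {a b α M x : ℝ} (h₂ : α < 2) {g : ℝ → ℝ}
    (hM : ∀ ξ ∈ Icc a b, |g ξ| ≤ M) (hx : x ∈ Icc a b) :
    |∫ ξ in a..x, g ξ * (x - ξ) ^ (1 - α)| ≤ M * ((b - a) ^ (2 - α) / (2 - α)) := by
  have hM0 : 0 ≤ M := (abs_nonneg _).trans (hM x hx)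
  have hb : ∫ ξ in a..x, M * (x - ξ) ^ (1 - α) = M * ((x - a) ^ (2 - α) / (2 - α)) := by
    rw [intervalIntegral.integral_const_mul,
      intervalIntegral.integral_comp_sub_left (fun s : ℝ => s ^ (1 - α)), sub_self,
      integral_rpow (Or.inl (by linarith)), show 1 - α + 1 = 2 - α by ring,
      Real.zero_rpow (by linarith), sub_zero]
  have := intervalIntegral.norm_integral_le_of_norm_le (a := a) (b := x) (μ := volume)
    (f := fun ξ => g ξ * (x - ξ) ^ (1 - α)) (g := fun ξ => M * (x - ξ) ^ (1 - α)) hx.1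
    (Filter.Eventually.of_forall fun ξ hξ => ?_)
    ((intervalIntegrable_sub_rpow (by linarith) x a x).const_mul _)
  · rw [hb] at this
    refine this.trans ?_
    have h2α : 0 < 2 - α := by linarith
    have hxa : 0 ≤ x - a := by linarith [hx.1]
    gcongr
    exact hx.2
  · rw [Real.norm_eq_abs, abs_mul, abs_of_nonneg (Real.rpow_nonneg (by linarith [hξ.2]) _)]
    have := Real.rpow_nonneg (by linarith [hξ.2] : 0 ≤ x - ξ) (1 - α)
    gcongr
    exact hM ξ ⟨hξ.1.le, hξ.2.trans hx.2⟩

lemma leftWSGD_eq {α lam γ₁ γ₂ γ₃ a b h : ℝ} {N j : ℕ} (hh : 0 < h) (hN : N * h = b - a)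
    (hj : j < N) {f v : ℝ → ℝ} (hv : ∀ ξ ∈ Icc a b, f ξ = Real.exp (lam * ξ) * v ξ) :
    leftWSGD α lam γ₁ γ₂ γ₃ h (fun i => v (a + i * h)) j
      = Real.exp (-(lam * (a + j * h))) * (1 / h ^ α * ∑ k ∈ Finset.range (j + 2),
          wsgdCoeff α γ₁ γ₂ γ₃ k * f (a + j * h + h - k * h))
        - 1 / h ^ α * wsgdShift α lam γ₁ γ₂ γ₃ h * v (a + j * h) := by
  unfold leftWSGD
  congr 1
  rw [mul_left_comm, Finset.mul_sum (s := Finset.range (j + 2)) (a := Real.exp _)]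
  congr 1
  refine Finset.sum_congr rfl fun k hk => ?_
  have hk' : k ≤ j + 1 := by rw [Finset.mem_range] at hk; omega
  have hkR : (k : ℝ) ≤ j + 1 := by exact_mod_cast hk'
  have hjR : (j : ℝ) + 1 ≤ N := by exact_mod_cast hj
  have e : a + ((j + 1 - k : ℕ) : ℝ) * h = a + j * h + h - k * h := by
    rw [Nat.cast_sub hk']; push_cast; ring
  have h1 : (k : ℝ) * h ≤ (j + 1) * h := by gcongr
  have h2 : 0 ≤ (k : ℝ) * h := by positivity
  have h3 : ((j : ℝ) + 1) * h ≤ N * h := by gcongr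
  beta_reduce
  rw [e, hv _ ⟨by linarith, by linarith⟩, wsgdWeight_eq,
    show Real.exp (-((k - 1 : ℝ) * h * lam)) = Real.exp (-(lam * (a + j * h)))
      * Real.exp (lam * (a + j * h + h - k * h)) by rw [← Real.exp_add]; ring_nf]
  ring

-- The error splits into four parts: spatial consistency for the averaged chain, the time average
-- against the midpoint inside the fractional integral (using that the second x-derivative is C² in
-- t), the error in κ, and the time average of the λ^α term. All are estimated for e^{λx}u and carry
-- a common factor e^{-λx} ≤ e^{-λa}.
set_option maxHeartbeats 1000000 in
lemma exists_leftWSGD_bound {α lam γ₁ γ₂ γ₃ a b T : ℝ} (h₁ : 1 < α) (h₂ : α < 2)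
    (hγ : AdmissibleWeights α γ₁ γ₂ γ₃) (hlam : 0 ≤ lam) (hab : a < b) (hT : 0 < T)
    {u : ℝ → ℝ → ℝ} (hu : ContDiffOn ℝ 4 (zeroExtLeft a u) (Iic b ×ˢ Icc 0 T)) :
    ∃ C, 0 ≤ C ∧ ∀ (N j : ℕ) (h : ℝ), 0 < h → N * h = b - a → 1 ≤ j → j < N →
      ∀ t₁ ∈ Icc 0 T, ∀ t₂ ∈ Icc 0 T,
      |leftWSGD α lam γ₁ γ₂ γ₃ h (fun i => (u (a + i * h) t₁ + u (a + i * h) t₂) / 2) j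
        - (leftTempered 2 α lam a (fun y => u y ((t₁ + t₂) / 2)) (a + j * h)
          - lam ^ α * u (a + j * h) ((t₁ + t₂) / 2))| ≤ C * (h ^ 2 + (t₂ - t₁) ^ 2) := by
  set S := Iic b ×ˢ Icc 0 T with hS
  set G : ℝ × ℝ → ℝ := fun p => Real.exp (lam * p.1) * zeroExtLeft a u p with hGdef
  have hG : ContDiffOn ℝ (4 : ℕ) G S := by
    refine ContDiffOn.mul (ContDiff.contDiffOn ?_) (by exact_mod_cast hu)
    exact (contDiff_const.mul contDiff_fst).exp
  have hG0 : ∀ x < a, ∀ t ∈ Icc 0 T, G (x, t) = 0 := fun x hx t _ => by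
    simp [hGdef, zeroExtLeft, hx]
  have hGu : ∀ t, ∀ ξ ∈ Icc a b, G (ξ, t) = Real.exp (lam * ξ) * u ξ t := fun t ξ hξ => by
    simp [hGdef, zeroExtLeft, not_lt.2 hξ.1]
  set H : ℕ → ℝ × ℝ → ℝ := fun i => (partialWithin S (1, 0))^[i] G with hH
  have hchain : ∀ t ∈ Icc 0 T, IsDerivChain a b 4 fun i x => H i (x, t) := fun t ht =>
    isDerivChain_iterate_fst hab hT hG hG0 ht
  have hsub : Icc a b ⊆ Iic b := Icc_subset_Iic_self
  have hcomp := (isCompact_Icc (a := a) (b := b)).prod (isCompact_Icc (a := (0 : ℝ)) (b := T))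
  obtain ⟨M₄, hM₄0, hM₄⟩ := exists_abs_le_of_continuousOn hcomp (prod_mono hsub le_rfl)
    (contDiffOn_iterate_fst (i := 4) (n := 0) hT hG rfl).continuousOn
  obtain ⟨M₀, hM₀0, hM₀⟩ := exists_abs_le_of_continuousOn hcomp (prod_mono hsub le_rfl)
    hG.continuousOn
  obtain ⟨A₂, hA₂0, hA₂⟩ := exists_average_bound (a := a) (uniqueDiffOn_Iic b) hsub hT
    (contDiffOn_iterate_fst (i := 2) (n := 2) hT hG rfl)
  obtain ⟨A₀, hA₀0, hA₀⟩ := exists_average_bound (a := a) (uniqueDiffOn_Iic b) hsub hT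
    (hG.of_le (by norm_cast : ((2 : ℕ) : WithTop ℕ∞) ≤ (4 : ℕ)))
  obtain ⟨Cc, hCc0, hCc⟩ := exists_consistency_bound h₁ h₂ hγ hab
  obtain ⟨Cs, hCs0, hCs⟩ := exists_wsgdShift_bound h₁ h₂ hγ hlam (b - a)
  set E := Real.exp (-(lam * a)) with hE
  set Γ := Real.Gamma (2 - α) with hΓ
  have hΓ0 : 0 < Γ := Real.Gamma_pos_of_pos (by linarith)
  have h2α : 0 < 2 - α := by linarith
  have hba : 0 < b - a := by linarith
  set I := (b - a) ^ (2 - α) / (2 - α) / Γ with hI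
  refine ⟨E * (Cc * M₄ + A₂ * I + Cs * M₀ + lam ^ α * A₀), by positivity, ?_⟩
  intro N j h hh hN hj hjN t₁ ht₁ t₂ ht₂
  set m := (t₁ + t₂) / 2 with hm
  have hmT : m ∈ Icc 0 T := ⟨by linarith [ht₁.1, ht₂.1], by linarith [ht₁.2, ht₂.2]⟩
  set x := a + j * h with hx
  have hj1 : (1 : ℝ) ≤ j := by exact_mod_cast hj
  have hjN' : (j : ℝ) + 1 ≤ N := by exact_mod_cast hjN
  have hjh : 1 * h ≤ j * h := by gcongr
  have hjNh : ((j : ℝ) + 1) * h ≤ N * h := by gcongr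
  have hxm : x ∈ Ioo a b := ⟨by linarith, by linarith⟩
  have hxm' : x ∈ Icc a b := ⟨hxm.1.le, hxm.2.le⟩
  have hhb : h ≤ b - a := by linarith
  set A : ℕ → ℝ → ℝ := fun i y => (H i (y, t₁) + H i (y, t₂)) / 2 with hA
  have hAc : IsDerivChain a b 4 A := (hchain t₁ ht₁).average (hchain t₂ ht₂)
  have hAv : ∀ ξ ∈ Icc a b, A 0 ξ = Real.exp (lam * ξ) * ((u ξ t₁ + u ξ t₂) / 2) := by
    intro ξ hξ
    simp only [hA, hH, Function.iterate_zero, id_eq]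
    rw [hGu t₁ ξ hξ, hGu t₂ ξ hξ]
    ring
  have hmv : ∀ ξ ∈ Icc a b, H 0 (ξ, m) = Real.exp (lam * ξ) * u ξ m := fun ξ hξ => hGu m ξ hξ
  have hL := leftWSGD_eq (α := α) (lam := lam) (γ₁ := γ₁) (γ₂ := γ₂) (γ₃ := γ₃) hh hN hjN hAv
  have hTm := (hchain m hmT).leftTempered_eq (lam := lam) (v := fun y => u y m) h₁ h₂ hmv hxm
  have c1 := hCc A M₄ hAc (fun ξ hξ => by
    have k1 := abs_le.1 (hM₄ (ξ, t₁) ⟨hξ, ht₁⟩)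
    have k2 := abs_le.1 (hM₄ (ξ, t₂) ⟨hξ, ht₂⟩)
    simp only [hA, hH]
    rw [abs_le]
    constructor <;> linarith [k1.1, k1.2, k2.1, k2.2]) N j h hh hN hjN
  rw [← hx] at c1 hL
  have c2 : |(∫ ξ in a..x, A 2 ξ * (x - ξ) ^ (1 - α)) / Γ
      - (∫ ξ in a..x, H 2 (ξ, m) * (x - ξ) ^ (1 - α)) / Γ| ≤ A₂ * I * (t₂ - t₁) ^ 2 := by
    have hint : ∀ {g : ℝ → ℝ}, ContinuousOn g (Icc a b) → IntervalIntegrable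
        (fun ξ => g ξ * (x - ξ) ^ (1 - α)) MeasureTheory.volume a x := fun hg =>
      (intervalIntegrable_sub_rpow (by linarith) x a x).continuousOn_mul
        (hg.mono (by rw [uIcc_of_le hxm'.1]; exact Icc_subset_Icc_right hxm'.2))
    rw [← sub_div, ← intervalIntegral.integral_sub (hint (hAc.continuousOn 2 (by norm_num)))
      (hint ((hchain m hmT).continuousOn 2 (by norm_num))), abs_div, abs_of_pos hΓ0,
      div_le_iff₀ hΓ0]
    simp only [← sub_mul]
    refine (abs_integral_mul_rpow_le h₂ (g := fun ξ => A 2 ξ - H 2 (ξ, m))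
      (fun ξ hξ => hA₂ ξ hξ t₁ ht₁ t₂ ht₂) hxm').trans (le_of_eq ?_)
    rw [hI]
    field_simp
  have c3 := hCs h hh hhb
  have hEx : Real.exp (-(lam * x)) ≤ E := by
    rw [hE, Real.exp_le_exp]
    have := mul_le_mul_of_nonneg_left hxm'.1 hlam
    linarith
  have hEE : Real.exp (-(lam * x)) * Real.exp (lam * x) = 1 := by
    rw [← Real.exp_add]; simp
  have hvx : (u x t₁ + u x t₂) / 2 = Real.exp (-(lam * x)) * A 0 x := by
    rw [hAv x hxm', ← mul_assoc, hEE, one_mul]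
  have hux : u x m = Real.exp (-(lam * x)) * H 0 (x, m) := by
    rw [hmv x hxm', ← mul_assoc, hEE, one_mul]
  have hA0 : |A 0 x| ≤ M₀ := by
    have k1 := abs_le.1 (hM₀ (x, t₁) ⟨hxm', ht₁⟩)
    have k2 := abs_le.1 (hM₀ (x, t₂) ⟨hxm', ht₂⟩)
    simp only [hA, hH, Function.iterate_zero, id_eq]
    rw [abs_le]
    constructor <;> linarith [k1.1, k1.2, k2.1, k2.2]
  have c4 : |A 0 x - H 0 (x, m)| ≤ A₀ * (t₂ - t₁) ^ 2 := hA₀ x hxm' t₁ ht₁ t₂ ht₂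
  set Q := 1 / h ^ α * ∑ k ∈ Finset.range (j + 2),
    wsgdCoeff α γ₁ γ₂ γ₃ k * A 0 (x + h - k * h) with hQ
  set DA := (∫ ξ in a..x, A 2 ξ * (x - ξ) ^ (1 - α)) / Γ with hDA
  set Dm := (∫ ξ in a..x, H 2 (ξ, m) * (x - ξ) ^ (1 - α)) / Γ with hDm
  set κ := 1 / h ^ α * wsgdShift α lam γ₁ γ₂ γ₃ h with hκ
  have e : leftWSGD α lam γ₁ γ₂ γ₃ h (fun i => (u (a + i * h) t₁ + u (a + i * h) t₂) / 2) j
        - (leftTempered 2 α lam a (fun y => u y m) x - lam ^ α * u x m)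
      = Real.exp (-(lam * x)) * ((Q - DA) + (DA - Dm) + (-((κ - lam ^ α) * A 0 x))
        + (-(lam ^ α * (A 0 x - H 0 (x, m))))) := by
    rw [hL, hTm, hvx, hux]
    ring
  have c3' : |-((κ - lam ^ α) * A 0 x)| ≤ Cs * h ^ 2 * M₀ := by
    rw [abs_neg, abs_mul]
    gcongr
  have c4' : |-(lam ^ α * (A 0 x - H 0 (x, m)))| ≤ lam ^ α * (A₀ * (t₂ - t₁) ^ 2) := by
    rw [abs_neg, abs_mul, abs_of_nonneg (by positivity : 0 ≤ lam ^ α)]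
    gcongr
  rw [e, abs_mul, Real.abs_exp]
  have hh2 : 0 ≤ h ^ 2 := sq_nonneg h
  have ht2 : 0 ≤ (t₂ - t₁) ^ 2 := sq_nonneg _
  have hI0 : 0 ≤ I := by positivity
  have tot : |(Q - DA) + (DA - Dm) + (-((κ - lam ^ α) * A 0 x))
        + (-(lam ^ α * (A 0 x - H 0 (x, m))))|
      ≤ Cc * M₄ * h ^ 2 + A₂ * I * (t₂ - t₁) ^ 2 + Cs * h ^ 2 * M₀
        + lam ^ α * (A₀ * (t₂ - t₁) ^ 2) :=
    (abs_add_le _ _).trans (add_le_add ((abs_add_three _ _ _).trans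
      (add_le_add (add_le_add c1 c2) c3')) c4')
  rw [mul_assoc E]
  refine mul_le_mul hEx (tot.trans ?_) (abs_nonneg _) (Real.exp_pos _).le
  have p1 : 0 ≤ Cc * M₄ * (t₂ - t₁) ^ 2 := by positivity
  have p2 : 0 ≤ A₂ * I * h ^ 2 := by positivity
  have p3 : 0 ≤ Cs * M₀ * (t₂ - t₁) ^ 2 := by positivity
  have p4 : 0 ≤ lam ^ α * A₀ * h ^ 2 := by positivity
  linarith

/-! ### Reflection and the right tempered-WSGD operator -/

/-- Reflection x ↦ -x exchanges the two sides; the signs from the two derivatives cancel. It reduces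
the right operator to the left one on [-b, -a]. -/
lemma rightTempered_eq_leftTempered (α lam b : ℝ) (v : ℝ → ℝ) (x : ℝ) :
    rightTempered 2 α lam b v x = leftTempered 2 α lam (-b) (fun y => v (-y)) (-x) := by
  have e : (fun y => ∫ ξ in y..b, Real.exp (-(lam * ξ)) * v ξ / (ξ - y) ^ (α - (2 : ℕ) + 1))
      = fun y => (fun z => ∫ ξ in (-b)..z, Real.exp (lam * ξ) * v (-ξ) /
        (z - ξ) ^ (α - (2 : ℕ) + 1)) (-y) := by
    funext y
    have := intervalIntegral.integral_comp_neg (a := -b) (b := -y)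
      (fun ξ => Real.exp (-(lam * ξ)) * v ξ / (ξ - y) ^ (α - (2 : ℕ) + 1))
    rw [neg_neg, neg_neg] at this
    rw [← this]
    refine intervalIntegral.integral_congr fun ξ _ => ?_
    ring_nf
  rw [rightTempered, leftTempered, e]
  generalize (fun z => ∫ ξ in (-b)..z, Real.exp (lam * ξ) * v (-ξ) /
        (z - ξ) ^ (α - (2 : ℕ) + 1)) = L
  rw [iteratedDeriv_comp_neg]
  norm_num

lemma contDiffOn_zeroExtLeft_neg {a b T : ℝ} {u : ℝ → ℝ → ℝ}
    (hu : ContDiffOn ℝ 4 (zeroExtRight b u) (Ici a ×ˢ Icc 0 T)) :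
    ContDiffOn ℝ 4 (zeroExtLeft (-b) fun x t => u (-x) t) (Iic (-a) ×ˢ Icc 0 T) := by
  have e : zeroExtLeft (-b) (fun x t => u (-x) t)
      = zeroExtRight b u ∘ fun p : ℝ × ℝ => (-p.1, p.2) := by
    funext p
    simp only [zeroExtLeft, zeroExtRight, Function.comp_apply, lt_neg]
  rw [e]
  refine hu.comp ((contDiff_fst.neg.prodMk contDiff_snd).contDiffOn) fun p hp => ?_
  exact mk_mem_prod (mem_Ici.2 (le_neg.1 (mem_Iic.1 hp.1))) hp.2

/-- The reflected node N - i is meaningful only for i ≤ N, so the two grid functions need to be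
compared only at the nodes the operator uses. -/
lemma leftWSGD_congr {α lam γ₁ γ₂ γ₃ h : ℝ} {V W : ℕ → ℝ} {j : ℕ}
    (hVW : ∀ i ≤ j + 1, V i = W i) :
    leftWSGD α lam γ₁ γ₂ γ₃ h V j = leftWSGD α lam γ₁ γ₂ γ₃ h W j := by
  unfold leftWSGD
  rw [hVW j (by omega), Finset.sum_congr rfl fun k _ => by rw [hVW (j + 1 - k) (by omega)]]

lemma exists_rightWSGD_bound {α lam γ₁ γ₂ γ₃ a b T : ℝ} (h₁ : 1 < α) (h₂ : α < 2)
    (hγ : AdmissibleWeights α γ₁ γ₂ γ₃) (hlam : 0 ≤ lam) (hab : a < b) (hT : 0 < T)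
    {u : ℝ → ℝ → ℝ} (hu : ContDiffOn ℝ 4 (zeroExtRight b u) (Ici a ×ˢ Icc 0 T)) :
    ∃ C, 0 ≤ C ∧ ∀ (N j : ℕ) (h : ℝ), 0 < h → N * h = b - a → 1 ≤ j → j < N →
      ∀ t₁ ∈ Icc 0 T, ∀ t₂ ∈ Icc 0 T,
      |rightWSGD α lam γ₁ γ₂ γ₃ h N (fun i => (u (a + i * h) t₁ + u (a + i * h) t₂) / 2) j
        - (rightTempered 2 α lam b (fun y => u y ((t₁ + t₂) / 2)) (a + j * h)
          - lam ^ α * u (a + j * h) ((t₁ + t₂) / 2))| ≤ C * (h ^ 2 + (t₂ - t₁) ^ 2) := by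
  obtain ⟨C, hC, hb⟩ := exists_leftWSGD_bound h₁ h₂ hγ hlam (neg_lt_neg hab) hT
    (contDiffOn_zeroExtLeft_neg hu)
  refine ⟨C, hC, fun N j h hh hN hj hjN t₁ ht₁ t₂ ht₂ => ?_⟩
  have key := hb N (N - j) h hh (by rw [hN]; ring) (by omega) (by omega) t₁ ht₁ t₂ ht₂
  have hx : -b + ((N - j : ℕ) : ℝ) * h = -(a + j * h) := by
    rw [Nat.cast_sub hjN.le]
    linear_combination hN
  rw [hx, ← rightTempered_eq_leftTempered α lam b (fun y => u y ((t₁ + t₂) / 2)), neg_neg] at key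
  rw [rightWSGD_eq_leftWSGD _ _ _ _ _ _ hj hjN]
  convert key using 3
  refine leftWSGD_congr fun i hi => ?_
  have hiN : i ≤ N := by omega
  rw [show a + ((N - i : ℕ) : ℝ) * h = -(-b + i * h) by
    rw [Nat.cast_sub hiN]; linear_combination hN]

/-! ### Truncation error of the scheme -/

/-- As l + r = 1, at least one of the two one-sided smoothness assumptions is in force, and on the
rectangle the extension is u itself. -/
lemma contDiffOn_of_isSufficientlySmooth {a b T l r : ℝ} (hlr : l + r = 1) {u : ℝ → ℝ → ℝ}
    (hu : IsSufficientlySmooth a b T l r u) :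
    ContDiffOn ℝ (4 : ℕ) (fun p : ℝ × ℝ => u p.1 p.2) (Icc a b ×ˢ Icc 0 T) := by
  by_cases hl : l = 0
  · refine ((hu.2 (by rintro rfl; linarith)).mono (prod_mono Icc_subset_Ici_self le_rfl)).congr
      fun p hp => ?_
    simp [zeroExtRight, not_lt.2 hp.1.2]
  · refine ((hu.1 hl).mono (prod_mono Icc_subset_Iic_self le_rfl)).congr fun p hp => ?_
    simp [zeroExtLeft, not_lt.2 hp.1.1]

set_option maxHeartbeats 1000000 in
lemma exists_truncation_bound {α lam γ₁ γ₂ γ₃ a b T l r : ℝ} (h₁ : 1 < α) (h₂ : α < 2)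
    (hγ : AdmissibleWeights α γ₁ γ₂ γ₃) (hlam : 0 ≤ lam) (hab : a < b) (hT : 0 < T)
    (hl : 0 ≤ l) (hr : 0 ≤ r) (hlr : l + r = 1) {s : ℝ → ℝ → ℝ} {u₀ φl φr : ℝ → ℝ}
    {u : ℝ → ℝ → ℝ} (hu : IsExactSolution α lam a b T l r s u₀ φl φr u)
    (hsmooth : IsSufficientlySmooth a b T l r u) :
    ∃ C, 0 ≤ C ∧ ∀ (N j : ℕ) (h : ℝ), 0 < h → N * h = b - a → 1 ≤ j → j < N →
      ∀ t₁ ∈ Icc 0 T, ∀ t₂ ∈ Icc 0 T, t₁ ≤ t₂ → ∀ V : ℕ → ℝ,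
      (V = fun i : ℕ => (u (a + i * h) t₁ + u (a + i * h) t₂) / 2) →
      |u (a + j * h) t₂ - u (a + j * h) t₁ - (t₂ - t₁) *
        (l * leftWSGD α lam γ₁ γ₂ γ₃ h V j + r * rightWSGD α lam γ₁ γ₂ γ₃ h N V j
          - α * lam ^ (α - 1) * (l - r) * ((V (j + 1) - V (j - 1)) / (2 * h))
          + s (a + j * h) ((t₁ + t₂) / 2))|
        ≤ (t₂ - t₁) * (C * (h ^ 2 + (t₂ - t₁) ^ 2)) := by
  have hX : UniqueDiffOn ℝ (Icc a b) := uniqueDiffOn_Icc hab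
  have hY : UniqueDiffOn ℝ (Icc 0 T) := uniqueDiffOn_Icc hT
  set S := Icc a b ×ˢ Icc 0 T with hS
  set G : ℝ × ℝ → ℝ := fun p => u p.1 p.2 with hGdef
  have hG : ContDiffOn ℝ (4 : ℕ) G S := contDiffOn_of_isSufficientlySmooth hlr hsmooth
  have hG3 : ContDiffOn ℝ (3 : ℕ) G S := hG.of_le (by norm_cast)
  have hGx : ContDiffOn ℝ (3 : ℕ) (partialWithin S (1, 0) G) S :=
    contDiffOn_partialWithin hX hY hG (1, 0)
  have hGx2 : ContDiffOn ℝ (2 : ℕ) (partialWithin S (1, 0) G) S := hGx.of_le (by norm_cast)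
  obtain ⟨Mt, hMt0, hMt⟩ := exists_time_difference_bound (a := a) hX subset_rfl hT hG3
  obtain ⟨Mx, hMx0, hMx⟩ := exists_space_difference_bound hab hT hG3
  obtain ⟨Ma, hMa0, hMa⟩ := exists_average_bound (a := a) hX subset_rfl hT hGx2
  have hL : ∃ C, 0 ≤ C ∧ ∀ (N j : ℕ) (h : ℝ), 0 < h → N * h = b - a → 1 ≤ j → j < N →
      ∀ t₁ ∈ Icc 0 T, ∀ t₂ ∈ Icc 0 T,
      |l * (leftWSGD α lam γ₁ γ₂ γ₃ h (fun i => (u (a + i * h) t₁ + u (a + i * h) t₂) / 2) j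
        - (leftTempered 2 α lam a (fun y => u y ((t₁ + t₂) / 2)) (a + j * h)
          - lam ^ α * u (a + j * h) ((t₁ + t₂) / 2)))| ≤ C * (h ^ 2 + (t₂ - t₁) ^ 2) := by
    -- On an inactive side u need not extend smoothly and the operator need not be consistent, but
    -- its factor l is zero.
    by_cases hl0 : l = 0
    · exact ⟨0, le_rfl, fun N j h _ _ _ _ t₁ _ t₂ _ => by simp [hl0]⟩
    · obtain ⟨C, hC, hb⟩ := exists_leftWSGD_bound h₁ h₂ hγ hlam hab hT (hsmooth.1 hl0)
      refine ⟨l * C, by positivity, fun N j h hh hN hj hjN t₁ ht₁ t₂ ht₂ => ?_⟩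
      rw [abs_mul, abs_of_nonneg hl, mul_assoc]
      exact mul_le_mul_of_nonneg_left (hb N j h hh hN hj hjN t₁ ht₁ t₂ ht₂) hl
  have hR : ∃ C, 0 ≤ C ∧ ∀ (N j : ℕ) (h : ℝ), 0 < h → N * h = b - a → 1 ≤ j → j < N →
      ∀ t₁ ∈ Icc 0 T, ∀ t₂ ∈ Icc 0 T,
      |r * (rightWSGD α lam γ₁ γ₂ γ₃ h N (fun i => (u (a + i * h) t₁ + u (a + i * h) t₂) / 2) j
        - (rightTempered 2 α lam b (fun y => u y ((t₁ + t₂) / 2)) (a + j * h)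
          - lam ^ α * u (a + j * h) ((t₁ + t₂) / 2)))| ≤ C * (h ^ 2 + (t₂ - t₁) ^ 2) := by
    by_cases hr0 : r = 0
    · exact ⟨0, le_rfl, fun N j h _ _ _ _ t₁ _ t₂ _ => by simp [hr0]⟩
    · obtain ⟨C, hC, hb⟩ := exists_rightWSGD_bound h₁ h₂ hγ hlam hab hT (hsmooth.2 hr0)
      refine ⟨r * C, by positivity, fun N j h hh hN hj hjN t₁ ht₁ t₂ ht₂ => ?_⟩
      rw [abs_mul, abs_of_nonneg hr, mul_assoc]
      exact mul_le_mul_of_nonneg_left (hb N j h hh hN hj hjN t₁ ht₁ t₂ ht₂) hr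
  obtain ⟨CL, hCL0, hCL⟩ := hL
  obtain ⟨CR, hCR0, hCR⟩ := hR
  set B := α * lam ^ (α - 1) with hB
  have hB0 : 0 ≤ B := by positivity
  refine ⟨Mt + CL + CR + B * (Mx + Ma), by positivity, ?_⟩
  rintro N j h hh hN hj hjN t₁ ht₁ t₂ ht₂ hle V rfl
  set m := (t₁ + t₂) / 2 with hm
  set τ := t₂ - t₁ with hτ
  have hτ0 : 0 ≤ τ := by linarith
  have hmT : m ∈ Icc 0 T := ⟨by linarith [ht₁.1, ht₂.1], by linarith [ht₁.2, ht₂.2]⟩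
  set x := a + j * h with hx
  have hj1 : (1 : ℝ) ≤ j := by exact_mod_cast hj
  have hjN' : (j : ℝ) + 1 ≤ N := by exact_mod_cast hjN
  have hjh : 1 * h ≤ j * h := by gcongr
  have hjNh : ((j : ℝ) + 1) * h ≤ N * h := by gcongr
  have hxm : x ∈ Ioo a b := ⟨by linarith, by linarith⟩
  have hxm' : x ∈ Icc a b := ⟨hxm.1.le, hxm.2.le⟩
  have hxp : x + h ∈ Icc a b := ⟨by linarith, by linarith⟩
  have hxn : x - h ∈ Icc a b := ⟨by linarith, by linarith⟩
  set ut := partialWithin S (0, 1) G (x, m) with hut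
  have hut_eq : ut = l * leftVariant α lam a (fun y => u y m) x
      + r * rightVariant α lam b (fun y => u y m) x + s x m :=
    -- Uniqueness of the derivative within [0, T] identifies the partial derivative of the smooth
    -- function with the right-hand side of the equation at the midpoint.
    (hY m hmT).eq_deriv _ (hasDerivWithinAt_snd (n := 3) hG hxm' hmT) (hu.equation x hxm m hmT)
  have hux_eq : ∀ t ∈ Icc 0 T, deriv (fun y => u y t) x = partialWithin S (1, 0) G (x, t) :=
    fun t ht => ((hasDerivWithinAt_fst (n := 3) hG hxm' ht).hasDerivAt
      (Icc_mem_nhds hxm.1 hxm.2)).deriv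
  have d1 := hMt x hxm' t₁ ht₁ t₂ ht₂ hle
  have d2 := hCL N j h hh hN hj hjN t₁ ht₁ t₂ ht₂
  have d3 := hCR N j h hh hN hj hjN t₁ ht₁ t₂ ht₂
  have d4 := hMa x hxm' t₁ ht₁ t₂ ht₂
  have hdq : ∀ t ∈ Icc 0 T,
      |(u (x + h) t - u (x - h) t) / (2 * h) - partialWithin S (1, 0) G (x, t)| ≤ Mx * h ^ 2 := by
    intro t ht
    have := hMx t ht x h hh.le hxn hxp
    have e : (u (x + h) t - u (x - h) t) / (2 * h) - partialWithin S (1, 0) G (x, t)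
        = (G (x + h, t) - G (x - h, t) - 2 * h * partialWithin S (1, 0) G (x, t)) / (2 * h) := by
      simp only [hGdef]
      field_simp
    rw [e, abs_div, abs_of_pos (by positivity : 0 < 2 * h), div_le_iff₀ (by positivity)]
    refine this.trans (le_of_eq ?_)
    ring
  have d5 := hdq t₁ ht₁
  have d6 := hdq t₂ ht₂
  have ep : a + ((j + 1 : ℕ) : ℝ) * h = x + h := by rw [hx]; push_cast; ring
  have en : a + ((j - 1 : ℕ) : ℝ) * h = x - h := by rw [hx, Nat.cast_sub hj]; push_cast; ring
  simp only [ep, en]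
  rw [← hx, ← hm] at d2 d3
  rw [leftVariant, rightVariant, hux_eq m hmT] at hut_eq
  set LV := leftWSGD α lam γ₁ γ₂ γ₃ h (fun i => (u (a + i * h) t₁ + u (a + i * h) t₂) / 2) j
  set RV := rightWSGD α lam γ₁ γ₂ γ₃ h N (fun i => (u (a + i * h) t₁ + u (a + i * h) t₂) / 2) j
  set LT := leftTempered 2 α lam a (fun y => u y m) x
  set RT := rightTempered 2 α lam b (fun y => u y m) x
  set p₁ := partialWithin S (1, 0) G (x, t₁)
  set p₂ := partialWithin S (1, 0) G (x, t₂)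
  set pm := partialWithin S (1, 0) G (x, m)
  set dq₁ := (u (x + h) t₁ - u (x - h) t₁) / (2 * h) with hdq₁
  set dq₂ := (u (x + h) t₂ - u (x - h) t₂) / (2 * h) with hdq₂
  have dd : |((dq₁ - p₁) + (dq₂ - p₂)) / 2 + ((p₁ + p₂) / 2 - pm)| ≤ Mx * h ^ 2 + Ma * τ ^ 2 := by
    rw [abs_le] at d4 d5 d6 ⊢
    constructor <;> linarith [d4.1, d4.2, d5.1, d5.2, d6.1, d6.2]
  have dB : |B * (l - r) * (((dq₁ - p₁) + (dq₂ - p₂)) / 2 + ((p₁ + p₂) / 2 - pm))|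
      ≤ B * 1 * (Mx * h ^ 2 + Ma * τ ^ 2) := by
    rw [abs_mul, abs_mul, abs_of_nonneg hB0]
    gcongr
    rw [abs_le]; constructor <;> linarith
  have e : u x t₂ - u x t₁ - τ * (l * LV + r * RV - B * (l - r) *
        (((u (x + h) t₁ + u (x + h) t₂) / 2 - (u (x - h) t₁ + u (x - h) t₂) / 2) / (2 * h)) + s x m)
      = (G (x, t₂) - G (x, t₁) - τ * ut) + τ * (-(l * (LV - (LT - lam ^ α * u x m)))
        + (-(r * (RV - (RT - lam ^ α * u x m))))
        + B * (l - r) * (((dq₁ - p₁) + (dq₂ - p₂)) / 2 + ((p₁ + p₂) / 2 - pm))) := by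
    rw [hut_eq, hdq₁, hdq₂, hB]
    simp only [hGdef]
    ring
  rw [e]
  have hh2 : 0 ≤ h ^ 2 := sq_nonneg h
  have ht2 : 0 ≤ τ ^ 2 := sq_nonneg τ
  have hin : |-(l * (LV - (LT - lam ^ α * u x m))) + (-(r * (RV - (RT - lam ^ α * u x m))))
        + B * (l - r) * (((dq₁ - p₁) + (dq₂ - p₂)) / 2 + ((p₁ + p₂) / 2 - pm))|
      ≤ CL * (h ^ 2 + τ ^ 2) + CR * (h ^ 2 + τ ^ 2) + B * 1 * (Mx * h ^ 2 + Ma * τ ^ 2) :=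
    (abs_add_three _ _ _).trans
      (add_le_add (add_le_add (by rwa [abs_neg]) (by rwa [abs_neg])) dB)
  calc _ ≤ Mt * τ ^ 3 + τ * (CL * (h ^ 2 + τ ^ 2) + CR * (h ^ 2 + τ ^ 2)
        + B * 1 * (Mx * h ^ 2 + Ma * τ ^ 2)) := by
        refine (abs_add_le _ _).trans (add_le_add d1 ?_)
        rw [abs_mul, abs_of_nonneg hτ0]
        exact mul_le_mul_of_nonneg_left hin hτ0
    _ = τ * (Mt * τ ^ 2 + (CL * (h ^ 2 + τ ^ 2) + CR * (h ^ 2 + τ ^ 2)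
        + B * (Mx * h ^ 2 + Ma * τ ^ 2))) := by ring
    _ ≤ _ := by
        refine mul_le_mul_of_nonneg_left ?_ hτ0
        have q1 := mul_nonneg hMt0 hh2
        have q2 := mul_nonneg hB0 (mul_nonneg hMx0 ht2)
        have q3 := mul_nonneg hB0 (mul_nonneg hMa0 hh2)
        linarith

/-! ### Energy estimate and convergence -/

lemma leftWSGD_sub (α lam γ₁ γ₂ γ₃ h : ℝ) (V W : ℕ → ℝ) (j : ℕ) :
    leftWSGD α lam γ₁ γ₂ γ₃ h (fun i => V i - W i) j
      = leftWSGD α lam γ₁ γ₂ γ₃ h V j - leftWSGD α lam γ₁ γ₂ γ₃ h W j := by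
  simp only [leftWSGD, mul_sub, Finset.sum_sub_distrib]
  ring

lemma rightWSGD_sub (α lam γ₁ γ₂ γ₃ h : ℝ) (N : ℕ) (V W : ℕ → ℝ) (j : ℕ) :
    rightWSGD α lam γ₁ γ₂ γ₃ h N (fun i => V i - W i) j
      = rightWSGD α lam γ₁ γ₂ γ₃ h N V j - rightWSGD α lam γ₁ γ₂ γ₃ h N W j := by
  simp only [rightWSGD, mul_sub, Finset.sum_sub_distrib]
  ring

lemma gridNorm_nonneg (h : ℝ) (N : ℕ) (v : ℕ → ℝ) : 0 ≤ gridNorm h N v := Real.sqrt_nonneg _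

lemma gridNorm_sq {h : ℝ} (hh : 0 ≤ h) (N : ℕ) (v : ℕ → ℝ) :
    gridNorm h N v ^ 2 = h * ∑ m ∈ Finset.Ico 1 N, v m ^ 2 :=
  Real.sq_sqrt (mul_nonneg hh (Finset.sum_nonneg fun _ _ => sq_nonneg _))

lemma sum_mul_le_gridNorm_mul {h : ℝ} (hh : 0 ≤ h) (N : ℕ) (v w : ℕ → ℝ) :
    h * ∑ m ∈ Finset.Ico 1 N, v m * w m ≤ gridNorm h N v * gridNorm h N w := by
  have key := Real.sum_mul_le_sqrt_mul_sqrt (Finset.Ico 1 N) v w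
  rw [gridNorm, gridNorm, Real.sqrt_mul hh, Real.sqrt_mul hh]
  calc _ ≤ h * (√(∑ m ∈ Finset.Ico 1 N, v m ^ 2) * √(∑ m ∈ Finset.Ico 1 N, w m ^ 2)) :=
        mul_le_mul_of_nonneg_left key hh
    _ = √h * √h * (√(∑ m ∈ Finset.Ico 1 N, v m ^ 2) * √(∑ m ∈ Finset.Ico 1 N, w m ^ 2)) := by
        rw [Real.mul_self_sqrt hh]
    _ = _ := by ring

lemma gridNorm_le_of_abs_le {h R : ℝ} (hh : 0 ≤ h) (hR : 0 ≤ R) {N : ℕ} {v : ℕ → ℝ}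
    (hv : ∀ j, 1 ≤ j → j < N → |v j| ≤ R) : gridNorm h N v ≤ R * √(N * h) := by
  have hs : ∑ m ∈ Finset.Ico 1 N, v m ^ 2 ≤ N * R ^ 2 := by
    calc _ ≤ ∑ _m ∈ Finset.Ico 1 N, R ^ 2 := Finset.sum_le_sum fun m hm => by
          rw [Finset.mem_Ico] at hm
          exact sq_le_sq' (abs_le.1 (hv m hm.1 hm.2)).1 (abs_le.1 (hv m hm.1 hm.2)).2
      _ = ((N - 1 : ℕ) : ℝ) * R ^ 2 := by simp
      _ ≤ _ := by
          gcongr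
          omega
  rw [gridNorm, ← Real.sqrt_sq hR, ← Real.sqrt_mul (sq_nonneg R)]
  refine Real.sqrt_le_sqrt ?_
  have := mul_le_mul_of_nonneg_left hs hh
  linarith

/-- By Cauchy–Schwarz the hypothesis becomes A² - B² ≤ τD(A + B) for the two norms A and B;
cancelling A + B gives linear growth, without a Gronwall factor. -/
lemma gridNorm_step_le {h R τ : ℝ} (hh : 0 ≤ h) (hτ : 0 ≤ τ) (hR : 0 ≤ R) {N : ℕ}
    {v w ρ : ℕ → ℝ} (hρ : ∀ j, 1 ≤ j → j < N → |ρ j| ≤ R)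
    (hle : ∑ j ∈ Finset.Ico 1 N, (w j ^ 2 - v j ^ 2)
      ≤ τ * ∑ j ∈ Finset.Ico 1 N, ρ j * (v j + w j)) :
    gridNorm h N w ≤ gridNorm h N v + τ * (R * √(N * h)) := by
  have c1 := sum_mul_le_gridNorm_mul hh N ρ v
  have c2 := sum_mul_le_gridNorm_mul hh N ρ w
  have c3 := gridNorm_le_of_abs_le hh hR hρ
  have s1 := gridNorm_sq hh N v
  have s2 := gridNorm_sq hh N w
  have hv := gridNorm_nonneg h N v
  have hw := gridNorm_nonneg h N w
  rw [Finset.sum_sub_distrib] at hle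
  simp only [mul_add, Finset.sum_add_distrib] at hle
  set A := gridNorm h N w
  set B := gridNorm h N v
  set D := R * √(N * h)
  have hD : 0 ≤ D := mul_nonneg hR (Real.sqrt_nonneg _)
  have k1 : A ^ 2 - B ^ 2 ≤ τ * (D * (A + B)) := by
    have m1 := mul_le_mul_of_nonneg_left hle hh
    have m2 := mul_le_mul_of_nonneg_left (add_le_add c1 c2) hτ
    have m3 := mul_le_mul_of_nonneg_left
      (mul_le_mul_of_nonneg_right c3 (add_nonneg hw hv)) hτ
    linarith
  by_contra! hlt
  have hAB : 0 < A - B - τ * D := by linarith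
  have hpos : 0 < A + B := by
    have : 0 ≤ τ * D := mul_nonneg hτ hD
    linarith
  nlinarith [mul_pos hAB hpos]

set_option maxHeartbeats 1000000 in
lemma error_energy_le {α lam γ₁ γ₂ γ₃ h τ l r c : ℝ} (h₁ : 1 < α) (h₂ : α < 2)
    (hγ : AdmissibleWeights α γ₁ γ₂ γ₃) (hlam : 0 ≤ lam) (hh : 0 ≤ h) (hτ : 0 ≤ τ)
    (hl : 0 ≤ l) (hr : 0 ≤ r) {N : ℕ} (hN : 1 ≤ N) {v w ρ E : ℕ → ℝ}
    (hE : E = fun i => (v i + w i) / 2)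
    (hv0 : v 0 = 0) (hvN : v N = 0) (hw0 : w 0 = 0) (hwN : w N = 0)
    (heq : ∀ j, 1 ≤ j → j < N → w j - v j
      = τ * (l * leftWSGD α lam γ₁ γ₂ γ₃ h E j + r * rightWSGD α lam γ₁ γ₂ γ₃ h N E j
        - c * ((E (j + 1) - E (j - 1)) / (2 * h))) + τ * ρ j) :
    ∑ j ∈ Finset.Ico 1 N, (w j ^ 2 - v j ^ 2)
      ≤ τ * ∑ j ∈ Finset.Ico 1 N, ρ j * (v j + w j) := by
  have hE0 : E 0 = 0 := by simp [hE, hv0, hw0]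
  have hEN : E N = 0 := by simp [hE, hvN, hwN]
  have e1 := hγ.sum_leftWSGD_mul_nonpos h₁ h₂ hlam hh hN hE0 hEN
  have e2 := hγ.sum_rightWSGD_mul_nonpos h₁ h₂ hlam hh hN hE0 hEN
  have e3 := sum_Ico_shift_eq hN hE0 hEN
  -- The equation is tested with v + w = 2E, twice the Crank–Nicolson average, so the left side
  -- becomes an exact difference of squares and the operators appear as quadratic forms in E.
  have e : ∑ j ∈ Finset.Ico 1 N, (w j ^ 2 - v j ^ 2)
      = 2 * τ * (l * ∑ j ∈ Finset.Ico 1 N, leftWSGD α lam γ₁ γ₂ γ₃ h E j * E j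
        + r * ∑ j ∈ Finset.Ico 1 N, rightWSGD α lam γ₁ γ₂ γ₃ h N E j * E j
        - c / (2 * h) * (∑ j ∈ Finset.Ico 1 N, E (j + 1) * E j
          - ∑ j ∈ Finset.Ico 1 N, E (j - 1) * E j))
        + τ * ∑ j ∈ Finset.Ico 1 N, ρ j * (v j + w j) := by
    simp only [Finset.mul_sum, ← Finset.sum_add_distrib, ← Finset.sum_sub_distrib]
    refine Finset.sum_congr rfl fun j hj => ?_
    rw [Finset.mem_Ico] at hj
    have hj' := heq j hj.1 hj.2
    have hEj : v j + w j = 2 * E j := by simp only [hE]; ring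
    have : w j ^ 2 - v j ^ 2 = (w j - v j) * (v j + w j) := by ring
    rw [this, hj', hEj]
    ring
  rw [e, e3, sub_self, mul_zero, sub_zero]
  have f1 := mul_nonpos_of_nonneg_of_nonpos hl e1
  have f2 := mul_nonpos_of_nonneg_of_nonpos hr e2
  have := mul_nonpos_of_nonneg_of_nonpos (by linarith : 0 ≤ 2 * τ) (add_nonpos f1 f2)
  linarith

end TemperedDiffusion

end

/-! ### Convergence: consistency combined with stability. -/

theorem mainTheorem2
    (α lam a b T l r : ℝ) (hα₁ : 1 < α) (hα₂ : α < 2) (hlam : 0 ≤ lam)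
    (hab : a < b) (hT : 0 < T) (hl : 0 ≤ l) (hr : 0 ≤ r) (hlr : l + r = 1)
    (s : ℝ → ℝ → ℝ) (u₀ φl φr : ℝ → ℝ)
    (hφl : l ≠ 0 → ∀ t ∈ Set.Icc 0 T, φl t = 0)
    (hφr : r ≠ 0 → ∀ t ∈ Set.Icc 0 T, φr t = 0)
    (u : ℝ → ℝ → ℝ)
    (hu : TemperedDiffusion.IsExactSolution α lam a b T l r s u₀ φl φr u)
    (hsmooth : TemperedDiffusion.IsSufficientlySmooth a b T l r u)
    (γ₁ γ₂ γ₃ : ℝ)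
    (hγ : TemperedDiffusion.AdmissibleS1 α γ₁ γ₂ γ₃ ∨ TemperedDiffusion.AdmissibleS2 α γ₁ γ₂ γ₃ ∨
      TemperedDiffusion.AdmissibleS3 α γ₁ γ₂ γ₃) :
    ∃ c : ℝ, 0 < c ∧ ∀ Nx Nt : ℕ, 1 ≤ Nx → 1 ≤ Nt →
      ∀ h τ : ℝ, h = (b - a) / Nx → τ = T / Nt →
      ∀ U : ℕ → ℕ → ℝ,
        TemperedDiffusion.IsSchemeSolution α lam γ₁ γ₂ γ₃ a b T l r s u₀ φl φr Nx Nt h τ U →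
        ∀ n : ℕ, 1 ≤ n → n ≤ Nt →
          TemperedDiffusion.gridNorm h Nx (fun j => u (a + j * h) (n * τ) - U n j)
            ≤ c * (τ ^ 2 + h ^ 2) := by
  have hα₀ : 0 < α := by linarith
  have hγ' : TemperedDiffusion.AdmissibleWeights α γ₁ γ₂ γ₃ := by
    rcases hγ with hγ | hγ | hγ
    exacts [hγ.admissibleWeights hα₀, hγ.admissibleWeights hα₀, hγ.admissibleWeights hα₀]
  obtain ⟨C, hC, htr⟩ := TemperedDiffusion.exists_truncation_bound hα₁ hα₂ hγ' hlam hab hT hl hr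
    hlr hu hsmooth
  -- Each step adds τC(h² + τ²)√(b-a) to the error and nτ ≤ T; the 1 only makes the constant
  -- strictly positive.
  refine ⟨T * (C * √(b - a)) + 1, by positivity, ?_⟩
  intro Nx Nt hNx hNt h τ hh hτ U hU n _ hn
  have hNx' : (0 : ℝ) < Nx := by exact_mod_cast hNx
  have hNt' : (0 : ℝ) < Nt := by exact_mod_cast hNt
  have hba : 0 < b - a := by linarith
  have hh0 : 0 < h := by rw [hh]; positivity
  have hτ0 : 0 < τ := by rw [hτ]; positivity
  have hNh : Nx * h = b - a := by rw [hh]; field_simp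
  have hNτ : Nt * τ = T := by rw [hτ]; field_simp
  have hmem : ∀ k : ℕ, k ≤ Nt → (k : ℝ) * τ ∈ Set.Icc 0 T := fun k hk => by
    have : (k : ℝ) ≤ Nt := by exact_mod_cast hk
    exact ⟨by positivity, by rw [← hNτ]; gcongr⟩
  set e : ℕ → ℕ → ℝ := fun k j => u (a + j * h) (k * τ) - U k j with he
  have he0 : ∀ k ≤ Nt, e k 0 = 0 := fun k hk => by
    simp [he, hU.boundary_left k hk, hu.boundary_left _ (hmem k hk)]
  have heN : ∀ k ≤ Nt, e k Nx = 0 := fun k hk => by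
    simp [he, hNh, hU.boundary_right k hk, hu.boundary_right _ (hmem k hk)]
  set R := C * (h ^ 2 + τ ^ 2) with hR
  have hR0 : 0 ≤ R := by positivity
  have hstep : ∀ k < Nt, TemperedDiffusion.gridNorm h Nx (e (k + 1))
      ≤ TemperedDiffusion.gridNorm h Nx (e k) + τ * (R * √(Nx * h)) := by
    intro k hk
    set V : ℕ → ℝ := fun i => (U k i + U (k + 1) i) / 2 with hV
    set W : ℕ → ℝ := fun i => (u (a + i * h) (k * τ) + u (a + i * h) ((k + 1 : ℕ) * τ)) / 2 with hW
    set E : ℕ → ℝ := fun i => (e k i + e (k + 1) i) / 2 with hE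
    have hEVW : E = fun i => W i - V i := by
      funext i
      simp only [hE, hW, hV, he]
      ring
    -- X is the residual of the exact solution in the scheme, which carries a factor τ. The energy
    -- estimate is applied with ρ = X/τ.
    set X : ℕ → ℝ := fun j => u (a + j * h) ((k + 1 : ℕ) * τ) - u (a + j * h) (k * τ) - τ *
        (l * TemperedDiffusion.leftWSGD α lam γ₁ γ₂ γ₃ h W j
          + r * TemperedDiffusion.rightWSGD α lam γ₁ γ₂ γ₃ h Nx W j
          - α * lam ^ (α - 1) * (l - r) * ((W (j + 1) - W (j - 1)) / (2 * h))
          + s (a + j * h) ((k + 1 / 2 : ℝ) * τ)) with hX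
    have hXb : ∀ j, 1 ≤ j → j < Nx → |X j / τ| ≤ R := by
      intro j hj hjN
      have key := htr Nx j h hh0 hNh hj hjN (k * τ) (hmem k hk.le) ((k + 1 : ℕ) * τ)
        (hmem (k + 1) hk) (by gcongr; omega) W rfl
      rw [show ((k + 1 : ℕ) : ℝ) * τ - k * τ = τ by push_cast; ring,
        show ((k : ℝ) * τ + (k + 1 : ℕ) * τ) / 2 = (k + 1 / 2 : ℝ) * τ by push_cast; ring] at key
      rw [abs_div, abs_of_pos hτ0, div_le_iff₀ hτ0, mul_comm R]
      exact key
    refine TemperedDiffusion.gridNorm_step_le hh0.le hτ0.le hR0 hXb ?_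
    refine TemperedDiffusion.error_energy_le (c := α * lam ^ (α - 1) * (l - r)) hα₁ hα₂ hγ' hlam
      hh0.le hτ0.le hl hr hNx hE (he0 k hk.le) (heN k hk.le) (he0 (k + 1) hk) (heN (k + 1) hk) ?_
    intro j hj hjN
    have hs := hU.step k hk j hj hjN
    simp only [← hV] at hs
    rw [mul_div_cancel₀ _ hτ0.ne', hEVW, TemperedDiffusion.leftWSGD_sub,
      TemperedDiffusion.rightWSGD_sub]
    simp only [he, hX]
    linear_combination (-1 : ℝ) * hs
  have hind : ∀ k ≤ Nt, TemperedDiffusion.gridNorm h Nx (e k) ≤ k * (τ * (R * √(Nx * h))) := by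
    intro k
    induction k with
    | zero =>
      intro _
      -- The scheme starts from the exact initial values at the interior nodes, so the error
      -- recursion starts from zero.
      have : TemperedDiffusion.gridNorm h Nx (e 0) = 0 := by
        rw [TemperedDiffusion.gridNorm, Finset.sum_eq_zero, mul_zero, Real.sqrt_zero]
        intro j hj
        rw [Finset.mem_Ico] at hj
        have hjN : (j : ℝ) + 1 ≤ Nx := by exact_mod_cast hj.2
        have hj1 : (1 : ℝ) ≤ j := by exact_mod_cast hj.1
        have hx : a + j * h ∈ Set.Ioo a b := by
          have p1 : ((j : ℝ) + 1) * h ≤ Nx * h := by gcongr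
          have p2 : 0 < (j : ℝ) * h := by positivity
          constructor <;> linarith
        simp [he, hU.initial j hj.1 hj.2, hu.initial _ hx]
      simp [this]
    | succ k ih =>
      intro hk
      have p1 := ih (by omega)
      have p2 := hstep k (by omega)
      push_cast
      linarith
  refine (hind n hn).trans ?_
  rw [hNh, hR]
  have hnT := (hmem n hn).2
  calc (n : ℝ) * (τ * (C * (h ^ 2 + τ ^ 2) * √(b - a)))
      = n * τ * (C * √(b - a) * (τ ^ 2 + h ^ 2)) := by ring
    _ ≤ T * (C * √(b - a) * (τ ^ 2 + h ^ 2)) := by gcongr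
    _ ≤ _ := by
        have : 0 ≤ τ ^ 2 + h ^ 2 := by positivity
        linarith
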